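/- Let $d\ge 1$, $\alpha<d$, and consider $D$-level systems on the open lattice $\Gamma=\Gamma_L=\{1,\dots,L\}^d$ with $N=L^d$ sites; site $j$ has position $\mathbf r_j$ and rescaled coordinate $\mathbf x_j=\mathbf r_j/L$. Let $h=h^\dagger$ act on $\mathbb C^D$, let $V=V^\dagger$ act on $\mathbb C^D\otimes\mathbb C^D$, let $V'$ be $V$ with the two tensor factors exchanged, let $L_\mu$ be finitely many operators on $\mathbb C^D$, and let $\kappa_\mu,w_\mu,w^0_\mu\in\mathbb R$. Write $\mathcal D_{A,B}[X]=AXB^\dagger-\tfrac12\{B^\dagger A,X\}$ and $$\mathcal L_1[X]=-i[h,X]+\sum_\mu\kappa_\mu\mathcal D_{L_\mu,L_\mu}[X],\qquad \mathcal L_{12}[X]=-\tfrac i2[V+V',X]+\sum_\mu\tfrac{w_\mu}{2}\big(\mathcal D_{L_\mu\otimes 1,\,1\otimes L_\mu}+\mathcal D_{1\otimes L_\mu,\,L_\mu\otimes 1}\big)[X].$$ Let $c_\alpha^N=\sum_{j\in\Gamma}\|\mathbf r_j\|^{-\alpha}$ and consider the homogeneous many-body generator $$\mathcal L_N=\sum_{k\in\Gamma}\mathcal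 L_1^{(k)}+\frac1{2c_\alpha^N}\Big(\sum_{j\ne k}\frac{\mathcal L_{12}^{(jk)}}{\|\mathbf r_j-\mathbf r_k\|^{\alpha}}+\sum_{k}\sum_\mu w^0_\mu\,\mathcal D_{L^{(k)}_\mu,L^{(k)}_\mu}\Big),$$ assumed to generate a completely positive dynamics $e^{t\mathcal L_N}$, $t\ge 0$, for every $L\ge1$. For each $L$ let $\varrho_N=\bigotimes_{j\in\Gamma}\varrho_N^{(\mathbf x_j)}$ be an initial product state. Assume that the single-site density matrices converge in trace norm, $\varrho_N^{(\mathbf x_j)}\to\varrho_{\infty,0}^{(\mathbf x)}$ whenever $L\to\infty$ and $\mathbf x_j\to\mathbf x\in[0,1]^d$, and that $\mathbf x\mapsto\varrho_{\infty,0}^{(\mathbf x)}$ is continuous in trace norm on $[0,1]^d$. Then the following hold. 1. The limit $\theta(\alpha)=\lim_{N\to\infty}N^{1-\alpha/d}/c_\alpha^N$ exists in $\mathbb R$. 2. For every $L\ge 1$ the mean-field equations $$\dot{\tilde\varrho}_{N,t}^{(j)}=\mathcal L_1[\tilde\varrho_{N,t}^{(j)}]+\sum_{k\ne j}\frac{\mathrm{tr}_2\big(\mathcal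 L_{12}[\tilde\varrho_{N,t}^{(j)}\otimes\tilde\varrho_{N,t}^{(k)}]\big)}{c_\alpha^N\|\mathbf r_j-\mathbf r_k\|^\alpha},\qquad \tilde\varrho_{N,0}^{(j)}=\varrho_N^{(\mathbf x_j)},$$ have a solution on $[0,\infty)$, and every solution consists of density matrices. 3. There are density matrices $\tilde\varrho_{\infty,t}^{(\mathbf x)}$ ($\mathbf x\in[0,1]^d$, $t\ge0$), continuous in $\mathbf x$ in trace norm for every $t\ge0$, with initial value $\varrho_{\infty,0}^{(\mathbf x)}$ at $t=0$, which satisfy for all $\mathbf x$ and all $t\ge 0$ $$\dot{\tilde\varrho}_{\infty,t}^{(\mathbf x)}=\mathcal L_1[\tilde\varrho_{\infty,t}^{(\mathbf x)}]+\theta(\alpha)\int_{[0,1]^d}\frac{\mathrm{tr}_2\big(\mathcal L_{12}[\tilde\varrho_{\infty,t}^{(\mathbf x)}\otimes\tilde\varrho_{\infty,t}^{(\mathbf y)}]\big)}{\|\mathbf x-\mathbf y\|^\alpha}\,d\mathbf y$$ with an absolutely convergent integral; this is the only solution consisting of density matrices. For every $t\ge0$ and $\mathbf x\in[0,1]^d$,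 $\tilde\varrho_{N,t}^{(j)}\to\tilde\varrho_{\infty,t}^{(\mathbf x)}$ in trace norm whenever $L\to\infty$ and $\mathbf x_j\to\mathbf x$. -/

import Mathlib

open scoped Matrix Kronecker ComplexOrder
open Filter Topology MeasureTheory

noncomputable section

namespace LongRange

/-! ### States and the trace norm -/

/-- Density matrices: positive semidefinite with unit trace. -/
def IsState {n : Type*} [Fintype n] (ρ : Matrix n n ℂ) : Prop :=
  ρ.PosSemidef ∧ ρ.trace = 1

/-- The trace norm: the sum of the singular values, i.e. of the square roots of the eigenvalues
of `Aᴴ * A`. -/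
def traceNorm {n : Type*} [Fintype n] [DecidableEq n] (A : Matrix n n ℂ) : ℝ :=
  ∑ i, √((Matrix.isHermitian_conjTranspose_mul_self A).eigenvalues i)

/-- The partial trace over the second tensor factor. -/
def partialTrace₂ {n p : Type*} [Fintype p] (X : Matrix (n × p) (n × p) ℂ) : Matrix n n ℂ :=
  Matrix.of fun a b => ∑ c, X (a, c) (b, c)

/-! ### Lindblad generators -/

section Generators

variable {n : Type*} [Fintype n] [DecidableEq n] {m : ℕ}

/-- `X ↦ [H, X]`. -/
def commMap (H : Matrix n n ℂ) : Matrix n n ℂ →ₗ[ℂ] Matrix n n ℂ :=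
  LinearMap.mulLeft ℂ H - LinearMap.mulRight ℂ H

/-- `X ↦ A X Bᴴ - (1/2) {Bᴴ A, X}`. -/
def dissMap (A B : Matrix n n ℂ) : Matrix n n ℂ →ₗ[ℂ] Matrix n n ℂ :=
  LinearMap.mulLeftRight ℂ (A, Bᴴ)
    - (1 / 2 : ℂ) • (LinearMap.mulLeft ℂ (Bᴴ * A) + LinearMap.mulRight ℂ (Bᴴ * A))

/-- The single-site term
`X ↦ -i [H, X] + ∑_μ κ_μ (A_μ X A_μᴴ - (1/2) {A_μᴴ A_μ, X})`. -/
def singleGen (H : Matrix n n ℂ) (κ : Fin m → ℝ) (A : Fin m → Matrix n n ℂ) :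
    Matrix n n ℂ →ₗ[ℂ] Matrix n n ℂ :=
  (-Complex.I) • commMap H + ∑ μ, (κ μ : ℂ) • dissMap (A μ) (A μ)

/-- The two-site term
`X ↦ -(i/2) [V₁ + V₂, X] + ∑_μ (w_μ / 2) (A_μ X B_μᴴ - (1/2) {B_μᴴ A_μ, X})`
`+ ∑_μ (w_μ / 2) (B_μ X A_μᴴ - (1/2) {A_μᴴ B_μ, X})`,
where `A_μ` and `B_μ` are the jump operators of the first and of the second site. -/
def pairGen (V₁ V₂ : Matrix n n ℂ) (w : Fin m → ℝ) (A B : Fin m → Matrix n n ℂ) :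
    Matrix n n ℂ →ₗ[ℂ] Matrix n n ℂ :=
  (-Complex.I / 2) • commMap (V₁ + V₂)
    + ∑ μ, ((w μ : ℂ) / 2) • (dissMap (A μ) (B μ) + dissMap (B μ) (A μ))

/-- Complete positivity: `id_k ⊗ Φ` preserves positive semidefiniteness for every `k`. -/
def IsCompletelyPositive (Φ : Matrix n n ℂ → Matrix n n ℂ) : Prop :=
  ∀ (k : ℕ) (X : Matrix (Fin k × n) (Fin k × n) ℂ), X.PosSemidef →
    (Matrix.of fun (a b : Fin k × n) =>
      Φ (Matrix.of fun σ τ => X (a.1, σ) (b.1, τ)) a.2 b.2).PosSemidef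

/-- The linear map `G` generates a completely positive dynamics: the solution map `Φ t` of the
master equation `d/dt X = G[X]` (that is, `exp (t G)`) is completely positive for every `t ≥ 0`.
Derivatives of matrix-valued functions are taken entry by entry. -/
def GeneratesCP (G : Matrix n n ℂ →ₗ[ℂ] Matrix n n ℂ) : Prop :=
  ∃ Φ : ℝ → Matrix n n ℂ →ₗ[ℂ] Matrix n n ℂ,
    Φ 0 = LinearMap.id ∧
    (∀ t : ℝ, 0 ≤ t → ∀ X a b,
      HasDerivWithinAt (fun s => Φ s X a b) (G (Φ t X) a b) (Set.Ici 0) t) ∧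
    ∀ t : ℝ, 0 ≤ t → IsCompletelyPositive (Φ t)

end Generators

/-! ### The lattice -/

/-- The `d`-dimensional lattice with `N = L ^ d` sites. -/
abbrev Site (d L : ℕ) : Type := Fin d → Fin L

/-- The position of a site; its entries take the values `1, …, L`. -/
def pos {d L : ℕ} (j : Site d L) : EuclideanSpace ℝ (Fin d) :=
  WithLp.toLp 2 fun i => ((j i : ℕ) : ℝ) + 1

/-- The rescaled coordinate `x_j = r_j / L`. -/
def coord {d L : ℕ} (j : Site d L) : EuclideanSpace ℝ (Fin d) :=
  (L : ℝ)⁻¹ • pos j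

/-- The Euclidean distance of two sites (open boundary conditions). -/
def siteDist {d L : ℕ} (j k : Site d L) : ℝ := ‖pos j - pos k‖

/-- The Kac factor `∑_j ‖r_j‖ ^ (-α)`. -/
def kac (d : ℕ) (α : ℝ) (L : ℕ) : ℝ := ∑ j : Site d L, (‖pos j‖ ^ α)⁻¹

/-- The cube `[0,1]^d`. -/
def cube (d : ℕ) : Set (EuclideanSpace ℝ (Fin d)) := {x | ∀ i, x i ∈ Set.Icc (0 : ℝ) 1}

/-- The operator `A` acting on site `j`, as an operator on `⨂_{i ∈ Γ} ℂ^D`, whose standard basis is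
indexed by the maps `Γ → Fin D`. -/
def siteOp {Γ : Type*} [Fintype Γ] [DecidableEq Γ] {D : ℕ} (j : Γ)
    (A : Matrix (Fin D) (Fin D) ℂ) : Matrix (Γ → Fin D) (Γ → Fin D) ℂ :=
  Matrix.of fun σ τ => if ∀ i, i ≠ j → σ i = τ i then A (σ j) (τ j) else 0

/-- The two-body operator `V` acting on the sites `j ≠ k`, with first factor `j` and second
factor `k`. -/
def pairOp {Γ : Type*} [Fintype Γ] [DecidableEq Γ] {D : ℕ} (j k : Γ)
    (V : Matrix (Fin D × Fin D) (Fin D × Fin D) ℂ) : Matrix (Γ → Fin D) (Γ → Fin D) ℂ :=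
  Matrix.of fun σ τ =>
    if ∀ i, i ≠ j → i ≠ k → σ i = τ i then V (σ j, σ k) (τ j, τ k) else 0

/-! ### The homogeneous long-range model -/

/-- The parameters of a homogeneous model of `D`-level systems: single-site Hamiltonian `h`,
two-body interaction `V`, jump operators `ℓ μ` with local rates `κ μ`, and collective dissipation
coefficients `w μ` (distinct sites) and `w₀ μ` (coinciding sites). -/
structure Model (D m : ℕ) where
  h : Matrix (Fin D) (Fin D) ℂ
  V : Matrix (Fin D × Fin D) (Fin D × Fin D) ℂ
  ℓ : Fin m → Matrix (Fin D) (Fin D) ℂ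
  κ : Fin m → ℝ
  w : Fin m → ℝ
  w₀ : Fin m → ℝ
  h_herm : h.IsHermitian
  V_herm : V.IsHermitian

namespace Model

variable {D m : ℕ} (M : Model D m)

/-- The single-site generator `ℒ₁`. -/
def gen₁ : Matrix (Fin D) (Fin D) ℂ →ₗ[ℂ] Matrix (Fin D) (Fin D) ℂ :=
  singleGen M.h M.κ M.ℓ

/-- The two-site generator `ℒ₁₂`. -/
def gen₁₂ :
    Matrix (Fin D × Fin D) (Fin D × Fin D) ℂ →ₗ[ℂ] Matrix (Fin D × Fin D) (Fin D × Fin D) ℂ :=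
  pairGen M.V (M.V.submatrix Prod.swap Prod.swap) M.w
    (fun μ => M.ℓ μ ⊗ₖ (1 : Matrix (Fin D) (Fin D) ℂ))
    (fun μ => (1 : Matrix (Fin D) (Fin D) ℂ) ⊗ₖ M.ℓ μ)

/-- The many-body generator
`ℒ_N = ∑_k ℒ_k + (1 / (2 c)) ∑_{j,k} ℒ_{jk} / [δ_{jk} + (1 - δ_{jk}) ‖r_j - r_k‖ ^ α]`
on the open lattice of side `L`, with `c` the Kac factor. -/
def fullGen (d : ℕ) (α : ℝ) (L : ℕ) :
    Matrix (Site d L → Fin D) (Site d L → Fin D) ℂ →ₗ[ℂ]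
      Matrix (Site d L → Fin D) (Site d L → Fin D) ℂ :=
  ∑ k : Site d L, singleGen (siteOp k M.h) M.κ (fun μ => siteOp k (M.ℓ μ))
    + ((1 / (2 * kac d α L) : ℝ) : ℂ) • ∑ j : Site d L, ∑ k : Site d L,
        if j = k then
          pairGen 0 0 M.w₀ (fun μ => siteOp k (M.ℓ μ)) (fun μ => siteOp k (M.ℓ μ))
        else
          (((siteDist j k ^ α)⁻¹ : ℝ) : ℂ) •
            pairGen (pairOp j k M.V) (pairOp k j M.V) M.w
              (fun μ => siteOp j (M.ℓ μ)) (fun μ => siteOp k (M.ℓ μ))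

/-- The collision operator `tr₂ (ℒ₁₂ [ρ ⊗ σ])`. -/
def collision (ρ σ : Matrix (Fin D) (Fin D) ℂ) : Matrix (Fin D) (Fin D) ℂ :=
  partialTrace₂ (M.gen₁₂ (ρ ⊗ₖ σ))

/-- `r j t` (`j` a site, `t ≥ 0`) are the mean-field single-site states on the lattice of side `L`
with initial data `ρ₀`: they solve
`d/dt r_j = ℒ₁[r_j] + ∑_{k ≠ j} tr₂ (ℒ₁₂ [r_j ⊗ r_k]) / (c ‖r_j - r_k‖ ^ α)` on `[0, ∞)`. -/
def IsMeanFieldSolution {d : ℕ} (α : ℝ) (L : ℕ) (ρ₀ : Site d L → Matrix (Fin D) (Fin D) ℂ)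
    (r : Site d L → ℝ → Matrix (Fin D) (Fin D) ℂ) : Prop :=
  ∀ j, r j 0 = ρ₀ j ∧ ∀ t : ℝ, 0 ≤ t → ∀ a b,
    HasDerivWithinAt (fun s => r j s a b)
      (M.gen₁ (r j t) a b + ∑ k ∈ Finset.univ.erase j,
        (kac d α L * siteDist j k ^ α)⁻¹ • M.collision (r j t) (r k t) a b)
      (Set.Ici 0) t

/-- `R x t` (`x ∈ [0,1]^d`, `t ≥ 0`) solves
`d/dt R_x = ℒ₁[R_x] + θ ∫_{[0,1]^d} tr₂ (ℒ₁₂ [R_x ⊗ R_y]) / ‖x - y‖ ^ α dy`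
on `[0, ∞)`, with initial data `R₀`, and the integral converges absolutely. -/
def IsLimitSolution {d : ℕ} (α θ : ℝ)
    (R₀ : EuclideanSpace ℝ (Fin d) → Matrix (Fin D) (Fin D) ℂ)
    (R : EuclideanSpace ℝ (Fin d) → ℝ → Matrix (Fin D) (Fin D) ℂ) : Prop :=
  ∀ x ∈ cube d, R x 0 = R₀ x ∧ ∀ t : ℝ, 0 ≤ t → ∀ a b,
    IntegrableOn (fun y => (‖x - y‖ ^ α)⁻¹ • M.collision (R x t) (R y t) a b) (cube d) volume ∧
    HasDerivWithinAt (fun s => R x s a b)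
      (M.gen₁ (R x t) a b +
        θ • ∫ y in cube d, (‖x - y‖ ^ α)⁻¹ • M.collision (R x t) (R y t) a b)
      (Set.Ici 0) t

end Model

/-! ### The thermodynamic limit -/

/-- Convergence in trace norm in the thermodynamic limit: `r L j` tends to `R x` whenever
`L → ∞` and `x_j → x`, for every `x ∈ [0,1]^d`. -/
def ConvergesAlongSites {d D : ℕ} (r : (L : ℕ) → Site d L → Matrix (Fin D) (Fin D) ℂ)
    (R : EuclideanSpace ℝ (Fin d) → Matrix (Fin D) (Fin D) ℂ) : Prop :=
  ∀ x ∈ cube d, ∀ ε > 0, ∃ δ > 0, ∃ L₀ : ℕ, ∀ L ≥ L₀, ∀ j : Site d L,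
    ‖coord j - x‖ < δ → traceNorm (r L j - R x) < ε

/-- Continuity in trace norm on the cube `[0,1]^d`. -/
def TraceNormContinuous {d D : ℕ}
    (R : EuclideanSpace ℝ (Fin d) → Matrix (Fin D) (Fin D) ℂ) : Prop :=
  ∀ x ∈ cube d, Tendsto (fun y => traceNorm (R y - R x)) (𝓝[cube d] x) (𝓝 0)

end LongRange

end

/-!
A completely positive many-body dynamics constrains the single-site data only through the local
rates `κ`, and mean-field theory preserves exactly this constraint; the rest is a stability argument
for differential equations with a singular but integrable kernel.

*Positivity.* A generator `G` of a completely positive dynamics satisfies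
`⟨φ, G[ψ ψᴴ] φ⟩ ≥ 0` for orthogonal `φ`, `ψ`, as otherwise `ψ ψᴴ` would leave the positive cone at
once. Tested with product vectors that differ at one site only, all interactions between distinct
sites drop out of the many-body generator, and `κ + w₀ / (2 c)` remains. Since the Kac factor `c`
diverges, the rates `κ` alone have the same property (`Model.LocallyPositive`,
`Model.locallyPositive`). The partial trace turns the two-site generator into a commutator:
`tr₂ (ℒ₁₂ [ρ ⊗ σ]) = [K_σ, ρ]` (`Model.collision_eq_commutator`). Such a term vanishes between kernel
vectors of a positive matrix, so that Hermitian solutions of `r' = ℒ₁[r] + [K(t), r]` stay positive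
(`Model.LocallyPositive.posSemidef_of_hasDerivWithinAt`); Hermiticity and the trace are preserved
because the equation commutes with the Hermitian conjugation and its right side is traceless.

*Existence.* The finite equations and the limit equation are both of the form
`f' = ℒ₁[f] + tr₂ (ℒ₁₂ [f ⊗ T f])` in the Banach space of continuous matrix fields on a compact space
(the sites, or the cube), with a bounded linear averaging operator `T`. The vector field is locally
Lipschitz, and the states form a closed bounded invariant set, hence solutions are global
(`Model.LocallyPositive.exists_solution`).

*Limit.* In rescaled coordinates the couplings are `N ^ (1 - α / d) / c` times
`N⁻¹ ‖x_j - x_k‖ ^ (-α)`. A lattice sum against the kernel is an integral of a step function: the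
kernel is rounded to the grid, and for a lattice point `x_j` the rounded kernel depends on the
difference `x_j - y` only. Thus the discretization error is bounded, uniformly in `j`, by one `L¹`
distance, which tends to zero by dominated convergence (`tendsto_kerError`,
`norm_latticeSum_sub_integral_le`). With `x = 0` this gives the limit of `N ^ (1 - α / d) / c`
(`tendsto_kacRatio`). With the limit solution inserted it shows that this solution almost satisfies
the finite equations, and a Grönwall inequality for families of curves
(`norm_le_mul_exp_of_uniform_deriv_bound`) yields convergence; the same inequality yields uniqueness.
-/

noncomputable section

namespace LongRange

attribute [local instance] Matrix.normedAddCommGroup Matrix.normedSpace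

/-! ### The trace norm and states -/

section TraceNorm
variable {n : Type*} [Fintype n] [DecidableEq n]

theorem sum_eigenvalues_conjTranspose_mul_self (A : Matrix n n ℂ) :
    ∑ i, (Matrix.isHermitian_conjTranspose_mul_self A).eigenvalues i = ∑ a, ∑ b, ‖A a b‖ ^ 2 := by
  have h := (Matrix.isHermitian_conjTranspose_mul_self A).trace_eq_sum_eigenvalues
  have h2 : (Aᴴ * A).trace = ((∑ a, ∑ b, ‖A a b‖ ^ 2 : ℝ) : ℂ) := by
    rw [Finset.sum_comm]
    simp only [Matrix.trace, Matrix.diag, Matrix.mul_apply, Matrix.conjTranspose_apply]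
    push_cast
    refine Finset.sum_congr rfl fun i _ => Finset.sum_congr rfl fun j _ => ?_
    simpa using Complex.conj_mul' (A j i)
  rw [h2] at h
  exact Complex.ofReal_injective (by rw [h]; push_cast; rfl)

theorem eigenvalues_conjTranspose_mul_self_nonneg (A : Matrix n n ℂ) (i : n) :
    0 ≤ (Matrix.isHermitian_conjTranspose_mul_self A).eigenvalues i :=
  (Matrix.posSemidef_conjTranspose_mul_self A).eigenvalues_nonneg i

theorem norm_le_traceNorm (A : Matrix n n ℂ) : ‖A‖ ≤ traceNorm A := by
  have h0 : 0 ≤ traceNorm A := Finset.sum_nonneg fun i _ => Real.sqrt_nonneg _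
  refine (Matrix.norm_le_iff h0).2 fun a b => ?_
  refine abs_le_of_sq_le_sq' ?_ h0 |>.2
  calc ‖A a b‖ ^ 2 ≤ ∑ a, ∑ b, ‖A a b‖ ^ 2 :=
        (Finset.single_le_sum (f := fun b => ‖A a b‖ ^ 2) (fun _ _ => by positivity)
          (Finset.mem_univ b)).trans
        (Finset.single_le_sum (f := fun a => ∑ b, ‖A a b‖ ^ 2)
          (fun _ _ => Finset.sum_nonneg fun _ _ => by positivity) (Finset.mem_univ a))
    _ = ∑ i, (√((Matrix.isHermitian_conjTranspose_mul_self A).eigenvalues i)) ^ 2 := by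
        rw [← sum_eigenvalues_conjTranspose_mul_self]
        refine Finset.sum_congr rfl fun i _ => ?_
        rw [Real.sq_sqrt (eigenvalues_conjTranspose_mul_self_nonneg A i)]
    _ ≤ traceNorm A ^ 2 := by
        rw [sq (traceNorm A)]
        conv_rhs => enter [1]; rw [traceNorm]
        rw [Finset.sum_mul]
        refine Finset.sum_le_sum fun i hi => ?_
        rw [sq]
        exact mul_le_mul_of_nonneg_left (Finset.single_le_sum (fun i _ => Real.sqrt_nonneg _) hi)
          (Real.sqrt_nonneg _)

theorem traceNorm_le_norm (A : Matrix n n ℂ) :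
    traceNorm A ≤ (Fintype.card n : ℝ) ^ 2 * ‖A‖ := by
  have key : ∀ i, √((Matrix.isHermitian_conjTranspose_mul_self A).eigenvalues i)
      ≤ Fintype.card n * ‖A‖ := fun i => by
    refine Real.sqrt_le_iff.2 ⟨by positivity, ?_⟩
    calc _ ≤ ∑ i, (Matrix.isHermitian_conjTranspose_mul_self A).eigenvalues i :=
          Finset.single_le_sum
            (fun i _ => eigenvalues_conjTranspose_mul_self_nonneg A i) (Finset.mem_univ i)
      _ = ∑ a, ∑ b, ‖A a b‖ ^ 2 := sum_eigenvalues_conjTranspose_mul_self A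
      _ ≤ ∑ _a : n, ∑ _b : n, ‖A‖ ^ 2 := by
          gcongr with a _ b _
          exact Matrix.norm_entry_le_entrywise_sup_norm A
      _ = (Fintype.card n * ‖A‖) ^ 2 := by simp; ring
  calc traceNorm A ≤ ∑ _i : n, (Fintype.card n * ‖A‖) := Finset.sum_le_sum fun i _ => key i
    _ = _ := by simp; ring

omit [DecidableEq n] in
open scoped MatrixOrder in
theorem exists_eq_conjTranspose_mul_self {ρ : Matrix n n ℂ} (h : ρ.PosSemidef) :
    ∃ B : Matrix n n ℂ, ρ = Bᴴ * B := by
  classical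
  exact CStarAlgebra.nonneg_iff_eq_star_mul_self.1 h.nonneg

omit [DecidableEq n] in
/-- The entries of a density matrix have modulus at most one. -/
theorem IsState.norm_le_one {ρ : Matrix n n ℂ} (h : IsState ρ) : ‖ρ‖ ≤ 1 := by
  obtain ⟨B, rfl⟩ := exists_eq_conjTranspose_mul_self h.1
  have htr : ∑ a, ∑ c, ‖B c a‖ ^ 2 = 1 := by
    have := h.2
    simp only [Matrix.trace, Matrix.diag, Matrix.mul_apply, Matrix.conjTranspose_apply] at this
    refine Complex.ofReal_injective ?_
    rw [Complex.ofReal_one, ← this]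
    push_cast
    refine Finset.sum_congr rfl fun i _ => Finset.sum_congr rfl fun j _ => ?_
    simpa using (Complex.conj_mul' (B j i)).symm
  have hcol : ∀ a, ∑ c, ‖B c a‖ ^ 2 ≤ 1 := fun a => htr ▸
    Finset.single_le_sum (f := fun a => ∑ c, ‖B c a‖ ^ 2)
      (fun _ _ => Finset.sum_nonneg fun _ _ => by positivity) (Finset.mem_univ a)
  refine (Matrix.norm_le_iff zero_le_one).2 fun a b => ?_
  calc ‖(Bᴴ * B) a b‖ ≤ ∑ c, ‖B c a‖ * ‖B c b‖ := by
        rw [Matrix.mul_apply]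
        exact (norm_sum_le _ _).trans_eq (by simp)
    _ ≤ ∑ c, (‖B c a‖ ^ 2 + ‖B c b‖ ^ 2) / 2 :=
        Finset.sum_le_sum fun c _ => by nlinarith [sq_nonneg (‖B c a‖ - ‖B c b‖)]
    _ ≤ 1 := by
        rw [← Finset.sum_div, Finset.sum_add_distrib]
        linarith [hcol a, hcol b]

omit [DecidableEq n] in
theorem isClosed_isState : IsClosed {ρ : Matrix n n ℂ | IsState ρ} := by
  have : {ρ : Matrix n n ℂ | IsState ρ} =
      {ρ | ρᴴ = ρ} ∩ (⋂ x : n → ℂ, {ρ | 0 ≤ star x ⬝ᵥ (ρ *ᵥ x)}) ∩ {ρ | ρ.trace = 1} := by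
    ext ρ
    simp [IsState, Matrix.posSemidef_iff_dotProduct_mulVec, Matrix.IsHermitian]
  rw [this]
  refine ((isClosed_eq (by fun_prop) (by fun_prop)).inter ?_).inter
    (isClosed_eq (by fun_prop) (by fun_prop))
  refine isClosed_iInter fun x => isClosed_le (by fun_prop) (by fun_prop)

end TraceNorm

/-! ### The mean-field equation has commutator form -/

section PartialTrace
variable {n p : Type*} [Fintype p]

theorem partialTrace₂_kronecker (P : Matrix n n ℂ) (Q : Matrix p p ℂ) :
    partialTrace₂ (P ⊗ₖ Q) = Q.trace • P := by
  ext a b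
  simp [partialTrace₂, Matrix.trace, Finset.mul_sum, mul_comm]

theorem partialTrace₂_add (X Y : Matrix (n × p) (n × p) ℂ) :
    partialTrace₂ (X + Y) = partialTrace₂ X + partialTrace₂ Y := by
  ext a b
  simp [partialTrace₂, Finset.sum_add_distrib]

theorem partialTrace₂_smul (c : ℂ) (X : Matrix (n × p) (n × p) ℂ) :
    partialTrace₂ (c • X) = c • partialTrace₂ X := by
  ext a b
  simp [partialTrace₂, Finset.mul_sum]

theorem partialTrace₂_sub (X Y : Matrix (n × p) (n × p) ℂ) :
    partialTrace₂ (X - Y) = partialTrace₂ X - partialTrace₂ Y := by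
  ext a b
  simp [partialTrace₂, Finset.sum_sub_distrib]

theorem partialTrace₂_sum {ι : Type*} (s : Finset ι) (X : ι → Matrix (n × p) (n × p) ℂ) :
    partialTrace₂ (∑ i ∈ s, X i) = ∑ i ∈ s, partialTrace₂ (X i) := by
  ext a b
  simp only [partialTrace₂, Matrix.of_apply, Matrix.sum_apply]
  exact Finset.sum_comm

/-- The partial expectation `tr₂ (W (1 ⊗ σ))` of a two-site operator. -/
def contract (W : Matrix (n × p) (n × p) ℂ) (σ : Matrix p p ℂ) : Matrix n n ℂ :=
  Matrix.of fun a b => ∑ c, ∑ e, W (a, c) (b, e) * σ e c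

theorem partialTrace₂_mul_kronecker [Fintype n] (W : Matrix (n × p) (n × p) ℂ) (ρ : Matrix n n ℂ)
    (σ : Matrix p p ℂ) : partialTrace₂ (W * ρ ⊗ₖ σ) = contract W σ * ρ := by
  ext a b
  simp only [partialTrace₂, contract, Matrix.of_apply, Matrix.mul_apply, Fintype.sum_prod_type,
    Matrix.kroneckerMap_apply, Finset.sum_mul]
  rw [Finset.sum_comm]
  refine Finset.sum_congr rfl fun i _ => Finset.sum_congr rfl fun j _ =>
    Finset.sum_congr rfl fun k _ => by ring

theorem partialTrace₂_kronecker_mul [Fintype n] (W : Matrix (n × p) (n × p) ℂ) (ρ : Matrix n n ℂ)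
    (σ : Matrix p p ℂ) : partialTrace₂ (ρ ⊗ₖ σ * W) = ρ * contract W σ := by
  ext a b
  simp only [partialTrace₂, contract, Matrix.of_apply, Matrix.mul_apply, Fintype.sum_prod_type,
    Matrix.kroneckerMap_apply, Finset.mul_sum]
  rw [Finset.sum_comm]
  refine Finset.sum_congr rfl fun i _ => ?_
  rw [Finset.sum_comm]
  refine Finset.sum_congr rfl fun j _ => Finset.sum_congr rfl fun k _ => by ring

theorem conjTranspose_contract (W : Matrix (n × p) (n × p) ℂ) (σ : Matrix p p ℂ) :
    (contract W σ)ᴴ = contract Wᴴ σᴴ := by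
  ext a b
  simp only [contract, Matrix.of_apply, Matrix.conjTranspose_apply, star_sum, star_mul']
  exact Finset.sum_comm

end PartialTrace

namespace Model
variable {D m : ℕ} (M : Model D m)

/-- The effect of a partner in the state `σ`: the collision operator is the commutator with this
matrix, which is `-i` times the mean-field Hamiltonian. -/
def meanFieldOp (σ : Matrix (Fin D) (Fin D) ℂ) : Matrix (Fin D) (Fin D) ℂ :=
  (-Complex.I / 2) • contract (M.V + M.V.submatrix Prod.swap Prod.swap) σ
    + ∑ μ, ((M.w μ : ℂ) / 4) •
      (((M.ℓ μ)ᴴ * σ).trace • M.ℓ μ - (M.ℓ μ * σ).trace • (M.ℓ μ)ᴴ)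

theorem collision_eq_commutator (ρ σ : Matrix (Fin D) (Fin D) ℂ) :
    M.collision ρ σ = M.meanFieldOp σ * ρ - ρ * M.meanFieldOp σ := by
  have key : ∀ A : Matrix (Fin D) (Fin D) ℂ,
      partialTrace₂ (dissMap (A ⊗ₖ (1 : Matrix (Fin D) (Fin D) ℂ))
          ((1 : Matrix (Fin D) (Fin D) ℂ) ⊗ₖ A) (ρ ⊗ₖ σ)
        + dissMap ((1 : Matrix (Fin D) (Fin D) ℂ) ⊗ₖ A)
          (A ⊗ₖ (1 : Matrix (Fin D) (Fin D) ℂ)) (ρ ⊗ₖ σ))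
      = (1 / 2 : ℂ) • (((Aᴴ * σ).trace • A - (A * σ).trace • Aᴴ) * ρ
          - ρ * ((Aᴴ * σ).trace • A - (A * σ).trace • Aᴴ)) := by
    intro A
    simp only [dissMap, LinearMap.sub_apply, LinearMap.smul_apply, LinearMap.add_apply,
      LinearMap.mulLeftRight_apply, LinearMap.mulLeft_apply, LinearMap.mulRight_apply,
      partialTrace₂_add, partialTrace₂_sub, partialTrace₂_smul, Matrix.conjTranspose_kronecker,
      Matrix.conjTranspose_one, ← Matrix.mul_kronecker_mul, Matrix.one_mul, Matrix.mul_one,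
      partialTrace₂_kronecker]
    rw [Matrix.trace_mul_comm σ A, Matrix.trace_mul_comm σ Aᴴ]
    simp only [smul_sub, smul_add, smul_smul, Matrix.sub_mul, Matrix.mul_sub, Matrix.smul_mul,
      Matrix.mul_smul]
    module
  rw [collision, gen₁₂, pairGen, LinearMap.add_apply, LinearMap.smul_apply, LinearMap.sum_apply,
    partialTrace₂_add, partialTrace₂_smul, partialTrace₂_sum, commMap, LinearMap.sub_apply,
    LinearMap.mulLeft_apply, LinearMap.mulRight_apply, partialTrace₂_sub,
    partialTrace₂_mul_kronecker, partialTrace₂_kronecker_mul, meanFieldOp]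
  simp only [LinearMap.smul_apply, partialTrace₂_smul, LinearMap.add_apply (dissMap _ _), key]
  rw [Matrix.add_mul, Matrix.mul_add, Finset.sum_mul, Finset.mul_sum, add_sub_add_comm,
    ← Finset.sum_sub_distrib]
  congr 1
  · rw [Matrix.smul_mul, Matrix.mul_smul, smul_sub]
  · refine Finset.sum_congr rfl fun μ _ => ?_
    rw [Matrix.smul_mul, Matrix.mul_smul, ← smul_sub, smul_smul]
    congr 1
    ring

theorem conjTranspose_meanFieldOp (σ : Matrix (Fin D) (Fin D) ℂ) :
    (M.meanFieldOp σ)ᴴ = -M.meanFieldOp σᴴ := by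
  have hV : (M.V + M.V.submatrix Prod.swap Prod.swap)ᴴ
      = M.V + M.V.submatrix Prod.swap Prod.swap := by
    rw [Matrix.conjTranspose_add, Matrix.conjTranspose_submatrix, M.V_herm]
  have h2 : ∀ A : Matrix (Fin D) (Fin D) ℂ, star (A * σ).trace = (Aᴴ * σᴴ).trace := fun A => by
    rw [← Matrix.trace_conjTranspose, Matrix.conjTranspose_mul, Matrix.trace_mul_comm]
  rw [meanFieldOp, Matrix.conjTranspose_add, Matrix.conjTranspose_smul, conjTranspose_contract, hV,
    Matrix.conjTranspose_sum, meanFieldOp, neg_add, ← neg_smul, ← Finset.sum_neg_distrib]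
  congr 1
  · simp [neg_div]
  · refine Finset.sum_congr rfl fun μ _ => ?_
    rw [Matrix.conjTranspose_smul, Matrix.conjTranspose_sub, Matrix.conjTranspose_smul,
      Matrix.conjTranspose_smul, h2, h2, Matrix.conjTranspose_conjTranspose, ← smul_neg, neg_sub]
    simp

theorem conjTranspose_collision (ρ σ : Matrix (Fin D) (Fin D) ℂ) :
    (M.collision ρ σ)ᴴ = M.collision ρᴴ σᴴ := by
  simp only [collision_eq_commutator, Matrix.conjTranspose_sub, Matrix.conjTranspose_mul,
    conjTranspose_meanFieldOp]
  noncomm_ring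

theorem trace_collision (ρ σ : Matrix (Fin D) (Fin D) ℂ) : (M.collision ρ σ).trace = 0 := by
  rw [collision_eq_commutator, Matrix.trace_sub, Matrix.trace_mul_comm, sub_self]

theorem gen₁_apply (X : Matrix (Fin D) (Fin D) ℂ) :
    M.gen₁ X = (-Complex.I) • (M.h * X - X * M.h) + ∑ μ, (M.κ μ : ℂ) •
      (M.ℓ μ * X * (M.ℓ μ)ᴴ
        - (1 / 2 : ℂ) • ((M.ℓ μ)ᴴ * M.ℓ μ * X + X * ((M.ℓ μ)ᴴ * M.ℓ μ))) := by
  simp [gen₁, singleGen, commMap, dissMap, Matrix.mul_assoc]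

theorem trace_gen₁ (X : Matrix (Fin D) (Fin D) ℂ) : (M.gen₁ X).trace = 0 := by
  rw [gen₁_apply, Matrix.trace_add, Matrix.trace_smul, Matrix.trace_sub, Matrix.trace_mul_comm,
    sub_self, smul_zero, zero_add, Matrix.trace_sum]
  refine Finset.sum_eq_zero fun μ _ => ?_
  rw [Matrix.trace_smul, Matrix.trace_sub, Matrix.trace_smul, Matrix.trace_add,
    Matrix.trace_mul_comm X, Matrix.trace_mul_comm _ (M.ℓ μ)ᴴ, ← Matrix.mul_assoc]
  simp only [smul_eq_mul]
  ring

theorem conjTranspose_gen₁ (X : Matrix (Fin D) (Fin D) ℂ) : (M.gen₁ X)ᴴ = M.gen₁ Xᴴ := by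
  rw [gen₁_apply, gen₁_apply, Matrix.conjTranspose_add, Matrix.conjTranspose_sum,
    Matrix.conjTranspose_smul, Matrix.conjTranspose_sub, Matrix.conjTranspose_mul,
    Matrix.conjTranspose_mul, M.h_herm]
  congr 1
  · simp only [star_neg, Complex.star_def, Complex.conj_I]
    module
  · refine Finset.sum_congr rfl fun μ _ => ?_
    simp [Matrix.conjTranspose_smul, Matrix.mul_assoc, add_comm]

end Model

/-! ### Positivity of the many-body dynamics constrains the local rates -/

section QuadForm
variable {n : Type*} [Fintype n]

/-- The functional `Y ↦ ⟨φ, Y φ⟩`. -/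
def quadForm (φ : n → ℂ) : Matrix n n ℂ →ₗ[ℂ] ℂ where
  toFun Y := star φ ⬝ᵥ (Y *ᵥ φ)
  map_add' Y Z := by rw [Matrix.add_mulVec, dotProduct_add]
  map_smul' c Y := by rw [Matrix.smul_mulVec, dotProduct_smul]; rfl

theorem quadForm_apply (φ : n → ℂ) (Y : Matrix n n ℂ) :
    quadForm φ Y = star φ ⬝ᵥ (Y *ᵥ φ) := rfl

theorem quadForm_eq_sum (φ : n → ℂ) (Y : Matrix n n ℂ) :
    quadForm φ Y = ∑ a, ∑ b, star (φ a) * (Y a b * φ b) := by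
  simp [quadForm_apply, dotProduct, Matrix.mulVec, Finset.mul_sum]

theorem star_dotProduct_conjTranspose_mulVec (B : Matrix n n ℂ) (φ ψ : n → ℂ) :
    star ψ ⬝ᵥ (Bᴴ *ᵥ φ) = star (star φ ⬝ᵥ (B *ᵥ ψ)) := by
  rw [Matrix.star_dotProduct, Matrix.star_mulVec, Matrix.conjTranspose_conjTranspose,
    ← Matrix.dotProduct_mulVec]

variable [DecidableEq n]

theorem quadForm_commMap {φ ψ : n → ℂ} (h : star φ ⬝ᵥ ψ = 0) (H : Matrix n n ℂ) :
    quadForm φ (commMap H (Matrix.vecMulVec ψ (star ψ))) = 0 := by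
  have h' : star ψ ⬝ᵥ φ = 0 := by rw [Matrix.star_dotProduct, h, star_zero]
  simp [quadForm_apply, commMap, Matrix.sub_mulVec, ← Matrix.mulVec_mulVec,
    Matrix.vecMulVec_mulVec, h, h']

theorem quadForm_dissMap {φ ψ : n → ℂ} (h : star φ ⬝ᵥ ψ = 0) (A B : Matrix n n ℂ) :
    quadForm φ (dissMap A B (Matrix.vecMulVec ψ (star ψ)))
      = (star φ ⬝ᵥ (A *ᵥ ψ)) * star (star φ ⬝ᵥ (B *ᵥ ψ)) := by
  have h' : star ψ ⬝ᵥ φ = 0 := by rw [Matrix.star_dotProduct, h, star_zero]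
  simp [quadForm_apply, dissMap, Matrix.sub_mulVec, Matrix.add_mulVec, ← Matrix.mulVec_mulVec,
    Matrix.vecMulVec_mulVec, h, h', Matrix.mulVec_smul, star_dotProduct_conjTranspose_mulVec,
    Matrix.smul_mulVec, mul_comm]

omit [DecidableEq n] in
/-- A completely positive dynamics cannot leave the positive cone at a boundary point: the
generator is nonnegative between orthogonal vectors. -/
theorem GeneratesCP.quadForm_nonneg {G : Matrix n n ℂ →ₗ[ℂ] Matrix n n ℂ} (hG : GeneratesCP G)
    {φ ψ : n → ℂ} (h : star φ ⬝ᵥ ψ = 0) :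
    0 ≤ (quadForm φ (G (Matrix.vecMulVec ψ (star ψ)))).re := by
  obtain ⟨Φ, h0, hΦ, hcp⟩ := hG
  set P := Matrix.vecMulVec ψ (star ψ) with hP
  have hpos : ∀ t, 0 ≤ t → 0 ≤ (quadForm φ (Φ t P)).re := by
    intro t ht
    have hX : (Matrix.of fun a b : Fin 1 × n => P a.2 b.2).PosSemidef :=
      (Matrix.posSemidef_vecMulVec_self_star ψ).submatrix (fun a : Fin 1 × n => a.2)
    have h1 := (hcp t ht 1 _ hX).submatrix (fun a : n => ((0 : Fin 1), a))
    have h2 := h1.dotProduct_mulVec_nonneg φ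
    exact (Complex.le_def.1 h2).1
  have hz : (quadForm φ (Φ 0 P)).re = 0 := by
    rw [h0, LinearMap.id_apply, quadForm_apply, hP, Matrix.vecMulVec_mulVec]
    simp [h]
  have hderiv : HasDerivWithinAt (fun s => (quadForm φ (Φ s P)).re) (quadForm φ (G P)).re
      (Set.Ici 0) 0 := by
    have h1 : HasDerivWithinAt (fun s => quadForm φ (Φ s P)) (quadForm φ (G P)) (Set.Ici 0) 0 := by
      simp only [quadForm_eq_sum]
      refine HasDerivWithinAt.fun_sum fun a _ => HasDerivWithinAt.fun_sum fun b _ => ?_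
      have := hΦ 0 le_rfl P a b
      rw [h0, LinearMap.id_apply] at this
      exact (this.mul_const (φ b)).const_mul (star (φ a))
    exact Complex.reCLM.hasFDerivAt.comp_hasDerivWithinAt (0 : ℝ) h1
  by_contra! hneg
  have hev := (hasDerivWithinAt_iff_tendsto_slope' (by simp)).1
    (hderiv.mono Set.Ioi_subset_Ici_self)
  obtain ⟨t, ht, ht0⟩ := ((hev.eventually (gt_mem_nhds hneg)).and self_mem_nhdsWithin).exists
  have ht0' : (0 : ℝ) < t := ht0
  rw [slope_def_field, hz, sub_zero, sub_zero] at ht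
  exact absurd ht (not_lt.2 (div_nonneg (hpos t ht0'.le) ht0'.le))

variable {m : ℕ}

theorem quadForm_singleGen {φ ψ : n → ℂ} (h : star φ ⬝ᵥ ψ = 0) (H : Matrix n n ℂ) (κ : Fin m → ℝ)
    (A : Fin m → Matrix n n ℂ) :
    quadForm φ (singleGen H κ A (Matrix.vecMulVec ψ (star ψ)))
      = ∑ μ, (κ μ : ℂ) * ((star φ ⬝ᵥ (A μ *ᵥ ψ)) * star (star φ ⬝ᵥ (A μ *ᵥ ψ))) := by
  simp only [singleGen, LinearMap.add_apply, LinearMap.smul_apply, LinearMap.sum_apply, map_add,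
    map_smul, map_sum, quadForm_commMap h, quadForm_dissMap h, mul_zero, zero_add, smul_eq_mul]

theorem quadForm_pairGen {φ ψ : n → ℂ} (h : star φ ⬝ᵥ ψ = 0) (V₁ V₂ : Matrix n n ℂ) (w : Fin m → ℝ)
    (A B : Fin m → Matrix n n ℂ) :
    quadForm φ (pairGen V₁ V₂ w A B (Matrix.vecMulVec ψ (star ψ)))
      = ∑ μ, ((w μ : ℂ) / 2) * ((star φ ⬝ᵥ (A μ *ᵥ ψ)) * star (star φ ⬝ᵥ (B μ *ᵥ ψ))
          + (star φ ⬝ᵥ (B μ *ᵥ ψ)) * star (star φ ⬝ᵥ (A μ *ᵥ ψ))) := by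
  simp only [pairGen, LinearMap.add_apply, LinearMap.smul_apply, LinearMap.sum_apply, map_add,
    map_smul, map_sum, quadForm_commMap h, quadForm_dissMap h, mul_zero, zero_add, smul_eq_mul]

end QuadForm

section Embedding
variable {Γ : Type*} [Fintype Γ] [DecidableEq Γ] {D : ℕ}

/-- The product vector that is `φ` at site `j` and the basis vector `b` at every other site. -/
def siteVec (j : Γ) (b : Fin D) (φ : Fin D → ℂ) : (Γ → Fin D) → ℂ :=
  fun σ => if ∀ i, i ≠ j → σ i = b then φ (σ j) else 0

theorem sum_ite_forall_ne (j : Γ) (b : Fin D) (f : Fin D → ℂ) :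
    (∑ σ : Γ → Fin D, if ∀ i, i ≠ j → σ i = b then f (σ j) else 0) = ∑ a, f a := by
  rw [← Finset.sum_filter]
  refine Finset.sum_nbij' (fun σ => σ j) (fun a => Function.update (fun _ => b) j a)
    (by simp) (fun a _ => by simp +contextual [Function.update_of_ne]) ?_ (by simp) (by simp)
  intro σ hσ
  simp only [Finset.mem_filter, Finset.mem_univ, true_and] at hσ
  ext i
  rcases eq_or_ne i j with rfl | hi
  · simp
  · simp [Function.update_of_ne hi, hσ i hi]

theorem star_siteVec_dotProduct (j : Γ) (b : Fin D) (φ ψ : Fin D → ℂ) :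
    star (siteVec j b φ) ⬝ᵥ siteVec j b ψ = star φ ⬝ᵥ ψ := by
  rw [dotProduct, dotProduct, ← sum_ite_forall_ne j b]
  refine Finset.sum_congr rfl fun σ _ => ?_
  by_cases h : ∀ i, i ≠ j → σ i = b
  · simp only [siteVec, Pi.star_apply, if_pos h]
  · simp only [siteVec, Pi.star_apply, if_neg h, mul_zero]

theorem siteOp_mulVec_siteVec (j : Γ) (b : Fin D) (A : Matrix (Fin D) (Fin D) ℂ)
    (ψ : Fin D → ℂ) : siteOp j A *ᵥ siteVec j b ψ = siteVec j b (A *ᵥ ψ) := by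
  ext σ
  simp only [Matrix.mulVec, dotProduct, siteOp, Matrix.of_apply]
  by_cases h : ∀ i, i ≠ j → σ i = b
  · have hA : (A *ᵥ ψ) (σ j) = ∑ a, A (σ j) a * ψ a := rfl
    rw [siteVec, if_pos h, hA, ← sum_ite_forall_ne j b]
    refine Finset.sum_congr rfl fun τ _ => ?_
    by_cases hτ : ∀ i, i ≠ j → τ i = b
    · have : ∀ i, i ≠ j → σ i = τ i := fun i hi => (h i hi).trans (hτ i hi).symm
      rw [siteVec, if_pos this, if_pos hτ, if_pos hτ]
    · rw [siteVec, if_neg hτ, if_neg hτ, mul_zero]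
  · rw [siteVec, if_neg h]
    refine Finset.sum_eq_zero fun τ _ => ?_
    by_cases hτ : ∀ i, i ≠ j → τ i = b
    · rw [if_neg, zero_mul]
      exact fun h' => h fun i hi => (h' i hi).trans (hτ i hi)
    · rw [siteVec, if_neg hτ, mul_zero]

/-- An operator at another site cannot connect product vectors with orthogonal factors at `j`. -/
theorem star_siteVec_dotProduct_siteOp_of_ne {j k : Γ} (hkj : k ≠ j) (b : Fin D)
    (A : Matrix (Fin D) (Fin D) ℂ) {φ ψ : Fin D → ℂ} (h : star φ ⬝ᵥ ψ = 0) :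
    star (siteVec j b φ) ⬝ᵥ (siteOp k A *ᵥ siteVec j b ψ) = 0 := by
  have key : ∀ σ : Γ → Fin D, (∀ i, i ≠ j → σ i = b) →
      (siteOp k A *ᵥ siteVec j b ψ) σ = A b b * ψ (σ j) := by
    intro σ hσ
    rw [Matrix.mulVec, dotProduct, Finset.sum_eq_single σ]
    · simp only [siteOp, Matrix.of_apply, siteVec, if_pos hσ, hσ k hkj, implies_true, if_true]
    · intro τ _ hτ
      by_cases hτb : ∀ i, i ≠ j → τ i = b
      · rw [siteOp, Matrix.of_apply, if_neg, zero_mul]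
        intro h'
        refine hτ (funext fun i => ?_)
        rcases eq_or_ne i j with rfl | hi
        · exact (h' i hkj.symm).symm
        · rw [hτb i hi, hσ i hi]
      · rw [siteVec, if_neg hτb, mul_zero]
    · simp
  calc star (siteVec j b φ) ⬝ᵥ (siteOp k A *ᵥ siteVec j b ψ)
      = ∑ σ : Γ → Fin D, if ∀ i, i ≠ j → σ i = b
          then star φ (σ j) * (A b b * ψ (σ j)) else 0 := by
        refine Finset.sum_congr rfl fun σ _ => ?_
        by_cases hσ : ∀ i, i ≠ j → σ i = b
        · rw [key σ hσ, if_pos hσ, Pi.star_apply, siteVec, if_pos hσ, Pi.star_apply]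
        · rw [if_neg hσ, Pi.star_apply, siteVec, if_neg hσ, star_zero, zero_mul]
    _ = ∑ a, star φ a * (A b b * ψ a) :=
        sum_ite_forall_ne j b (fun a => star φ a * (A b b * ψ a))
    _ = A b b * (star φ ⬝ᵥ ψ) := by
        rw [dotProduct, Finset.mul_sum]
        exact Finset.sum_congr rfl fun a _ => by ring
    _ = 0 := by rw [h, mul_zero]

end Embedding

namespace Model
variable {D m : ℕ} (M : Model D m)

/-- The map `X ↦ ∑ κ_μ ℓ_μ X ℓ_μᴴ` is nonnegative between orthogonal vectors; the rates `κ_μ`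
themselves may be negative. This is what the single-site equations need in order to preserve
positivity. -/
def LocallyPositive : Prop :=
  ∀ φ ψ : Fin D → ℂ, star φ ⬝ᵥ ψ = 0 → 0 ≤ ∑ μ, M.κ μ * ‖star φ ⬝ᵥ (M.ℓ μ *ᵥ ψ)‖ ^ 2

/-- Testing the many-body generator with product vectors that differ at one site only: the
interactions drop out, and only the local dissipation remains. -/
theorem local_rates_nonneg {d : ℕ} {α : ℝ} {L : ℕ} (hL : 1 ≤ L)
    (hCP : GeneratesCP (M.fullGen d α L)) {φ ψ : Fin D → ℂ} (h : star φ ⬝ᵥ ψ = 0) :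
    0 ≤ ∑ μ, M.κ μ * ‖star φ ⬝ᵥ (M.ℓ μ *ᵥ ψ)‖ ^ 2
      + 1 / (2 * kac d α L) * ∑ μ, M.w₀ μ * ‖star φ ⬝ᵥ (M.ℓ μ *ᵥ ψ)‖ ^ 2 := by
  rcases Nat.eq_zero_or_pos D with rfl | hD
  · simp [dotProduct]
  let b : Fin D := ⟨0, hD⟩
  let j : Site d L := fun _ => ⟨0, hL⟩
  have horth : star (siteVec j b φ) ⬝ᵥ siteVec j b ψ = 0 := by
    rw [star_siteVec_dotProduct, h]
  have hq := hCP.quadForm_nonneg horth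
  have hs : ∀ (k : Site d L) (A : Matrix (Fin D) (Fin D) ℂ),
      star (siteVec j b φ) ⬝ᵥ (siteOp k A *ᵥ siteVec j b ψ)
        = if k = j then star φ ⬝ᵥ (A *ᵥ ψ) else 0 := by
    intro k A
    split_ifs with hk
    · rw [hk, siteOp_mulVec_siteVec, star_siteVec_dotProduct]
    · exact star_siteVec_dotProduct_siteOp_of_ne hk b A h
  have hsq : ∀ z : ℂ, z * star z = ((‖z‖ ^ 2 : ℝ) : ℂ) := fun z => by
    simpa using Complex.mul_conj' z
  have hoff : ∀ k l : Site d L, k ≠ l → ∀ z z' : ℂ,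
      (if k = j then z else 0) * star (if l = j then z' else 0) = 0 := by
    intro k l hkl z z'
    by_cases hk : k = j
    · have : l ≠ j := fun hl => hkl (hk.trans hl.symm)
      simp [this]
    · simp [hk]
  have hG : quadForm (siteVec j b φ) (M.fullGen d α L
        (Matrix.vecMulVec (siteVec j b ψ) (star (siteVec j b ψ))))
      = ((∑ μ, M.κ μ * ‖star φ ⬝ᵥ (M.ℓ μ *ᵥ ψ)‖ ^ 2
      + 1 / (2 * kac d α L) * ∑ μ, M.w₀ μ * ‖star φ ⬝ᵥ (M.ℓ μ *ᵥ ψ)‖ ^ 2 : ℝ) : ℂ) := by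
    simp only [fullGen, LinearMap.add_apply, LinearMap.smul_apply, LinearMap.sum_apply, map_add,
      map_smul, map_sum, quadForm_singleGen horth, hs]
    rw [Complex.ofReal_add, Complex.ofReal_mul, smul_eq_mul]
    congr 2
    · rw [Finset.sum_eq_single j]
      · simp only [if_true, hsq]
        push_cast
        rfl
      · intro k _ hk
        simp [hk]
      · simp
    · have hterm : ∀ k l : Site d L, quadForm (siteVec j b φ) ((if k = l then
            pairGen 0 0 M.w₀ (fun μ => siteOp l (M.ℓ μ)) (fun μ => siteOp l (M.ℓ μ))
          else (((siteDist k l ^ α)⁻¹ : ℝ) : ℂ) •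
            pairGen (pairOp k l M.V) (pairOp l k M.V) M.w
              (fun μ => siteOp k (M.ℓ μ)) (fun μ => siteOp l (M.ℓ μ)))
            (Matrix.vecMulVec (siteVec j b ψ) (star (siteVec j b ψ))))
          = if k = l then (if l = j then
            ((∑ μ, M.w₀ μ * ‖star φ ⬝ᵥ (M.ℓ μ *ᵥ ψ)‖ ^ 2 : ℝ) : ℂ) else 0) else 0 := by
        intro k l
        split_ifs with hkl hlj
        · rw [quadForm_pairGen horth]
          simp only [hs, if_pos hlj, hsq]
          push_cast
          exact Finset.sum_congr rfl fun μ _ => by ring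
        · rw [quadForm_pairGen horth]
          simp [hs, hlj]
        · rw [LinearMap.smul_apply, map_smul, quadForm_pairGen horth]
          simp only [hs, hoff k l hkl, hoff l k (Ne.symm hkl), add_zero, mul_zero,
            Finset.sum_const_zero, smul_zero]
      simp only [hterm]
      simp
  rw [hG, Complex.ofReal_re] at hq
  exact hq

/-- The mean-field limit only sees the local rates, since the Kac factor diverges. -/
theorem locallyPositive {d : ℕ} {α : ℝ} (hkac : Tendsto (kac d α) atTop atTop)
    (hCP : ∀ L : ℕ, 1 ≤ L → GeneratesCP (M.fullGen d α L)) : M.LocallyPositive := by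
  intro φ ψ h
  have h1 : Tendsto (fun L => 1 / (2 * kac d α L)) atTop (𝓝 0) := by
    simp only [one_div]
    exact (hkac.const_mul_atTop two_pos).inv_tendsto_atTop
  have h2 := (h1.mul_const (∑ μ, M.w₀ μ * ‖star φ ⬝ᵥ (M.ℓ μ *ᵥ ψ)‖ ^ 2)).const_add
    (∑ μ, M.κ μ * ‖star φ ⬝ᵥ (M.ℓ μ *ᵥ ψ)‖ ^ 2)
  rw [zero_mul, add_zero] at h2
  refine ge_of_tendsto h2 ?_
  filter_upwards [eventually_ge_atTop 1] with L hL
  exact M.local_rates_nonneg hL (hCP L hL) h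

/-- A positive matrix with kernel vector `φ` is not pushed out of the positive cone by the local
generator. -/
theorem LocallyPositive.quadForm_gen₁_nonneg {M : Model D m} (hM : M.LocallyPositive)
    {s : Matrix (Fin D) (Fin D) ℂ} (hs : s.PosSemidef) {φ : Fin D → ℂ} (hφ : s *ᵥ φ = 0) :
    0 ≤ (quadForm φ (M.gen₁ s)).re := by
  obtain ⟨B, rfl⟩ := exists_eq_conjTranspose_mul_self hs
  have hB : B *ᵥ φ = 0 := by
    have : star (B *ᵥ φ) ⬝ᵥ (B *ᵥ φ) = 0 := by
      rw [Matrix.star_mulVec, ← Matrix.dotProduct_mulVec, Matrix.mulVec_mulVec, hφ,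
        dotProduct_zero]
    exact dotProduct_star_self_eq_zero.1 this
  have hdec : Bᴴ * B = ∑ c, Matrix.vecMulVec (star (B c)) (star (star (B c))) := by
    ext a b
    simp [Matrix.mul_apply, Matrix.sum_apply, Matrix.vecMulVec_apply]
  have horth : ∀ c, star φ ⬝ᵥ star (B c) = 0 := fun c => by
    rw [Matrix.star_dotProduct_star]
    have : B c ⬝ᵥ φ = 0 := congrFun hB c
    rw [this, star_zero]
  rw [hdec, map_sum, map_sum, Complex.re_sum]
  refine Finset.sum_nonneg fun c _ => ?_
  rw [gen₁, quadForm_singleGen (horth c)]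
  refine (hM φ (star (B c)) (horth c)).trans_eq ?_
  rw [Complex.re_sum]
  refine Finset.sum_congr rfl fun μ _ => ?_
  rw [Complex.re_ofReal_mul]
  congr 1
  have := Complex.mul_conj' (star φ ⬝ᵥ (M.ℓ μ *ᵥ star (B c)))
  rw [← Complex.star_def] at this
  rw [this, ← Complex.ofReal_pow, Complex.ofReal_re]

end Model

/-! ### Differential equations -/

section ODE

/-- Grönwall's inequality for a family of curves whose derivatives are controlled by the supremum
of the whole family. The bound `b` stands for the supremum, so that no regularity of the supremum
as a function of time is needed. -/
theorem norm_le_mul_exp_of_uniform_deriv_bound {X V : Type*} [NormedAddCommGroup V]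
    [NormedSpace ℝ V] {f f' : X → ℝ → V} {T B C δ₀ δ : ℝ} (hδ : 0 ≤ δ)
    (hδ₀ : 0 ≤ δ₀)
    (hf : ∀ x, ∀ t ∈ Set.Icc 0 T, HasDerivWithinAt (f x) (f' x t) (Set.Icc 0 T) t)
    (hB : ∀ x, ∀ t ∈ Set.Icc 0 T, ‖f x t‖ ≤ B) (h0 : ∀ x, ‖f x 0‖ ≤ δ₀)
    (h : ∀ t ∈ Set.Icc 0 T, ∀ b, (∀ y, ‖f y t‖ ≤ b) → ∀ x, ‖f' x t‖ ≤ C * b + δ) :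
    ∀ x, ∀ t ∈ Set.Icc 0 T, ‖f x t‖ ≤ (δ₀ + δ * T) * Real.exp (C * t) := by
  intro x t ht
  have hT : 0 ≤ T := ht.1.trans ht.2
  set A := δ₀ + δ * T with hA
  have hA0 : 0 ≤ A := by positivity
  -- Iterating the integral inequality improves the a priori bound by the factor `C t / n`.
  have key : ∀ n : ℕ, ∀ x, ∀ t ∈ Set.Icc 0 T,
      ‖f x t‖ ≤ A * Real.exp (C * t) + B * ((C * t) ^ n / n.factorial) := by
    intro n
    induction n with
    | zero =>
      intro x t ht
      have := hB x t ht
      have h2 : 0 ≤ A * Real.exp (C * t) := by positivity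
      simpa using by linarith
    | succ n ih =>
      intro x t ht
      let g : ℝ → ℝ := fun t => A * (Real.exp (C * t) - 1) + δ₀ + δ * t
        + B * ((C * t) ^ (n + 1) / (n + 1).factorial)
      have hg : ∀ t, HasDerivAt g
          (C * (A * Real.exp (C * t) + B * ((C * t) ^ n / n.factorial)) + δ) t := by
        intro t
        have h1 : HasDerivAt (fun t : ℝ => C * t) C t := by
          simpa using (hasDerivAt_id t).const_mul C
        have h2 := (((h1.exp.sub_const 1).const_mul A).add_const δ₀).add
          ((hasDerivAt_id t).const_mul δ)
        have h3 := ((h1.pow (n + 1)).div_const ((n + 1).factorial : ℝ)).const_mul B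
        refine (h2.add h3).congr_deriv ?_
        rw [Nat.factorial_succ]
        push_cast
        have : (n.factorial : ℝ) ≠ 0 := by positivity
        field_simp
        ring
      have hfg := image_norm_le_of_norm_deriv_right_le_deriv_boundary (f := f x) (f' := f' x)
        (a := 0) (b := T) (fun t ht => (hf x t ht).continuousWithinAt)
        (fun t ht => (hf x t (Set.Ico_subset_Icc_self ht)).mono_of_mem_nhdsWithin
          (Icc_mem_nhdsGE_of_mem ht))
        (B := g) (by simpa [g] using h0 x) hg
        (fun t ht => h t (Set.Ico_subset_Icc_self ht) _
          (fun y => ih y t (Set.Ico_subset_Icc_self ht)) x)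
      refine (hfg ht).trans ?_
      have : δ * t ≤ δ * T := mul_le_mul_of_nonneg_left ht.2 hδ
      simp only [g]
      linarith
  have hlim : Tendsto (fun n : ℕ => A * Real.exp (C * t) + B * ((C * t) ^ n / n.factorial)) atTop
      (𝓝 (A * Real.exp (C * t) + B * 0)) :=
    ((FloorSemiring.tendsto_pow_div_factorial_atTop (C * t)).const_mul B).const_add _
  rw [mul_zero, add_zero] at hlim
  exact ge_of_tendsto' hlim fun n => key n x t ht

variable {E : Type*} [NormedAddCommGroup E] [NormedSpace ℝ E]

open scoped NNReal in
/-- A bounded, globally Lipschitz vector field has solutions for all positive times. -/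
theorem exists_solution_of_bounded_lipschitz [CompleteSpace E] {F : E → E} {K B : ℝ≥0}
    (hF : LipschitzWith K F) (hB : ∀ x, ‖F x‖ ≤ B) (x₀ : E) :
    ∃ f : ℝ → E, f 0 = x₀ ∧ ∀ t, 0 ≤ t → HasDerivWithinAt f (F (f t)) (Set.Ici 0) t := by
  have hloc : ∀ n : ℕ, ∃ g : ℝ → E, g 0 = x₀ ∧
      ∀ t ∈ Set.Icc (0 : ℝ) n, HasDerivWithinAt g (F (g t)) (Set.Icc 0 (n : ℝ)) t := by
    intro n
    have hpl : IsPicardLindelof (fun _ => F) (tmin := 0) (tmax := (n : ℝ))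
        ⟨0, le_rfl, n.cast_nonneg⟩ x₀ (B * n) 0 B K :=
      .of_time_independent (fun x _ => hB x) (hF.lipschitzOnWith)
        (by simp)
    exact hpl.exists_eq_forall_mem_Icc_hasDerivWithinAt₀
  choose g hg0 hg using hloc
  have huniq : ∀ n k : ℕ, n ≤ k → Set.EqOn (g n) (g k) (Set.Icc 0 (n : ℝ)) := by
    intro n k hnk
    have hsub : Set.Icc (0 : ℝ) n ⊆ Set.Icc 0 (k : ℝ) :=
      Set.Icc_subset_Icc_right (by exact_mod_cast hnk)
    refine ODE_solution_unique_of_mem_Icc_right (v := fun _ => F) (s := fun _ => Set.univ) (K := K)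
      (fun t _ => hF.lipschitzOnWith)
      (fun t ht => (hg n t ht).continuousWithinAt)
      (fun t ht => (hg n t (Set.Ico_subset_Icc_self ht)).mono_of_mem_nhdsWithin
        (Icc_mem_nhdsGE_of_mem ht)) (fun _ _ => trivial)
      (fun t ht => ((hg k t (hsub ht)).mono hsub).continuousWithinAt)
      (fun t ht => ((hg k t (hsub (Set.Ico_subset_Icc_self ht))).mono hsub).mono_of_mem_nhdsWithin
        (Icc_mem_nhdsGE_of_mem ht)) (fun _ _ => trivial) ?_
    rw [hg0, hg0]
  have heq : ∀ n : ℕ, ∀ s : ℝ, 0 ≤ s → s < n → g (⌊s⌋₊ + 1) s = g n s := by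
    intro n s hs hsn
    exact huniq _ _ (Nat.succ_le_of_lt ((Nat.floor_lt hs).2 hsn))
      ⟨hs, by push_cast; exact (Nat.lt_floor_add_one s).le⟩
  refine ⟨fun t => g (⌊t⌋₊ + 1) t, by simp [hg0], fun t ht => ?_⟩
  set n := ⌊t⌋₊ + 1 with hn
  have htn : t < n := by rw [hn]; push_cast; exact Nat.lt_floor_add_one t
  have hd : HasDerivWithinAt (g n) (F (g n t)) (Set.Ici 0) t := by
    refine (hg n t ⟨ht, htn.le⟩).mono_of_mem_nhdsWithin ?_
    rw [← Set.Ici_inter_Iic]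
    exact inter_mem self_mem_nhdsWithin (mem_nhdsWithin_of_mem_nhds (Iic_mem_nhds htn))
  refine hd.congr_of_eventuallyEq ?_ rfl
  filter_upwards [self_mem_nhdsWithin, mem_nhdsWithin_of_mem_nhds (Iio_mem_nhds htn)] with s hs hsn
  exact heq n s hs hsn

/-- A cutoff function equal to one on `[0, 2]` and vanishing beyond `3`. -/
def cutoff (s : ℝ) : ℝ := max 0 (min 1 (3 - s))

theorem cutoff_nonneg (s : ℝ) : 0 ≤ cutoff s := le_max_left _ _

theorem cutoff_le_one (s : ℝ) : cutoff s ≤ 1 := max_le zero_le_one (min_le_left _ _)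

theorem cutoff_of_le {s : ℝ} (h : s ≤ 2) : cutoff s = 1 := by
  rw [cutoff, min_eq_left (by linarith), max_eq_right zero_le_one]

theorem cutoff_of_ge {s : ℝ} (h : 3 ≤ s) : cutoff s = 0 := by
  rw [cutoff, max_eq_left ((min_le_right _ _).trans (by linarith))]

theorem abs_cutoff_sub_le (s t : ℝ) : |cutoff s - cutoff t| ≤ |s - t| := by
  refine (abs_max_sub_max_le_max _ _ _ _).trans (max_le (by simp) ?_)
  refine (abs_min_sub_min_le_max _ _ _ _).trans (max_le (by simp) ?_)
  rw [sub_sub_sub_cancel_left, abs_sub_comm]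

theorem norm_cutoff_smul_sub_le {F : E → E} {K B : ℝ} (hK : 0 ≤ K)
    (hF : ∀ x y, ‖x‖ ≤ 3 → ‖y‖ ≤ 3 → ‖F x - F y‖ ≤ K * ‖x - y‖)
    (hB : ∀ x, ‖x‖ ≤ 3 → ‖F x‖ ≤ B) (x y : E) :
    ‖cutoff ‖x‖ • F x - cutoff ‖y‖ • F y‖ ≤ (K + B) * ‖x - y‖ := by
  have hB0 : 0 ≤ B := (norm_nonneg _).trans (hB 0 (by simp))
  have hc : |cutoff ‖x‖ - cutoff ‖y‖| ≤ ‖x - y‖ :=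
    (abs_cutoff_sub_le _ _).trans (abs_norm_sub_norm_le x y)
  have hnn : 0 ≤ K * ‖x - y‖ := by positivity
  rcases le_total ‖x‖ 3 with hx | hx
  · rcases le_total ‖y‖ 3 with hy | hy
    · have : cutoff ‖x‖ • F x - cutoff ‖y‖ • F y
          = cutoff ‖x‖ • (F x - F y) + (cutoff ‖x‖ - cutoff ‖y‖) • F y := by module
      rw [this, add_mul]
      refine (norm_add_le _ _).trans (add_le_add ?_ ?_)
      · rw [norm_smul, Real.norm_of_nonneg (cutoff_nonneg _)]
        exact (mul_le_of_le_one_left (norm_nonneg _) (cutoff_le_one _)).trans (hF x y hx hy)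
      · rw [norm_smul, Real.norm_eq_abs, mul_comm]
        exact mul_le_mul (hB y hy) hc (abs_nonneg _) hB0
    · rw [cutoff_of_ge hy, sub_zero] at hc
      rw [cutoff_of_ge hy, zero_smul, sub_zero, norm_smul, Real.norm_eq_abs, mul_comm, add_mul]
      have := mul_le_mul (hB x hx) hc (abs_nonneg _) hB0
      linarith
  · rcases le_total ‖y‖ 3 with hy | hy
    · rw [cutoff_of_ge hx, zero_sub, abs_neg] at hc
      rw [cutoff_of_ge hx, zero_smul, zero_sub, norm_neg, norm_smul, Real.norm_eq_abs, mul_comm,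
        add_mul]
      have := mul_le_mul (hB y hy) hc (abs_nonneg _) hB0
      linarith
    · rw [cutoff_of_ge hx, cutoff_of_ge hy, zero_smul, zero_smul, sub_zero, norm_zero]
      positivity

/-- If solutions of a locally Lipschitz equation cannot leave the closed bounded set `S`, then
those that start in `S` exist for all positive times. -/
theorem exists_solution_of_invariant [CompleteSpace E] {F : E → E} {S : Set E} (hS : IsClosed S)
    (hS1 : ∀ x ∈ S, ‖x‖ ≤ 1) {K : ℝ} (hK : 0 ≤ K)
    (hF : ∀ x y, ‖x‖ ≤ 3 → ‖y‖ ≤ 3 → ‖F x - F y‖ ≤ K * ‖x - y‖)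
    (hinv : ∀ τ, 0 < τ → ∀ f : ℝ → E,
      (∀ t ∈ Set.Icc 0 τ, HasDerivWithinAt f (F (f t)) (Set.Icc 0 τ) t) → f 0 ∈ S →
      ∀ t ∈ Set.Icc 0 τ, f t ∈ S) {x₀ : E} (hx₀ : x₀ ∈ S) :
    ∃ f : ℝ → E, f 0 = x₀ ∧
      ∀ t, 0 ≤ t → f t ∈ S ∧ HasDerivWithinAt f (F (f t)) (Set.Ici 0) t := by
  -- Solve the equation with the vector field cut off outside a ball, and show that the solution
  -- never reaches the region where the cutoff matters.
  set B := ‖F 0‖ + K * 3 with hBdef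
  have hB0 : 0 ≤ B := by positivity
  have hB : ∀ x, ‖x‖ ≤ 3 → ‖F x‖ ≤ B := fun x hx => by
    have h1 := hF x 0 hx (by simp)
    rw [sub_zero] at h1
    have h2 : K * ‖x‖ ≤ K * 3 := by gcongr
    have h3 := norm_le_norm_add_norm_sub' (F x) (F 0)
    linarith
  obtain ⟨f, hf0, hf⟩ := exists_solution_of_bounded_lipschitz (F := fun x => cutoff ‖x‖ • F x)
    (K := ⟨K + B, by positivity⟩) (B := ⟨B, hB0⟩)
    (LipschitzWith.of_dist_le_mul fun x y => by
      rw [dist_eq_norm, dist_eq_norm]; exact norm_cutoff_smul_sub_le hK hF hB x y)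
    (fun x => by
      rw [norm_smul, Real.norm_of_nonneg (cutoff_nonneg _)]
      rcases le_total ‖x‖ 3 with hx | hx
      · exact (mul_le_of_le_one_left (norm_nonneg _) (cutoff_le_one _)).trans (hB x hx)
      · rw [cutoff_of_ge hx, zero_mul]; exact hB0) x₀
  have hcont : ContinuousOn f (Set.Ici 0) := fun t ht => (hf t ht).continuousWithinAt
  have hmem : ∀ T, 0 ≤ T → f T ∈ S := by
    intro T hT
    have hclosed : IsClosed (f ⁻¹' S ∩ Set.Icc 0 T) := by
      rw [Set.inter_comm]
      exact (hcont.mono Set.Icc_subset_Ici_self).preimage_isClosed_of_isClosed isClosed_Icc hS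
    refine hclosed.Icc_subset_of_forall_mem_nhdsWithin (by simpa [hf0] using hx₀) ?_ ⟨hT, le_rfl⟩
    rintro t ⟨htS, ht0, htT⟩
    have hnear : ∀ᶠ u in 𝓝[Set.Ici 0] t, ‖f u‖ < 2 :=
      (hcont t ht0).norm.eventually_lt tendsto_const_nhds
        ((hS1 _ htS).trans_lt one_lt_two)
    obtain ⟨ε, hε, hball⟩ := Metric.mem_nhdsWithin_iff.1 hnear
    have hsolve : ∀ u ∈ Set.Icc 0 (ε / 2), HasDerivWithinAt (fun u => f (t + u)) (F (f (t + u)))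
        (Set.Icc 0 (ε / 2)) u := by
      intro u hu
      have hu2 : ‖f (t + u)‖ < 2 := hball ⟨by
        rw [Metric.mem_ball, Real.dist_eq, add_sub_cancel_left, abs_of_nonneg hu.1]
        linarith [hu.2], add_nonneg ht0 hu.1⟩
      have h1 := hf (t + u) (add_nonneg ht0 hu.1)
      rw [cutoff_of_le hu2.le, one_smul] at h1
      have h2 : HasDerivWithinAt (fun u => t + u) 1 (Set.Icc 0 (ε / 2)) u :=
        (hasDerivWithinAt_id u _).const_add t
      simpa [Function.comp_def] using h1.scomp u h2 (fun v hv => add_nonneg ht0 hv.1)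
    have hres := hinv (ε / 2) (by positivity) _ hsolve (by simpa using htS)
    filter_upwards [Ioc_mem_nhdsGT (show t < t + ε / 2 by linarith)] with v hv
    have := hres (v - t) ⟨by linarith [hv.1], by linarith [hv.2]⟩
    simpa using this
  refine ⟨f, hf0, fun t ht => ⟨hmem t ht, ?_⟩⟩
  have := hf t ht
  rwa [cutoff_of_le ((hS1 _ (hmem t ht)).trans one_le_two), one_smul] at this

end ODE

/-! ### The single-site equation preserves positivity -/

theorem hasDerivWithinAt_matrix {n : Type*} [Fintype n] {f : ℝ → Matrix n n ℂ} {A : Matrix n n ℂ}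
    {s : Set ℝ} {t : ℝ} :
    HasDerivWithinAt f A s t ↔ ∀ a b, HasDerivWithinAt (fun u => f u a b) (A a b) s t :=
  hasDerivWithinAt_pi.trans (forall_congr' fun _ => hasDerivWithinAt_pi)

section Positivity
variable {n : Type*} [Fintype n]

theorem _root_.HasDerivWithinAt.re_quadForm {f : ℝ → Matrix n n ℂ} {A : Matrix n n ℂ}
    {s : Set ℝ} {t : ℝ} (h : HasDerivWithinAt f A s t) (φ : n → ℂ) :
    HasDerivWithinAt (fun u => (quadForm φ (f u)).re) (quadForm φ A).re s t := by
  have h1 : HasDerivWithinAt (fun u => quadForm φ (f u)) (quadForm φ A) s t := by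
    simp only [quadForm_eq_sum]
    exact HasDerivWithinAt.fun_sum fun a _ => HasDerivWithinAt.fun_sum fun b _ =>
      ((hasDerivWithinAt_matrix.1 h a b).mul_const (φ b)).const_mul (star (φ a))
  exact Complex.reCLM.hasFDerivAt.comp_hasDerivWithinAt t h1

theorem posSemidef_of_re_quadForm_nonneg {A : Matrix n n ℂ} (hA : A.IsHermitian)
    (h : ∀ φ, 0 ≤ (quadForm φ A).re) : A.PosSemidef := by
  refine .of_dotProduct_mulVec_nonneg hA fun φ => Complex.le_def.2 ⟨h φ, ?_⟩
  have h1 : star (star φ ⬝ᵥ (A *ᵥ φ)) = star φ ⬝ᵥ (A *ᵥ φ) := by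
    rw [← star_dotProduct_conjTranspose_mulVec, hA]
  exact (Complex.conj_eq_iff_im.1 h1).symm

theorem quadForm_smul_left (c : ℝ) (φ : n → ℂ) (A : Matrix n n ℂ) :
    (quadForm ((c : ℂ) • φ) A).re = c ^ 2 * (quadForm φ A).re := by
  have : quadForm ((c : ℂ) • φ) A = ((c ^ 2 : ℝ) : ℂ) * quadForm φ A := by
    simp only [quadForm_apply, star_smul, Matrix.mulVec_smul, smul_dotProduct, dotProduct_smul,
      smul_eq_mul, Complex.star_def, Complex.conj_ofReal]
    push_cast
    ring
  rw [this, Complex.re_ofReal_mul]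

variable [DecidableEq n]

theorem re_quadForm_one (φ : n → ℂ) : (quadForm φ 1).re = ∑ a, ‖φ a‖ ^ 2 := by
  rw [quadForm_apply, Matrix.one_mulVec, dotProduct, Complex.re_sum]
  refine Finset.sum_congr rfl fun a _ => ?_
  have := Complex.conj_mul' (φ a)
  rw [Pi.star_apply, Complex.star_def, this, ← Complex.ofReal_pow, Complex.ofReal_re]

theorem one_le_re_quadForm_one {φ : n → ℂ} (h : ‖φ‖ = 1) : 1 ≤ (quadForm φ 1).re := by
  rw [re_quadForm_one]
  by_contra! hlt
  have h1 : ∀ a, ‖φ a‖ < 1 := fun a => by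
    have h2 : ‖φ a‖ ^ 2 < 1 := (Finset.single_le_sum (f := fun a => ‖φ a‖ ^ 2)
      (fun _ _ => by positivity) (Finset.mem_univ a)).trans_lt hlt
    nlinarith [norm_nonneg (φ a)]
  have := (pi_norm_lt_iff one_pos).2 h1
  linarith

end Positivity

variable {D m : ℕ} {M : Model D m}

/-- A Hermitian solution of `r' = ℒ₁[r] + [K(t), r]` that starts positive stays positive. Adding
`ε exp (C t)` times the identity makes the solution strictly positive. At the first time at which
this fails the derivative would have the wrong sign: the commutator vanishes between kernel
vectors of a positive matrix, whatever `K` is. -/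
theorem Model.LocallyPositive.posSemidef_of_hasDerivWithinAt (hM : M.LocallyPositive) {τ : ℝ}
    {K r : ℝ → Matrix (Fin D) (Fin D) ℂ}
    (hr : ∀ t ∈ Set.Icc 0 τ,
      HasDerivWithinAt r (M.gen₁ (r t) + (K t * r t - r t * K t)) (Set.Icc 0 τ) t)
    (hherm : ∀ t ∈ Set.Icc 0 τ, (r t).IsHermitian) (h0 : (r 0).PosSemidef) :
    ∀ t ∈ Set.Icc 0 τ, (r t).PosSemidef := by
  obtain ⟨c, hc⟩ : ∃ c : ℝ, ∀ φ ∈ Metric.sphere (0 : Fin D → ℂ) 1,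
      (quadForm φ (M.gen₁ 1)).re ≤ c := by
    have hcont : Continuous fun φ : Fin D → ℂ => (quadForm φ (M.gen₁ 1)).re := by
      simp only [quadForm_eq_sum]
      fun_prop
    obtain ⟨c, hc⟩ := (isCompact_sphere (0 : Fin D → ℂ) 1).bddAbove_image hcont.continuousOn
    exact ⟨c, fun φ hφ => hc (Set.mem_image_of_mem _ hφ)⟩
  set C := |c| + 1 with hC
  have hrc : ContinuousOn r (Set.Icc 0 τ) := fun t ht => (hr t ht).continuousWithinAt
  have main : ∀ ε : ℝ, 0 < ε → ∀ t ∈ Set.Icc 0 τ, ∀ φ ∈ Metric.sphere (0 : Fin D → ℂ) 1,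
      0 < (quadForm φ (r t + ((ε * Real.exp (C * t) : ℝ) : ℂ) • 1)).re := by
    intro ε hε
    set s : ℝ → Matrix (Fin D) (Fin D) ℂ := fun t => r t + ((ε * Real.exp (C * t) : ℝ) : ℂ) • 1
      with hs
    have hsc : ContinuousOn s (Set.Icc 0 τ) := hrc.add (by fun_prop)
    by_contra! hbad
    have hm : ContinuousOn (fun p : ℝ × (Fin D → ℂ) => (quadForm p.2 (s p.1)).re)
        (Set.Icc 0 τ ×ˢ Metric.sphere (0 : Fin D → ℂ) 1) := by
      have hs1 : ContinuousOn (fun p : ℝ × (Fin D → ℂ) => s p.1)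
          (Set.Icc 0 τ ×ˢ Metric.sphere (0 : Fin D → ℂ) 1) :=
        hsc.comp continuousOn_fst fun p hp => hp.1
      simp only [quadForm_eq_sum]
      refine Complex.continuous_re.comp_continuousOn ?_
      refine continuousOn_finsetSum _ fun a _ => continuousOn_finsetSum _ fun b _ => ?_
      have hab : ContinuousOn (fun p : ℝ × (Fin D → ℂ) => s p.1 a b)
          (Set.Icc 0 τ ×ˢ Metric.sphere (0 : Fin D → ℂ) 1) :=
        (continuous_apply_apply (ρ := fun _ _ => ℂ) a b).comp_continuousOn hs1
      have h1 : Continuous fun p : ℝ × (Fin D → ℂ) => star (p.2 a) := by fun_prop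
      have h2 : Continuous fun p : ℝ × (Fin D → ℂ) => p.2 b := by fun_prop
      exact h1.continuousOn.mul (hab.mul h2.continuousOn)
    have hcpt : IsCompact (Set.Icc 0 τ ×ˢ Metric.sphere (0 : Fin D → ℂ) 1) :=
      isCompact_Icc.prod (isCompact_sphere _ _)
    have hbadc : IsCompact ((Set.Icc 0 τ ×ˢ Metric.sphere (0 : Fin D → ℂ) 1) ∩
        (fun p : ℝ × (Fin D → ℂ) => (quadForm p.2 (s p.1)).re) ⁻¹' Set.Iic 0) :=
      hcpt.of_isClosed_subset (hm.preimage_isClosed_of_isClosed hcpt.isClosed isClosed_Iic)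
        Set.inter_subset_left
    obtain ⟨t₁, ht₁, φ₁, hφ₁, hneg₁⟩ := hbad
    obtain ⟨t₀, ⟨⟨t₀', φ⟩, ⟨⟨ht₀, hφ⟩, hneg⟩, rfl⟩, hleast⟩ :=
      (hbadc.image continuous_fst).exists_isLeast ⟨t₁, (t₁, φ₁), ⟨⟨ht₁, hφ₁⟩, hneg₁⟩, rfl⟩
    simp only [Set.mem_preimage, Set.mem_Iic] at hneg ht₀
    have hpos : ∀ t ∈ Set.Icc 0 τ, t < t₀' → ∀ ψ ∈ Metric.sphere (0 : Fin D → ℂ) 1,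
        0 < (quadForm ψ (s t)).re := by
      intro t ht htt ψ hψ
      by_contra! hcon
      exact not_lt.2 (hleast ⟨(t, ψ), ⟨⟨ht, hψ⟩, hcon⟩, rfl⟩) htt
    have hφ1 : ‖φ‖ = 1 := by simpa using hφ
    have ht₀pos : 0 < t₀' := by
      rcases ht₀.1.eq_or_lt with h | h
      · exfalso
        rw [← h] at hneg
        have h1 : 0 ≤ (quadForm φ (r 0)).re := (Complex.le_def.1 (h0.dotProduct_mulVec_nonneg φ)).1
        have h2 := one_le_re_quadForm_one hφ1
        simp only [hs, map_add, map_smul, Complex.add_re, smul_eq_mul, Complex.re_ofReal_mul,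
          mul_zero, Real.exp_zero, mul_one] at hneg
        nlinarith
      · exact h
    have hIio : Set.Ioo 0 t₀' ∈ 𝓝[<] t₀' := Ioo_mem_nhdsLT ht₀pos
    have hsub : Set.Icc 0 τ ∈ 𝓝[<] t₀' :=
      mem_of_superset hIio fun t ht => ⟨ht.1.le, ht.2.le.trans ht₀.2⟩
    have hpos' : ∀ᶠ t in 𝓝[<] t₀', ∀ ψ, 0 ≤ (quadForm ψ (s t)).re := by
      filter_upwards [hIio] with t ht ψ
      rcases eq_or_ne ψ 0 with rfl | hψ
      · simp [quadForm_apply]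
      · have h1 := hpos t ⟨ht.1.le, ht.2.le.trans ht₀.2⟩ ht.2 (((‖ψ‖⁻¹ : ℝ) : ℂ) • ψ)
          (by simp [norm_smul, hψ])
        rw [quadForm_smul_left] at h1
        exact (pos_of_mul_pos_right h1 (by positivity)).le
    have hst₀ : (s t₀').PosSemidef := by
      refine posSemidef_of_re_quadForm_nonneg ?_ fun ψ => ?_
      · refine (hherm t₀' ht₀).add ?_
        rw [Matrix.IsHermitian, Matrix.conjTranspose_smul, Matrix.conjTranspose_one,
          Complex.star_def, Complex.conj_ofReal]
      · have hψ : ContinuousWithinAt (fun t => (quadForm ψ (s t)).re) (Set.Iio t₀') t₀' := by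
          have h1 : ContinuousWithinAt s (Set.Iio t₀') t₀' :=
            (hsc t₀' ht₀).mono_of_mem_nhdsWithin hsub
          simp only [quadForm_eq_sum]
          refine Complex.continuous_re.continuousAt.comp_continuousWithinAt ?_
          refine tendsto_finsetSum _ fun a _ => tendsto_finsetSum _ fun b _ => ?_
          exact ((((continuous_apply_apply (ρ := fun _ _ => ℂ) a b).continuousAt.comp_continuousWithinAt
            h1)).mul_const _).const_mul _
        exact ge_of_tendsto hψ (hpos'.mono fun t ht => ht ψ)
    have hker : s t₀' *ᵥ φ = 0 := by
      refine (hst₀.dotProduct_mulVec_zero_iff φ).1 ?_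
      have h1 := hst₀.dotProduct_mulVec_nonneg φ
      exact le_antisymm (Complex.le_def.2 ⟨hneg, (Complex.le_def.1 h1).2.symm⟩) h1
    have hderiv : HasDerivWithinAt s (M.gen₁ (r t₀') + (K t₀' * r t₀' - r t₀' * K t₀')
        + ((ε * (Real.exp (C * t₀') * C) : ℝ) : ℂ) • 1) (Set.Iio t₀') t₀' := by
      refine ((hr t₀' ht₀).mono_of_mem_nhdsWithin hsub).add ?_
      have h1 : HasDerivWithinAt (fun t : ℝ => ε * Real.exp (C * t))
          (ε * (Real.exp (C * t₀') * C)) (Set.Iio t₀') t₀' := by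
        have := ((hasDerivAt_id t₀').const_mul C).exp.const_mul ε
        simpa using this.hasDerivWithinAt
      exact (h1.ofReal_comp).smul_const (1 : Matrix (Fin D) (Fin D) ℂ)
    have hq := hderiv.re_quadForm φ
    set e := ε * Real.exp (C * t₀') with he
    have he0 : 0 < e := by positivity
    have hrs : r t₀' = s t₀' - (e : ℂ) • 1 := by simp [hs, he]
    have hcomm : quadForm φ (K t₀' * r t₀' - r t₀' * K t₀') = 0 := by
      have h1 : K t₀' * r t₀' - r t₀' * K t₀' = K t₀' * s t₀' - s t₀' * K t₀' := by
        rw [hrs, Matrix.mul_sub, Matrix.sub_mul, Matrix.mul_smul, Matrix.smul_mul, Matrix.mul_one,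
          Matrix.one_mul]
        abel
      have h2 : star φ ⬝ᵥ (s t₀' *ᵥ (K t₀' *ᵥ φ)) = 0 := by
        rw [Matrix.dotProduct_mulVec]
        have : star φ ᵥ* s t₀' = 0 := by
          rw [← hst₀.1, ← Matrix.star_mulVec, hker, star_zero]
        rw [this, zero_dotProduct]
      rw [h1, quadForm_apply, Matrix.sub_mulVec, ← Matrix.mulVec_mulVec, ← Matrix.mulVec_mulVec,
        hker, Matrix.mulVec_zero, dotProduct_sub, h2, dotProduct_zero, sub_zero]
    have hgen : (quadForm φ (M.gen₁ (r t₀'))).re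
        = (quadForm φ (M.gen₁ (s t₀'))).re - e * (quadForm φ (M.gen₁ 1)).re := by
      rw [hrs, map_sub, map_smul, map_sub, map_smul, Complex.sub_re, smul_eq_mul,
        Complex.re_ofReal_mul]
    have hval : 0 < (quadForm φ (M.gen₁ (r t₀') + (K t₀' * r t₀' - r t₀' * K t₀')
        + ((ε * (Real.exp (C * t₀') * C) : ℝ) : ℂ) • 1)).re := by
      rw [map_add, map_add, hcomm, add_zero, Complex.add_re, hgen, map_smul, smul_eq_mul,
        Complex.re_ofReal_mul]
      have h1 := hM.quadForm_gen₁_nonneg hst₀ hker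
      have h2 := hc φ hφ
      have h3 := one_le_re_quadForm_one hφ1
      have h4 : c < C := by rw [hC]; linarith [le_abs_self c]
      have h5 : 0 < C := by positivity
      have h6 : (quadForm φ (M.gen₁ 1)).re < C * (quadForm φ 1).re := by nlinarith
      have h7 := mul_lt_mul_of_pos_left h6 he0
      have h8 : ε * (Real.exp (C * t₀') * C) * (quadForm φ 1).re = e * (C * (quadForm φ 1).re) := by
        rw [he]; ring
      linarith
    have hslope := (hasDerivWithinAt_iff_tendsto_slope' (by simp)).1 hq
    obtain ⟨t, ⟨ht, htp⟩, ht0⟩ := ((hslope.eventually (lt_mem_nhds hval)).and hpos').and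
      self_mem_nhdsWithin |>.exists
    have ht0' : t - t₀' < 0 := sub_neg.2 ht0
    rw [slope_def_field] at ht
    have := div_nonpos_of_nonneg_of_nonpos (sub_nonneg.2 (hneg.trans (htp φ))) ht0'.le
    linarith
  intro t ht
  refine posSemidef_of_re_quadForm_nonneg (hherm t ht) fun φ => ?_
  rcases eq_or_ne φ 0 with rfl | hφ
  · simp [quadForm_apply]
  have hlim : Tendsto (fun ε : ℝ => (quadForm (((‖φ‖⁻¹ : ℝ) : ℂ) • φ) (r t)).re
      + ε * Real.exp (C * t) * (quadForm (((‖φ‖⁻¹ : ℝ) : ℂ) • φ) 1).re) (𝓝[>] 0)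
      (𝓝 ((quadForm (((‖φ‖⁻¹ : ℝ) : ℂ) • φ) (r t)).re
      + 0 * Real.exp (C * t) * (quadForm (((‖φ‖⁻¹ : ℝ) : ℂ) • φ) 1).re)) := by
    refine tendsto_nhdsWithin_of_tendsto_nhds (Continuous.tendsto ?_ 0)
    fun_prop
  have h1 := ge_of_tendsto hlim (b := 0) (by
    filter_upwards [self_mem_nhdsWithin] with ε hε
    have := main ε hε t ht (((‖φ‖⁻¹ : ℝ) : ℂ) • φ) (by simp [norm_smul, hφ])
    rw [map_add, map_smul, Complex.add_re, smul_eq_mul, Complex.re_ofReal_mul] at this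
    exact this.le)
  rw [zero_mul, zero_mul, add_zero, quadForm_smul_left] at h1
  exact nonneg_of_mul_nonneg_right h1 (by positivity)

/-- The uniformity of the entrywise norm. It is the usual one, but instances for normed spaces only
recognise it in this form. -/
local instance matrixUniformSpace {D : ℕ} : UniformSpace (Matrix (Fin D) (Fin D) ℂ) :=
  PseudoMetricSpace.toUniformSpace

/-- The topology of the entrywise norm, in the form seen by instances for normed spaces. -/
local instance matrixTopology {D : ℕ} : TopologicalSpace (Matrix (Fin D) (Fin D) ℂ) :=
  PseudoMetricSpace.toUniformSpace.toTopologicalSpace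

local instance matrixCompleteSpace {D : ℕ} : CompleteSpace (Matrix (Fin D) (Fin D) ℂ) :=
  FiniteDimensional.complete ℝ _

/-! ### Mean-field equations over a compact space of sites -/

namespace Model
variable {D m : ℕ} (M : Model D m)

/-- The local generator as a continuous real-linear map. -/
def gen₁L : Matrix (Fin D) (Fin D) ℂ →L[ℝ] Matrix (Fin D) (Fin D) ℂ :=
  LinearMap.toContinuousLinearMap (M.gen₁.restrictScalars ℝ)

theorem gen₁L_apply (ρ : Matrix (Fin D) (Fin D) ℂ) : M.gen₁L ρ = M.gen₁ ρ := rfl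

/-- The collision operator as a continuous real-bilinear map. -/
def collisionL : Matrix (Fin D) (Fin D) ℂ →L[ℝ] Matrix (Fin D) (Fin D) ℂ →L[ℝ]
    Matrix (Fin D) (Fin D) ℂ :=
  (LinearMap.mk₂ ℝ M.collision
    (fun ρ ρ' σ => by simp only [collision, Matrix.add_kronecker, map_add, partialTrace₂_add])
    (fun c ρ σ => by
      rw [← Complex.coe_smul, ← Complex.coe_smul]
      simp only [collision, Matrix.smul_kronecker, map_smul, partialTrace₂_smul])
    (fun ρ σ σ' => by simp only [collision, Matrix.kronecker_add, map_add, partialTrace₂_add])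
    (fun c ρ σ => by
      rw [← Complex.coe_smul, ← Complex.coe_smul]
      simp only [collision, Matrix.kronecker_smul, map_smul,
        partialTrace₂_smul])).toContinuousBilinearMap

theorem collisionL_apply (ρ σ : Matrix (Fin D) (Fin D) ℂ) :
    M.collisionL ρ σ = M.collision ρ σ := rfl

theorem norm_collision_le (ρ σ : Matrix (Fin D) (Fin D) ℂ) :
    ‖M.collision ρ σ‖ ≤ ‖M.collisionL‖ * ‖ρ‖ * ‖σ‖ :=
  M.collisionL.le_opNorm₂ ρ σ

theorem norm_collision_sub_le (ρ σ ρ' σ' : Matrix (Fin D) (Fin D) ℂ) :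
    ‖M.collision ρ σ - M.collision ρ' σ'‖
      ≤ ‖M.collisionL‖ * (‖ρ - ρ'‖ * ‖σ‖ + ‖ρ'‖ * ‖σ - σ'‖) := by
  have h : M.collision ρ σ - M.collision ρ' σ'
      = M.collision (ρ - ρ') σ + M.collision ρ' (σ - σ') := by
    simp only [← collisionL_apply, map_sub, _root_.sub_apply]
    abel
  rw [h]
  refine (norm_add_le _ _).trans ?_
  rw [mul_add, ← mul_assoc, ← mul_assoc]
  exact add_le_add (M.norm_collision_le _ _) (M.norm_collision_le _ _)

/-- Stability of mean-field equations: two families of curves with the same local generator whose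
interaction terms `p`, `q` differ by at most `K` times the largest distance, up to `δ`. -/
theorem norm_sub_le_of_hasDerivWithinAt {X : Type*} {f g p q : X → ℝ → Matrix (Fin D) (Fin D) ℂ}
    {T R K δ₀ δ : ℝ} (hδ : 0 ≤ δ) (hδ₀ : 0 ≤ δ₀)
    (hf : ∀ x, ∀ t ∈ Set.Icc 0 T,
      HasDerivWithinAt (f x) (M.gen₁ (f x t) + p x t) (Set.Icc 0 T) t)
    (hg : ∀ x, ∀ t ∈ Set.Icc 0 T,
      HasDerivWithinAt (g x) (M.gen₁ (g x t) + q x t) (Set.Icc 0 T) t)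
    (hfR : ∀ x, ∀ t ∈ Set.Icc 0 T, ‖f x t‖ ≤ R) (hgR : ∀ x, ∀ t ∈ Set.Icc 0 T, ‖g x t‖ ≤ R)
    (h0 : ∀ x, ‖f x 0 - g x 0‖ ≤ δ₀)
    (hpq : ∀ t ∈ Set.Icc 0 T, ∀ b, (∀ y, ‖f y t - g y t‖ ≤ b) →
      ∀ x, ‖p x t - q x t‖ ≤ K * b + δ) :
    ∀ x, ∀ t ∈ Set.Icc 0 T,
      ‖f x t - g x t‖ ≤ (δ₀ + δ * T) * Real.exp ((‖M.gen₁L‖ + K) * t) := by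
  refine norm_le_mul_exp_of_uniform_deriv_bound (f := fun x t => f x t - g x t) (B := R + R)
    hδ hδ₀ (fun x t ht => (hf x t ht).sub (hg x t ht))
    (fun x t ht => (norm_sub_le _ _).trans (add_le_add (hfR x t ht) (hgR x t ht))) h0 ?_
  intro t ht b hb x
  have h1 : M.gen₁ (f x t) + p x t - (M.gen₁ (g x t) + q x t)
      = M.gen₁L (f x t - g x t) + (p x t - q x t) := by
    rw [map_sub, gen₁L_apply, gen₁L_apply]; abel
  have h2 := (M.gen₁L.le_opNorm (f x t - g x t)).trans
    (mul_le_mul_of_nonneg_left (hb x) (norm_nonneg _))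
  have h3 := hpq t ht b hb x
  have h4 := norm_add_le (M.gen₁L (f x t - g x t)) (p x t - q x t)
  rw [← h1] at h4
  linarith

variable {X : Type*} [TopologicalSpace X] [CompactSpace X]

/-- The pointwise Hermitian conjugate of a field of matrices. -/
def conjField (f : C(X, Matrix (Fin D) (Fin D) ℂ)) : C(X, Matrix (Fin D) (Fin D) ℂ) :=
  ⟨fun x => (f x)ᴴ, f.continuous.matrix_conjTranspose⟩

omit [CompactSpace X] in
theorem conjField_apply (f : C(X, Matrix (Fin D) (Fin D) ℂ)) (x : X) :
    conjField f x = (f x)ᴴ := rfl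

/-- The vector field of the mean-field equation in which site `x` feels the averaged state
`T f x`. -/
def meanFieldVec (T : C(X, Matrix (Fin D) (Fin D) ℂ) →L[ℝ] C(X, Matrix (Fin D) (Fin D) ℂ))
    (f : C(X, Matrix (Fin D) (Fin D) ℂ)) : C(X, Matrix (Fin D) (Fin D) ℂ) :=
  ⟨fun x => M.gen₁L (f x) + M.collisionL (f x) (T f x), by fun_prop⟩

variable (T : C(X, Matrix (Fin D) (Fin D) ℂ) →L[ℝ] C(X, Matrix (Fin D) (Fin D) ℂ))

omit [CompactSpace X] in
theorem meanFieldVec_apply (f : C(X, Matrix (Fin D) (Fin D) ℂ)) (x : X) :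
    M.meanFieldVec T f x = M.gen₁ (f x) + M.collision (f x) (T f x) := rfl

theorem norm_meanFieldVec_sub_le {f g : C(X, Matrix (Fin D) (Fin D) ℂ)} {R : ℝ}
    (hf : ‖f‖ ≤ R) (hg : ‖g‖ ≤ R) :
    ‖M.meanFieldVec T f - M.meanFieldVec T g‖
      ≤ (‖M.gen₁L‖ + 2 * ‖M.collisionL‖ * ‖T‖ * R) * ‖f - g‖ := by
  have hR : 0 ≤ R := (norm_nonneg _).trans hf
  refine (ContinuousMap.norm_le _ (by positivity)).2 fun x => ?_
  have h1 : (M.meanFieldVec T f - M.meanFieldVec T g) x = M.gen₁L (f x - g x)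
      + (M.collision (f x) (T f x) - M.collision (g x) (T g x)) := by
    rw [ContinuousMap.sub_apply, meanFieldVec_apply, meanFieldVec_apply, map_sub, gen₁L_apply,
      gen₁L_apply]
    abel
  have hfg : ‖f x - g x‖ ≤ ‖f - g‖ := (f - g).norm_coe_le_norm x
  have hT : ‖T f x - T g x‖ ≤ ‖T‖ * ‖f - g‖ := by
    rw [← ContinuousMap.sub_apply, ← map_sub]
    exact ((T (f - g)).norm_coe_le_norm x).trans (T.le_opNorm _)
  have hTf : ‖T f x‖ ≤ ‖T‖ * R := ((T f).norm_coe_le_norm x).trans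
    ((T.le_opNorm _).trans (mul_le_mul_of_nonneg_left hf (norm_nonneg _)))
  have hgx : ‖g x‖ ≤ R := (g.norm_coe_le_norm x).trans hg
  rw [h1]
  calc _ ≤ ‖M.gen₁L‖ * ‖f x - g x‖
        + ‖M.collisionL‖ * (‖f x - g x‖ * ‖T f x‖ + ‖g x‖ * ‖T f x - T g x‖) :=
        (norm_add_le _ _).trans (add_le_add (M.gen₁L.le_opNorm _) (M.norm_collision_sub_le _ _ _ _))
    _ ≤ ‖M.gen₁L‖ * ‖f - g‖
        + ‖M.collisionL‖ * (‖f - g‖ * (‖T‖ * R) + R * (‖T‖ * ‖f - g‖)) := by gcongr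
    _ = _ := by ring

theorem hasDerivWithinAt_eval {f : ℝ → C(X, Matrix (Fin D) (Fin D) ℂ)}
    {F : C(X, Matrix (Fin D) (Fin D) ℂ)} {s : Set ℝ} {t : ℝ} (h : HasDerivWithinAt f F s t)
    (x : X) : HasDerivWithinAt (fun u => f u x) (F x) s t :=
  (ContinuousMap.evalCLM (M := Matrix (Fin D) (Fin D) ℂ) ℝ x).hasFDerivAt.comp_hasDerivWithinAt t h

theorem _root_.HasDerivWithinAt.conjTranspose {f : ℝ → Matrix (Fin D) (Fin D) ℂ}
    {A : Matrix (Fin D) (Fin D) ℂ} {s : Set ℝ} {t : ℝ} (h : HasDerivWithinAt f A s t) :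
    HasDerivWithinAt (fun u => (f u)ᴴ) Aᴴ s t :=
  hasDerivWithinAt_matrix.2 fun a b =>
    Complex.conjCLE.hasFDerivAt.comp_hasDerivWithinAt t (hasDerivWithinAt_matrix.1 h b a)

variable {M T}

/-- Solutions of the mean-field equation that start from states consist of states. -/
theorem LocallyPositive.isState_of_hasDerivWithinAt (hM : M.LocallyPositive)
    (hT : ∀ f, T (conjField f) = conjField (T f)) {τ : ℝ}
    {f : ℝ → C(X, Matrix (Fin D) (Fin D) ℂ)}
    (hf : ∀ t ∈ Set.Icc 0 τ, HasDerivWithinAt f (M.meanFieldVec T (f t)) (Set.Icc 0 τ) t)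
    (h0 : ∀ x, IsState (f 0 x)) : ∀ t ∈ Set.Icc 0 τ, ∀ x, IsState (f t x) := by
  have hfx : ∀ x, ∀ t ∈ Set.Icc 0 τ, HasDerivWithinAt (fun t => f t x)
      (M.gen₁ (f t x) + M.collision (f t x) (T (f t) x)) (Set.Icc 0 τ) t :=
    fun x t ht => hasDerivWithinAt_eval (hf t ht) x
  have hfc : ContinuousOn f (Set.Icc 0 τ) := fun t ht => (hf t ht).continuousWithinAt
  obtain ⟨R, hR⟩ := isCompact_Icc.exists_bound_of_continuousOn hfc
  have hRx : ∀ x, ∀ t ∈ Set.Icc 0 τ, ‖f t x‖ ≤ R := fun x t ht =>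
    ((f t).norm_coe_le_norm x).trans (hR t ht)
  -- The Hermitian conjugate solves the same equation with the same initial value.
  have hherm : ∀ x, ∀ t ∈ Set.Icc 0 τ, (f t x)ᴴ = f t x := by
    intro x t ht
    have hstab := M.norm_sub_le_of_hasDerivWithinAt (f := fun x t => f t x)
      (g := fun x t => (f t x)ᴴ) (p := fun x t => M.collision (f t x) (T (f t) x))
      (q := fun x t => (M.collision (f t x) (T (f t) x))ᴴ) (T := τ) (R := R) (δ₀ := 0) (δ := 0)
      (K := 2 * ‖M.collisionL‖ * ‖T‖ * R) le_rfl le_rfl hfx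
      (fun x t ht => by
        have := (hfx x t ht).conjTranspose
        rwa [Matrix.conjTranspose_add, conjTranspose_gen₁] at this)
      hRx (fun x t ht => by rw [Matrix.norm_conjTranspose]; exact hRx x t ht)
      (fun x => by rw [(h0 x).1.1, sub_self, norm_zero])
      (by
        intro t ht b hb x
        have hb0 : 0 ≤ b := (norm_nonneg _).trans (hb x)
        have hR0 : 0 ≤ R := (norm_nonneg _).trans (hR t ht)
        have h1 : ‖f t - conjField (f t)‖ ≤ b := (ContinuousMap.norm_le _ hb0).2 hb
        have h2 : ‖T (f t) x - (T (f t) x)ᴴ‖ ≤ ‖T‖ * b := by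
          have : T (f t) x - (T (f t) x)ᴴ = T (f t - conjField (f t)) x := by
            rw [map_sub, hT]; rfl
          rw [this]
          exact ((T _).norm_coe_le_norm x).trans ((T.le_opNorm _).trans (by gcongr))
        have h3 : ‖T (f t) x‖ ≤ ‖T‖ * R := ((T (f t)).norm_coe_le_norm x).trans
          ((T.le_opNorm _).trans (mul_le_mul_of_nonneg_left (hR t ht) (norm_nonneg _)))
        rw [conjTranspose_collision]
        calc _ ≤ _ := M.norm_collision_sub_le _ _ _ _
          _ ≤ ‖M.collisionL‖ * (b * (‖T‖ * R) + R * (‖T‖ * b)) := by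
            gcongr
            · exact hb x
            · rw [Matrix.norm_conjTranspose]; exact hRx x t ht
          _ = _ := by ring) x t ht
    rw [zero_mul, add_zero, zero_mul] at hstab
    exact (sub_eq_zero.1 (norm_le_zero_iff.1 hstab)).symm
  intro t ht x
  refine ⟨?_, ?_⟩
  · refine hM.posSemidef_of_hasDerivWithinAt (K := fun t => M.meanFieldOp (T (f t) x))
      (fun t ht => ?_) (fun t ht => hherm x t ht) (h0 x).1 t ht
    rw [← collision_eq_commutator]
    exact hfx x t ht
  · have htr : ∀ t ∈ Set.Icc 0 τ,
        HasDerivWithinAt (fun t => (f t x).trace) 0 (Set.Icc 0 τ) t := by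
      intro t ht
      have h1 : HasDerivWithinAt (fun t => (f t x).trace)
          (M.gen₁ (f t x) + M.collision (f t x) (T (f t) x)).trace (Set.Icc 0 τ) t :=
        HasDerivWithinAt.fun_sum fun a _ => hasDerivWithinAt_matrix.1 (hfx x t ht) a a
      rwa [Matrix.trace_add, trace_gen₁, trace_collision, add_zero] at h1
    have := constant_of_has_deriv_right_zero (fun t ht => (htr t ht).continuousWithinAt)
      (fun t ht => (htr t (Set.Ico_subset_Icc_self ht)).mono_of_mem_nhdsWithin
        (Icc_mem_nhdsGE_of_mem ht)) t ht
    rw [this, (h0 x).2]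

/-- The mean-field equation has a solution for all positive times, consisting of states. -/
theorem LocallyPositive.exists_solution (hM : M.LocallyPositive)
    (hT : ∀ f, T (conjField f) = conjField (T f)) {f₀ : C(X, Matrix (Fin D) (Fin D) ℂ)}
    (h0 : ∀ x, IsState (f₀ x)) :
    ∃ f : ℝ → C(X, Matrix (Fin D) (Fin D) ℂ), f 0 = f₀ ∧ ∀ t, 0 ≤ t →
      (∀ x, IsState (f t x)) ∧ HasDerivWithinAt f (M.meanFieldVec T (f t)) (Set.Ici 0) t := by
  have hclosed : IsClosed {f : C(X, Matrix (Fin D) (Fin D) ℂ) | ∀ x, IsState (f x)} := by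
    simp only [Set.ofPred_forall]
    exact isClosed_iInter fun x => isClosed_isState.preimage (continuous_eval_const x)
  exact exists_solution_of_invariant hclosed
    (fun f hf => (ContinuousMap.norm_le _ zero_le_one).2 fun x => (hf x).norm_le_one)
    (K := ‖M.gen₁L‖ + 2 * ‖M.collisionL‖ * ‖T‖ * 3) (by positivity)
    (fun f g hf hg => M.norm_meanFieldVec_sub_le T hf hg)
    (fun τ _ f hf hf0 => hM.isState_of_hasDerivWithinAt hT hf hf0) h0

end Model

/-! ### The interaction kernel and its lattice discretization -/

section Kernel
variable {d : ℕ}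

theorem cube_eq_preimage : cube d = WithLp.ofLp ⁻¹' (Set.Icc (0 : Fin d → ℝ) 1) := by
  ext x
  simp [cube, Set.mem_Icc, Pi.le_def, forall_and]

theorem isCompact_cube : IsCompact (cube d) := by
  rw [cube_eq_preimage]
  exact (EuclideanSpace.equiv (Fin d) ℝ).toHomeomorph.isCompact_preimage.2 isCompact_Icc

instance : CompactSpace (cube d) := isCompact_iff_compactSpace.1 isCompact_cube

theorem measurableSet_cube : MeasurableSet (cube d) := isCompact_cube.isClosed.measurableSet

theorem convex_cube : Convex ℝ (cube d) := by
  rw [cube_eq_preimage]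
  exact (convex_Icc _ _).linear_preimage (EuclideanSpace.equiv (Fin d) ℝ).toLinearMap

theorem zero_mem_cube : (0 : EuclideanSpace ℝ (Fin d)) ∈ cube d := fun i => by simp

theorem volume_cube : volume (cube d) = 1 := by
  rw [cube_eq_preimage, (PiLp.volume_preserving_ofLp (Fin d)).measure_preimage
    measurableSet_Icc.nullMeasurableSet, Real.volume_Icc_pi]
  simp

theorem norm_le_sqrt_mul {z : EuclideanSpace ℝ (Fin d)} {c : ℝ} (hc : 0 ≤ c)
    (h : ∀ i, |z i| ≤ c) : ‖z‖ ≤ √d * c := by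
  rw [EuclideanSpace.norm_eq, Real.sqrt_le_left (by positivity), mul_pow,
    Real.sq_sqrt (by positivity)]
  calc ∑ i, ‖z i‖ ^ 2 ≤ ∑ _i : Fin d, c ^ 2 := by
        gcongr with i
        exact h i
    _ = d * c ^ 2 := by simp

/-- A ball that contains all differences of points of the cube. -/
def differenceBall (d : ℕ) : Set (EuclideanSpace ℝ (Fin d)) := Metric.ball 0 (√d + 1)

theorem sub_mem_differenceBall {x y : EuclideanSpace ℝ (Fin d)} (hx : x ∈ cube d)
    (hy : y ∈ cube d) : x - y ∈ differenceBall d := by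
  rw [differenceBall, mem_ball_zero_iff]
  have : ‖x - y‖ ≤ √d * 1 := norm_le_sqrt_mul zero_le_one fun i => by
    have h1 := hx i
    have h2 := hy i
    rw [PiLp.sub_apply, abs_le]
    constructor <;> linarith [h1.1, h1.2, h2.1, h2.2]
  linarith

/-- The interaction kernel `‖z‖ ^ (-α)`, set to zero at the origin because a site does not
interact with itself. -/
def ker (α : ℝ) (z : EuclideanSpace ℝ (Fin d)) : ℝ := if z = 0 then 0 else (‖z‖ ^ α)⁻¹

variable {α : ℝ}

theorem ker_of_ne {z : EuclideanSpace ℝ (Fin d)} (hz : z ≠ 0) : ker α z = (‖z‖ ^ α)⁻¹ := if_neg hz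

theorem ker_zero : ker α (0 : EuclideanSpace ℝ (Fin d)) = 0 := if_pos rfl

theorem ker_nonneg (z : EuclideanSpace ℝ (Fin d)) : 0 ≤ ker α z := by
  unfold ker
  split_ifs <;> positivity

theorem ker_pos {z : EuclideanSpace ℝ (Fin d)} (hz : z ≠ 0) : 0 < ker α z := by
  rw [ker_of_ne hz]
  have := norm_pos_iff.2 hz
  positivity

theorem ker_neg (z : EuclideanSpace ℝ (Fin d)) : ker α (-z) = ker α z := by
  simp [ker]

theorem measurable_ker : Measurable (ker α : EuclideanSpace ℝ (Fin d) → ℝ) :=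
  Measurable.ite (measurableSet_singleton 0) measurable_const
    (measurable_norm.pow_const α).inv

theorem continuousAt_ker {z : EuclideanSpace ℝ (Fin d)} (hz : z ≠ 0) :
    ContinuousAt (ker α) z := by
  have h : ContinuousAt (fun z : EuclideanSpace ℝ (Fin d) => (‖z‖ ^ α)⁻¹) z := by
    have := norm_pos_iff.2 hz
    exact (continuous_norm.continuousAt.rpow_const (Or.inl this.ne')).inv₀ (by positivity)
  refine h.congr ?_
  filter_upwards [isOpen_ne.mem_nhds hz] with y hy
  exact (ker_of_ne hy).symm

theorem ker_ae_eq (hd : 1 ≤ d) (x : EuclideanSpace ℝ (Fin d)) :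
    (fun y => ker α (x - y)) =ᵐ[volume] fun y => (‖x - y‖ ^ α)⁻¹ := by
  have : Nonempty (Fin d) := ⟨⟨0, hd⟩⟩
  have hx : ∀ᵐ y ∂(volume : Measure (EuclideanSpace ℝ (Fin d))), y ≠ x := by
    simp [ae_iff, measure_singleton]
  filter_upwards [hx] with y hy
  exact ker_of_ne (sub_ne_zero.2 hy.symm)

theorem integrableOn_ker (hd : 1 ≤ d) (hα : α < d) :
    IntegrableOn (ker α) (differenceBall d) := by
  have : Nonempty (Fin d) := ⟨⟨0, hd⟩⟩
  have h1 : IntegrableOn (fun z : EuclideanSpace ℝ (Fin d) => (‖z‖ ^ α)⁻¹) (differenceBall d) := by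
    rw [differenceBall, integrableOn_fun_norm_addHaar volume (f := fun r : ℝ => (r ^ α)⁻¹),
      finrank_euclideanSpace_fin]
    have h2 : IntegrableOn (fun r : ℝ => r ^ ((d : ℝ) - 1 - α)) (Set.Ioo 0 (√d + 1)) :=
      (intervalIntegral.integrableOn_Ioo_rpow_iff (by positivity)).2 (by linarith)
    refine h2.congr_fun (fun r hr => ?_) measurableSet_Ioo
    have hr0 : 0 < r := hr.1
    simp only [smul_eq_mul]
    rw [Real.rpow_sub hr0, div_eq_mul_inv, ← Real.rpow_natCast r (d - 1), Nat.cast_sub hd,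
      Nat.cast_one]
  refine h1.congr (ae_restrict_of_ae ?_)
  have := ker_ae_eq (α := α) hd (0 : EuclideanSpace ℝ (Fin d))
  filter_upwards [this] with y hy
  rw [zero_sub, ker_neg, norm_neg] at hy
  exact hy.symm

theorem integrableOn_comp_sub {F : Type*} [NormedAddCommGroup F]
    {h : EuclideanSpace ℝ (Fin d) → F} (hh : IntegrableOn h (differenceBall d))
    {x : EuclideanSpace ℝ (Fin d)} (hx : x ∈ cube d) :
    IntegrableOn (fun y => h (x - y)) (cube d) := by
  have h1 := ((integrable_indicator_iff Metric.isOpen_ball.measurableSet).2 hh).comp_sub_left x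
  refine h1.integrableOn.congr_fun (fun y hy => ?_) measurableSet_cube
  exact Set.indicator_of_mem (sub_mem_differenceBall hx hy) _

theorem setIntegral_comp_sub_le {h : EuclideanSpace ℝ (Fin d) → ℝ}
    (hh : IntegrableOn h (differenceBall d)) (h0 : ∀ z, 0 ≤ h z)
    {x : EuclideanSpace ℝ (Fin d)} (hx : x ∈ cube d) :
    ∫ y in cube d, h (x - y) ≤ ∫ z in differenceBall d, h z := by
  have hm : MeasurableSet (differenceBall d) := Metric.isOpen_ball.measurableSet
  have h1 := ((integrable_indicator_iff hm).2 hh).comp_sub_left x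
  calc ∫ y in cube d, h (x - y)
      = ∫ y in cube d, (differenceBall d).indicator h (x - y) :=
        setIntegral_congr_fun measurableSet_cube fun y hy =>
          (Set.indicator_of_mem (sub_mem_differenceBall hx hy) _).symm
    _ ≤ ∫ y, (differenceBall d).indicator h (x - y) :=
        setIntegral_le_integral h1 (ae_of_all _ fun y => Set.indicator_nonneg (fun z _ => h0 z) _)
    _ = ∫ z, (differenceBall d).indicator h z := integral_sub_left_eq_self _ volume x
    _ = ∫ z in differenceBall d, h z := integral_indicator hm

theorem integrableOn_ker_smul {F : Type*} [NormedAddCommGroup F] [NormedSpace ℝ F]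
    (hd : 1 ≤ d) (hα : α < d) {x : EuclideanSpace ℝ (Fin d)} (hx : x ∈ cube d)
    {g : EuclideanSpace ℝ (Fin d) → F} (hg : ContinuousOn g (cube d)) :
    IntegrableOn (fun y => ker α (x - y) • g y) (cube d) :=
  (integrableOn_comp_sub (integrableOn_ker hd hα) hx).smul_continuousOn hg isCompact_cube

theorem setIntegral_ker_pos (hd : 1 ≤ d) (hα : α < d) :
    0 < ∫ y in cube d, ker α (0 - y : EuclideanSpace ℝ (Fin d)) := by
  have : Nonempty (Fin d) := ⟨⟨0, hd⟩⟩
  rw [setIntegral_pos_iff_support_of_nonneg_ae (ae_of_all _ fun y => ker_nonneg _)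
    (integrableOn_comp_sub (integrableOn_ker hd hα) zero_mem_cube)]
  have hsub : cube d \ {0} ⊆ Function.support (fun y => ker α (0 - y)) ∩ cube d := by
    rintro y ⟨hy, hy0⟩
    refine ⟨?_, hy⟩
    rw [Function.mem_support, zero_sub, ker_neg]
    exact (ker_pos hy0).ne'
  refine lt_of_lt_of_le ?_ (measure_mono hsub)
  rw [measure_sdiff_null (measure_singleton _), volume_cube]
  exact one_pos

/-! ### Rounding to the grid -/

/-- Rounding of the coordinates down to multiples of `1 / L`. -/
def gridFloor (L : ℕ) (z : EuclideanSpace ℝ (Fin d)) : EuclideanSpace ℝ (Fin d) :=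
  WithLp.toLp 2 fun i => (⌊(L : ℝ) * z i⌋ : ℝ) / L

/-- Rounding of the coordinates up to multiples of `1 / L`. -/
def gridCeil (L : ℕ) (z : EuclideanSpace ℝ (Fin d)) : EuclideanSpace ℝ (Fin d) :=
  WithLp.toLp 2 fun i => (⌈(L : ℝ) * z i⌉ : ℝ) / L

theorem measurable_gridFloor (L : ℕ) :
    Measurable (gridFloor L : EuclideanSpace ℝ (Fin d) → EuclideanSpace ℝ (Fin d)) := by
  refine (PiLp.volume_preserving_toLp (Fin d)).measurable.comp (measurable_pi_lambda _ fun i => ?_)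
  have h1 : Measurable fun z : EuclideanSpace ℝ (Fin d) => (L : ℝ) * z i := by fun_prop
  exact ((measurable_from_top (f := fun n : ℤ => (n : ℝ))).comp
    (Int.measurable_floor.comp h1)).div_const _

theorem norm_sub_gridFloor_le {L : ℕ} (hL : 1 ≤ L) (z : EuclideanSpace ℝ (Fin d)) :
    ‖z - gridFloor L z‖ ≤ √d * (1 / L) := by
  have hL0 : (0 : ℝ) < L := by exact_mod_cast hL
  refine norm_le_sqrt_mul (by positivity) fun i => ?_
  have h1 : (z - gridFloor L z) i = Int.fract (L * z i) / L := by
    simp only [gridFloor, PiLp.sub_apply, Int.fract]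
    field_simp
  rw [h1, abs_of_nonneg (div_nonneg (Int.fract_nonneg _) hL0.le)]
  gcongr
  exact (Int.fract_lt_one _).le

theorem norm_sub_gridCeil_le {L : ℕ} (hL : 1 ≤ L) (z : EuclideanSpace ℝ (Fin d)) :
    ‖gridCeil L z - z‖ ≤ √d * (1 / L) := by
  have : gridCeil L z = -gridFloor L (-z) := by
    ext i
    simp [gridCeil, gridFloor, Int.floor_neg, neg_div]
  rw [this]
  refine le_trans (le_of_eq ?_) (norm_sub_gridFloor_le hL (-z))
  congr 1
  abel

theorem one_div_le_norm_gridFloor {L : ℕ} (hL : 1 ≤ L) {z : EuclideanSpace ℝ (Fin d)}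
    (h : gridFloor L z ≠ 0) : 1 / L ≤ ‖gridFloor L z‖ := by
  have hL0 : (0 : ℝ) < L := by exact_mod_cast hL
  obtain ⟨i, hi⟩ : ∃ i, ⌊(L : ℝ) * z i⌋ ≠ 0 := by
    by_contra! hcon
    refine h ?_
    ext i
    simp [gridFloor, hcon i]
  have h1 : (1 : ℝ) ≤ |(⌊(L : ℝ) * z i⌋ : ℝ)| := by
    exact_mod_cast Int.one_le_abs hi
  refine le_trans ?_ (PiLp.norm_apply_le (gridFloor L z) i)
  simp only [gridFloor, Real.norm_eq_abs, abs_div, Nat.abs_cast]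
  gcongr

theorem gridCeil_mem_cube {L : ℕ} (hL : 1 ≤ L) {y : EuclideanSpace ℝ (Fin d)} (hy : y ∈ cube d) :
    gridCeil L y ∈ cube d := by
  have hL0 : (0 : ℝ) < L := by exact_mod_cast hL
  intro i
  have h1 : (0 : ℤ) ≤ ⌈(L : ℝ) * y i⌉ := Int.ceil_nonneg (mul_nonneg hL0.le (hy i).1)
  have h2 : ⌈(L : ℝ) * y i⌉ ≤ (L : ℤ) := Int.ceil_le.2 (by
    have := mul_le_mul_of_nonneg_left (hy i).2 hL0.le
    simpa using this)
  simp only [gridCeil]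
  refine ⟨div_nonneg (by exact_mod_cast h1) hL0.le, (div_le_one hL0).2 (by exact_mod_cast h2)⟩

/-- On the grid, rounding up commutes with reflection to rounding down. -/
theorem sub_gridCeil {L : ℕ} (hL : 1 ≤ L) {x : EuclideanSpace ℝ (Fin d)}
    (hx : ∀ i, ∃ n : ℤ, (L : ℝ) * x i = n) (y : EuclideanSpace ℝ (Fin d)) :
    x - gridCeil L y = gridFloor L (x - y) := by
  have hL0 : (0 : ℝ) < L := by exact_mod_cast hL
  ext i
  obtain ⟨n, hn⟩ := hx i
  have h1 : (L : ℝ) * (x i - y i) = n + -(L * y i) := by rw [← hn]; ring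
  simp only [gridCeil, gridFloor, PiLp.sub_apply, h1, Int.floor_intCast_add, Int.floor_neg]
  push_cast
  rw [← hn]
  field_simp
  ring

/-- The discretized kernel is dominated uniformly in `L`. For `α ≥ 0` this uses that the
discretized kernel vanishes where `z` is rounded to zero, so that rounding shortens the remaining
vectors by a bounded factor only. -/
theorem ker_gridFloor_le {L : ℕ} (hL : 1 ≤ L) {z : EuclideanSpace ℝ (Fin d)}
    (hz : z ∈ differenceBall d) :
    ker α (gridFloor L z) ≤ (1 + √d) ^ |α| * ker α z + (2 * √d + 1) ^ |α| := by
  have hL1 : (1 : ℝ) ≤ L := by exact_mod_cast hL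
  have hk : 0 ≤ ker α z := ker_nonneg z
  by_cases hp : gridFloor L z = 0
  · rw [hp, ker_zero]
    positivity
  have hp0 := norm_pos_iff.2 hp
  have h1 := norm_sub_gridFloor_le hL z
  have hsd : 0 ≤ √(d : ℝ) := Real.sqrt_nonneg _
  rw [ker_of_ne hp]
  rcases le_total 0 α with hα | hα
  · have h2 : ‖z‖ ≤ (1 + √d) * ‖gridFloor L z‖ := by
      have h3 := norm_le_norm_add_norm_sub' z (gridFloor L z)
      have h4 := mul_le_mul_of_nonneg_left (one_div_le_norm_gridFloor hL hp) hsd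
      linarith
    have hz0 : z ≠ 0 := by
      rintro rfl
      exact hp (by ext i; simp [gridFloor])
    have hz1 := norm_pos_iff.2 hz0
    have h5 : ‖z‖ ^ α ≤ (1 + √d) ^ α * ‖gridFloor L z‖ ^ α := by
      rw [← Real.mul_rpow (by positivity) hp0.le]
      exact Real.rpow_le_rpow hz1.le h2 hα
    rw [ker_of_ne hz0, abs_of_nonneg hα]
    have h6 : (‖gridFloor L z‖ ^ α)⁻¹ ≤ (1 + √d) ^ α * (‖z‖ ^ α)⁻¹ := by
      rw [← div_eq_mul_inv, inv_le_comm₀ (by positivity) (by positivity), inv_div,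
        div_le_iff₀ (by positivity)]
      linarith
    have : 0 ≤ (2 * √(d : ℝ) + 1) ^ α := by positivity
    linarith
  · have h2 : ‖gridFloor L z‖ ≤ 2 * √d + 1 := by
      have h3 := norm_le_norm_add_norm_sub' (gridFloor L z) z
      rw [norm_sub_rev] at h3
      have h4 : ‖z‖ < √d + 1 := mem_ball_zero_iff.1 hz
      have h5 : √(d : ℝ) * (1 / L) ≤ √d * 1 := by
        gcongr
        exact (div_le_one (by linarith)).2 hL1
      linarith
    rw [← Real.rpow_neg hp0.le, abs_of_nonpos hα]
    have h6 := Real.rpow_le_rpow hp0.le h2 (neg_nonneg.2 hα)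
    have : 0 ≤ (1 + √(d : ℝ)) ^ (-α) * ker α z := by positivity
    linarith

theorem integrableOn_ker_bound (hd : 1 ≤ d) (hα : α < d) :
    IntegrableOn (fun z : EuclideanSpace ℝ (Fin d) =>
      (1 + √d) ^ |α| * ker α z + (2 * √d + 1) ^ |α|) (differenceBall d) :=
  ((integrableOn_ker hd hα).const_mul _).add (integrableOn_const (measure_ball_lt_top.ne))

theorem integrableOn_ker_gridFloor (hd : 1 ≤ d) (hα : α < d) {L : ℕ} (hL : 1 ≤ L) :
    IntegrableOn (fun z => ker α (gridFloor L z)) (differenceBall d) := by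
  refine (integrableOn_ker_bound hd hα).mono'
    (measurable_ker.comp (measurable_gridFloor L)).aestronglyMeasurable ?_
  refine (ae_restrict_iff' Metric.isOpen_ball.measurableSet).2 (ae_of_all _ fun z hz => ?_)
  rw [Real.norm_of_nonneg (ker_nonneg _)]
  exact ker_gridFloor_le hL hz

/-- The `L¹` distance of the kernel from its lattice discretization. -/
def kerError (d : ℕ) (α : ℝ) (L : ℕ) : ℝ :=
  ∫ z in differenceBall d, |ker α (gridFloor L z) - ker α z|

theorem tendsto_kerError (hd : 1 ≤ d) (hα : α < d) :
    Tendsto (kerError d α) atTop (𝓝 0) := by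
  have : Nonempty (Fin d) := ⟨⟨0, hd⟩⟩
  have hball : MeasurableSet (differenceBall d) := Metric.isOpen_ball.measurableSet
  have h0 : (0 : ℝ) = ∫ z in differenceBall d, (0 : ℝ) := by simp
  rw [h0]
  unfold kerError
  refine tendsto_integral_filter_of_dominated_convergence
    (fun z => (1 + √d) ^ |α| * ker α z + (2 * √d + 1) ^ |α| + ker α z) ?_ ?_ ?_ ?_
  · refine Eventually.of_forall fun L => ?_
    exact ((measurable_ker.comp (measurable_gridFloor L)).sub
      measurable_ker).abs.aestronglyMeasurable
  · filter_upwards [eventually_ge_atTop 1] with L hL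
    refine (ae_restrict_iff' hball).2 (ae_of_all _ fun z hz => ?_)
    rw [Real.norm_eq_abs, abs_abs]
    refine (abs_sub _ _).trans ?_
    rw [abs_of_nonneg (ker_nonneg _), abs_of_nonneg (ker_nonneg _)]
    gcongr
    exact ker_gridFloor_le hL hz
  · exact (integrableOn_ker_bound hd hα).add (integrableOn_ker hd hα)
  · have hne : ∀ᵐ z ∂(volume.restrict (differenceBall d)), z ≠ 0 :=
      ae_restrict_of_ae (by simp [ae_iff, measure_singleton])
    filter_upwards [hne] with z hz
    have hgrid : Tendsto (fun L : ℕ => gridFloor L z) atTop (𝓝 z) := by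
      rw [tendsto_iff_norm_sub_tendsto_zero]
      have hlim : Tendsto (fun L : ℕ => √(d : ℝ) * (1 / (L : ℝ))) atTop (𝓝 0) := by
        simpa using (tendsto_one_div_atTop_nhds_zero_nat (𝕜 := ℝ)).const_mul √(d : ℝ)
      refine squeeze_zero' (Eventually.of_forall fun _ => norm_nonneg _) ?_ hlim
      filter_upwards [eventually_ge_atTop 1] with L hL
      rw [norm_sub_rev]
      exact norm_sub_gridFloor_le hL z
    have := (((continuousAt_ker (α := α) hz).tendsto.comp hgrid).sub_const (ker α z)).abs
    simpa using this

end Kernel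

/-! ### Lattice sums as integrals of step functions -/

section LatticeSum
variable {d : ℕ} {α : ℝ}

theorem coord_apply {L : ℕ} (j : Site d L) (i : Fin d) : coord j i = ((j i : ℕ) + 1 : ℝ) / L := by
  simp [coord, pos, div_eq_inv_mul]

theorem coord_mem_cube {L : ℕ} (j : Site d L) : coord j ∈ cube d := by
  intro i
  have h1 : ((j i : ℕ) + 1 : ℝ) ≤ L := by exact_mod_cast (j i).2
  have h0 : (0 : ℝ) ≤ (j i : ℕ) + 1 := by positivity
  rw [coord_apply]
  exact ⟨by positivity, div_le_one_of_le₀ h1 (by positivity)⟩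

theorem mul_coord_eq_intCast {L : ℕ} (hL : 1 ≤ L) (j : Site d L) (i : Fin d) :
    ∃ n : ℤ, (L : ℝ) * coord j i = n := by
  have hL0 : (L : ℝ) ≠ 0 := by positivity
  refine ⟨(j i : ℕ) + 1, ?_⟩
  rw [coord_apply]
  push_cast
  field_simp

/-- The cell of side `1 / L` whose upper corner is the site `j`. -/
def cell {L : ℕ} (j : Site d L) : Set (EuclideanSpace ℝ (Fin d)) :=
  WithLp.ofLp ⁻¹' (Set.univ.pi fun i => Set.Ioc (((j i : ℕ) : ℝ) / L) (((j i : ℕ) + 1 : ℝ) / L))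

theorem mem_cell {L : ℕ} {j : Site d L} {y : EuclideanSpace ℝ (Fin d)} :
    y ∈ cell j ↔ ∀ i, y i ∈ Set.Ioc (((j i : ℕ) : ℝ) / L) (((j i : ℕ) + 1 : ℝ) / L) := by
  simp [cell]

theorem measurableSet_cell {L : ℕ} (j : Site d L) : MeasurableSet (cell j) :=
  (PiLp.volume_preserving_ofLp (Fin d)).measurable
    (MeasurableSet.univ_pi fun _ => measurableSet_Ioc)

theorem volume_cell {L : ℕ} (j : Site d L) :
    volume (cell j) = ENNReal.ofReal (((L : ℝ) ^ d)⁻¹) := by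
  rw [cell, (PiLp.volume_preserving_ofLp (Fin d)).measure_preimage
    (MeasurableSet.univ_pi fun _ => measurableSet_Ioc).nullMeasurableSet, Real.volume_pi_Ioc]
  have : ∀ i, (((j i : ℕ) + 1 : ℝ) / L - ((j i : ℕ) : ℝ) / L) = (L : ℝ)⁻¹ := fun i => by
    rw [← sub_div]; simp
  simp only [this]
  rw [Finset.prod_const, Finset.card_univ, Fintype.card_fin, ← ENNReal.ofReal_pow (by positivity),
    inv_pow]

theorem gridCeil_of_mem_cell {L : ℕ} (hL : 1 ≤ L) {j : Site d L} {y : EuclideanSpace ℝ (Fin d)}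
    (hy : y ∈ cell j) : gridCeil L y = coord j := by
  have hL0 : (0 : ℝ) < L := by exact_mod_cast hL
  ext i
  have h := mem_cell.1 hy i
  have h1 : ⌈(L : ℝ) * y i⌉ = ((j i : ℕ) : ℤ) + 1 := by
    rw [Int.ceil_eq_iff]
    have h2 := (div_lt_iff₀ hL0).1 h.1
    have h3 := (le_div_iff₀ hL0).1 h.2
    push_cast
    constructor <;> linarith
  rw [coord_apply]
  simp only [gridCeil, h1]
  push_cast
  rfl

theorem coord_injective {L : ℕ} (hL : 1 ≤ L) :
    Function.Injective (coord : Site d L → EuclideanSpace ℝ (Fin d)) := by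
  have hL0 : (L : ℝ) ≠ 0 := by positivity
  intro j k h
  ext i
  have := congrArg (fun z : EuclideanSpace ℝ (Fin d) => z i) h
  simp only [coord_apply] at this
  field_simp at this
  have h2 : ((j i : ℕ) : ℝ) = (k i : ℕ) := by linarith
  exact_mod_cast h2

theorem iUnion_cell_ae_eq {L : ℕ} (hL : 1 ≤ L) :
    (⋃ j : Site d L, cell j) =ᵐ[volume] cube d := by
  have hL0 : (0 : ℝ) < L := by exact_mod_cast hL
  have h1 : (⋃ j : Site d L, cell j)
      = WithLp.ofLp ⁻¹' (Set.univ.pi fun _ : Fin d => Set.Ioc (0 : ℝ) 1) := by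
    ext y
    simp only [Set.mem_iUnion, mem_cell, Set.mem_preimage, Set.mem_pi, Set.mem_univ,
      forall_true_left]
    constructor
    · rintro ⟨j, hj⟩ i
      have h := hj i
      have h3 : ((j i : ℕ) + 1 : ℝ) ≤ L := by exact_mod_cast (j i).2
      exact ⟨lt_of_le_of_lt (by positivity) h.1, h.2.trans (div_le_one_of_le₀ h3 hL0.le)⟩
    · intro h
      have hpos : ∀ i, 0 < ⌈(L : ℝ) * y i⌉₊ := fun i => Nat.ceil_pos.2 (mul_pos hL0 (h i).1)
      have hle : ∀ i, ⌈(L : ℝ) * y i⌉₊ ≤ L := fun i => Nat.ceil_le.2 (by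
        have := mul_le_mul_of_nonneg_left (h i).2 hL0.le
        simpa using this)
      refine ⟨fun i => ⟨⌈(L : ℝ) * y i⌉₊ - 1, by have := hpos i; have := hle i; omega⟩, fun i => ?_⟩
      have hcast : ((⌈(L : ℝ) * y i⌉₊ - 1 : ℕ) : ℝ) = (⌈(L : ℝ) * y i⌉₊ : ℝ) - 1 := by
        rw [Nat.cast_sub (hpos i), Nat.cast_one]
      simp only [hcast]
      refine ⟨(div_lt_iff₀ hL0).2 ?_, (le_div_iff₀ hL0).2 ?_⟩
      · have := Nat.ceil_lt_add_one (mul_nonneg hL0.le (h i).1.le)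
        linarith
      · have := Nat.le_ceil ((L : ℝ) * y i)
        linarith
  rw [h1, cube_eq_preimage]
  exact (PiLp.volume_preserving_ofLp (Fin d)).quasiMeasurePreserving.preimage_ae_eq
    Measure.univ_pi_Ioc_ae_eq_Icc

variable {F : Type*} [NormedAddCommGroup F] [NormedSpace ℝ F]

omit [NormedSpace ℝ F] in
theorem integrableOn_comp_gridCeil {L : ℕ} (hL : 1 ≤ L) (φ : EuclideanSpace ℝ (Fin d) → F) :
    IntegrableOn (fun y => φ (gridCeil L y)) (cube d) := by
  rw [← integrableOn_congr_set_ae (iUnion_cell_ae_eq hL), integrableOn_finite_iUnion]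
  intro j
  refine (integrableOn_const (C := φ (coord j)) ?_).congr_fun (fun y hy => ?_)
    (measurableSet_cell j)
  · rw [volume_cell]; exact ENNReal.ofReal_ne_top
  · simp only [gridCeil_of_mem_cell hL hy]

theorem setIntegral_comp_gridCeil [CompleteSpace F] {L : ℕ} (hL : 1 ≤ L)
    (φ : EuclideanSpace ℝ (Fin d) → F) :
    ∫ y in cube d, φ (gridCeil L y) = ((L : ℝ) ^ d)⁻¹ • ∑ j : Site d L, φ (coord j) := by
  have hint := integrableOn_comp_gridCeil hL φ
  rw [← integrableOn_congr_set_ae (iUnion_cell_ae_eq hL), integrableOn_finite_iUnion] at hint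
  rw [← setIntegral_congr_set (iUnion_cell_ae_eq hL), integral_iUnion_fintype measurableSet_cell
    ?_ hint, Finset.smul_sum]
  · refine Finset.sum_congr rfl fun j _ => ?_
    rw [setIntegral_congr_fun (measurableSet_cell j)
      (fun y hy => congrArg φ (gridCeil_of_mem_cell hL hy)), setIntegral_const, Measure.real,
      volume_cell, ENNReal.toReal_ofReal (by positivity)]
  · intro j k hjk
    refine Set.disjoint_left.2 fun y hj hk => hjk (coord_injective hL ?_)
    rw [← gridCeil_of_mem_cell hL hj, gridCeil_of_mem_cell hL hk]

/-- The mass of the kernel on the differences of points of the cube. -/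
def kerMass (d : ℕ) (α : ℝ) : ℝ := ∫ z in differenceBall d, ker α (z : EuclideanSpace ℝ (Fin d))

theorem kerMass_nonneg : 0 ≤ kerMass d α := integral_nonneg fun _ => ker_nonneg _

/-- Riemann sums of the singular kernel against a continuous function converge uniformly in the
position of the singularity, as long as this is a lattice point. -/
theorem norm_latticeSum_sub_integral_le [CompleteSpace F] (hd : 1 ≤ d) (hα : α < d) {L : ℕ}
    (hL : 1 ≤ L) {x : EuclideanSpace ℝ (Fin d)} (hx : x ∈ cube d)
    (hxL : ∀ i, ∃ n : ℤ, (L : ℝ) * x i = n) {g : EuclideanSpace ℝ (Fin d) → F}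
    (hg : ContinuousOn g (cube d)) {G ω : ℝ} (hG : ∀ y ∈ cube d, ‖g y‖ ≤ G)
    (hω : ∀ y ∈ cube d, ‖g (gridCeil L y) - g y‖ ≤ ω) :
    ‖((L : ℝ) ^ d)⁻¹ • ∑ k : Site d L, ker α (x - coord k) • g (coord k)
        - ∫ y in cube d, ker α (x - y) • g y‖ ≤ G * kerError d α L + ω * kerMass d α := by
  have hG0 : 0 ≤ G := (norm_nonneg _).trans (hG 0 zero_mem_cube)
  have hω0 : 0 ≤ ω := (norm_nonneg _).trans (hω 0 zero_mem_cube)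
  have herr : IntegrableOn (fun z => |ker α (gridFloor L z) - ker α z|) (differenceBall d) :=
    ((integrableOn_ker_gridFloor hd hα hL).sub (integrableOn_ker hd hα)).abs
  have hker := integrableOn_ker hd hα
  have h1 := setIntegral_comp_sub_le herr (fun z => abs_nonneg _) hx
  have h2 := setIntegral_comp_sub_le hker (fun z => ker_nonneg _) hx
  rw [← setIntegral_comp_gridCeil hL (fun y => ker α (x - y) • g y),
    ← integral_sub (integrableOn_comp_gridCeil hL (fun y => ker α (x - y) • g y))
      (integrableOn_ker_smul hd hα hx hg)]
  calc ‖∫ y in cube d, (ker α (x - gridCeil L y) • g (gridCeil L y) - ker α (x - y) • g y)‖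
      ≤ ∫ y in cube d, (G * |ker α (gridFloor L (x - y)) - ker α (x - y)|
          + ω * ker α (x - y)) := by
        refine norm_integral_le_of_norm_le (((integrableOn_comp_sub herr hx).const_mul G).add
          ((integrableOn_comp_sub hker hx).const_mul ω)) ?_
        refine (ae_restrict_iff' measurableSet_cube).2 (ae_of_all _ fun y hy => ?_)
        rw [sub_gridCeil hL hxL]
        have h3 : ker α (gridFloor L (x - y)) • g (gridCeil L y) - ker α (x - y) • g y
            = (ker α (gridFloor L (x - y)) - ker α (x - y)) • g (gridCeil L y)
              + ker α (x - y) • (g (gridCeil L y) - g y) := by module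
        rw [h3]
        refine (norm_add_le _ _).trans (add_le_add ?_ ?_)
        · rw [norm_smul, Real.norm_eq_abs, mul_comm]
          exact mul_le_mul_of_nonneg_right (hG _ (gridCeil_mem_cube hL hy)) (abs_nonneg _)
        · rw [norm_smul, Real.norm_of_nonneg (ker_nonneg _), mul_comm]
          exact mul_le_mul_of_nonneg_right (hω y hy) (ker_nonneg _)
    _ = G * (∫ y in cube d, |ker α (gridFloor L (x - y)) - ker α (x - y)|)
          + ω * ∫ y in cube d, ker α (x - y) := by
        rw [integral_add ((integrableOn_comp_sub herr hx).const_mul G)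
          ((integrableOn_comp_sub hker hx).const_mul ω), integral_const_mul, integral_const_mul]
    _ ≤ _ := add_le_add (mul_le_mul_of_nonneg_left h1 hG0) (mul_le_mul_of_nonneg_left h2 hω0)

theorem abs_latticeSum_ker_sub_le (hd : 1 ≤ d) (hα : α < d) {L : ℕ} (hL : 1 ≤ L)
    {x : EuclideanSpace ℝ (Fin d)} (hx : x ∈ cube d) (hxL : ∀ i, ∃ n : ℤ, (L : ℝ) * x i = n) :
    |((L : ℝ) ^ d)⁻¹ * ∑ k : Site d L, ker α (x - coord k) - ∫ y in cube d, ker α (x - y)|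
      ≤ kerError d α L := by
  have h := norm_latticeSum_sub_integral_le (F := ℝ) hd hα hL hx hxL (g := fun _ => 1)
    continuousOn_const (G := 1) (ω := 0) (by simp) (by simp)
  simpa using h

theorem latticeSum_ker_le (hd : 1 ≤ d) (hα : α < d) {L : ℕ} (hL : 1 ≤ L)
    {x : EuclideanSpace ℝ (Fin d)} (hx : x ∈ cube d) (hxL : ∀ i, ∃ n : ℤ, (L : ℝ) * x i = n) :
    ((L : ℝ) ^ d)⁻¹ * ∑ k : Site d L, ker α (x - coord k) ≤ kerMass d α + kerError d α L := by
  have h1 := (abs_le.1 (abs_latticeSum_ker_sub_le hd hα hL hx hxL)).2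
  have h2 := setIntegral_comp_sub_le (integrableOn_ker hd hα) (fun z => ker_nonneg _) hx
  unfold kerMass
  linarith

/-! ### The Kac factor -/

theorem coord_ne_zero (hd : 1 ≤ d) {L : ℕ} (hL : 1 ≤ L) (j : Site d L) : coord j ≠ 0 := by
  intro h
  have := congrArg (fun z : EuclideanSpace ℝ (Fin d) => z ⟨0, hd⟩) h
  simp only [coord_apply, PiLp.zero_apply] at this
  have h2 : (0 : ℝ) < ((j ⟨0, hd⟩ : ℕ) + 1 : ℝ) / L := by positivity
  linarith

theorem pos_eq_smul_coord {L : ℕ} (hL : 1 ≤ L) (j : Site d L) : pos j = (L : ℝ) • coord j := by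
  have hL0 : (L : ℝ) ≠ 0 := by positivity
  rw [coord, smul_smul, mul_inv_cancel₀ hL0, one_smul]

/-- The ratio `N ^ (1 - α / d) / c`, whose limit is `θ`. -/
def kacRatio (d : ℕ) (α : ℝ) (L : ℕ) : ℝ := (L : ℝ) ^ ((d : ℝ) - α) / kac d α L

theorem kac_eq (hd : 1 ≤ d) {L : ℕ} (hL : 1 ≤ L) :
    kac d α L = (L : ℝ) ^ ((d : ℝ) - α) *
      (((L : ℝ) ^ d)⁻¹ * ∑ k : Site d L, ker α (0 - coord k)) := by
  have hL0 : (0 : ℝ) < L := by exact_mod_cast hL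
  have h1 : ∀ j : Site d L, (‖pos j‖ ^ α)⁻¹ = ((L : ℝ) ^ α)⁻¹ * ker α (0 - coord j) := by
    intro j
    rw [zero_sub, ker_neg, ker_of_ne (coord_ne_zero hd hL j), pos_eq_smul_coord hL, norm_smul,
      Real.norm_of_nonneg hL0.le, Real.mul_rpow hL0.le (norm_nonneg _), mul_inv]
  simp only [kac, h1]
  rw [← Finset.mul_sum, Real.rpow_sub hL0, Real.rpow_natCast]
  field_simp

theorem kac_pos (hd : 1 ≤ d) {L : ℕ} (hL : 1 ≤ L) : 0 < kac d α L := by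
  refine Finset.sum_pos (fun j _ => ?_) ⟨fun _ => ⟨0, hL⟩, Finset.mem_univ _⟩
  have h : pos j ≠ 0 := by
    rw [pos_eq_smul_coord hL]
    exact smul_ne_zero (by positivity) (coord_ne_zero hd hL j)
  have := norm_pos_iff.2 h
  positivity

/-- The limit `θ(α)`: in the limit the Kac factor is the integral of the kernel over the cube. -/
def theta (d : ℕ) (α : ℝ) : ℝ := (∫ y in cube d, ker α (0 - y : EuclideanSpace ℝ (Fin d)))⁻¹

theorem theta_pos (hd : 1 ≤ d) (hα : α < d) : 0 < theta d α :=
  inv_pos.2 (setIntegral_ker_pos hd hα)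

theorem tendsto_kacRatio (hd : 1 ≤ d) (hα : α < d) :
    Tendsto (kacRatio d α) atTop (𝓝 (theta d α)) := by
  have h1 : Tendsto (fun L : ℕ => ((L : ℝ) ^ d)⁻¹ * ∑ k : Site d L, ker α (0 - coord k)) atTop
      (𝓝 (∫ y in cube d, ker α (0 - y : EuclideanSpace ℝ (Fin d)))) := by
    rw [tendsto_iff_norm_sub_tendsto_zero]
    refine squeeze_zero' (Eventually.of_forall fun _ => norm_nonneg _) ?_ (tendsto_kerError hd hα)
    filter_upwards [eventually_ge_atTop 1] with L hL
    exact abs_latticeSum_ker_sub_le hd hα hL zero_mem_cube fun i => ⟨0, by simp⟩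
  refine (h1.inv₀ (setIntegral_ker_pos hd hα).ne').congr' ?_
  filter_upwards [eventually_ge_atTop 1] with L hL
  have hL0 : (0 : ℝ) < L := by exact_mod_cast hL
  rw [kacRatio, kac_eq hd hL, ← div_div, div_self (by positivity), one_div]

theorem tendsto_kac (hd : 1 ≤ d) (hα : α < d) : Tendsto (kac d α) atTop atTop := by
  have h1 : Tendsto (fun L : ℕ => (L : ℝ) ^ ((d : ℝ) - α)) atTop atTop :=
    (tendsto_rpow_atTop (sub_pos.2 hα)).comp tendsto_natCast_atTop_atTop
  have h2 := h1.atTop_mul_pos (inv_pos.2 (theta_pos hd hα))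
    ((tendsto_kacRatio hd hα).inv₀ (theta_pos hd hα).ne')
  refine h2.congr' ?_
  filter_upwards [eventually_ge_atTop 1] with L hL
  have hL0 : (0 : ℝ) < L := by exact_mod_cast hL
  have := kac_pos (α := α) hd hL
  rw [kacRatio]
  field_simp

theorem rpow_div_kac_eq (hd : 1 ≤ d) (L : ℕ) :
    ((L : ℝ) ^ d) ^ (1 - α / d) / kac d α L = kacRatio d α L := by
  have hd0 : (d : ℝ) ≠ 0 := by positivity
  rw [kacRatio, ← Real.rpow_natCast, ← Real.rpow_mul (Nat.cast_nonneg _)]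
  congr 2
  field_simp

/-- The couplings of the mean-field equations as a discretization of the kernel. -/
theorem inv_kac_mul_siteDist {L : ℕ} (hL : 1 ≤ L) {j k : Site d L} (hjk : k ≠ j) :
    (kac d α L * siteDist j k ^ α)⁻¹
      = kacRatio d α L * (((L : ℝ) ^ d)⁻¹ * ker α (coord j - coord k)) := by
  have hL0 : (0 : ℝ) < L := by exact_mod_cast hL
  have hne : coord j - coord k ≠ 0 := sub_ne_zero.2 fun h => hjk (coord_injective hL h).symm
  rw [ker_of_ne hne, siteDist, pos_eq_smul_coord hL, pos_eq_smul_coord hL, ← smul_sub, norm_smul,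
    Real.norm_of_nonneg hL0.le, Real.mul_rpow hL0.le (norm_nonneg _), kacRatio,
    Real.rpow_sub hL0, Real.rpow_natCast]
  field_simp

theorem kacRatio_nonneg (hd : 1 ≤ d) {L : ℕ} (hL : 1 ≤ L) : 0 ≤ kacRatio d α L :=
  div_nonneg (by positivity) (kac_pos hd hL).le

end LatticeSum

/-! ### The averaging operators -/

section Averaging
variable {d : ℕ} {α : ℝ}

/-- The projection onto the cube, by truncation of the coordinates. -/
def projCube (y : EuclideanSpace ℝ (Fin d)) : cube d :=
  ⟨WithLp.toLp 2 fun i => max 0 (min 1 (y i)),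
    fun _ => ⟨le_max_left _ _, max_le zero_le_one (min_le_left _ _)⟩⟩

theorem continuous_projCube : Continuous (projCube : EuclideanSpace ℝ (Fin d) → cube d) := by
  refine Continuous.subtype_mk ((PiLp.continuous_toLp 2 _).comp ?_) _
  fun_prop

theorem coe_projCube {y : EuclideanSpace ℝ (Fin d)} (hy : y ∈ cube d) :
    (projCube y : EuclideanSpace ℝ (Fin d)) = y := by
  ext i
  simp [projCube, min_eq_right (hy i).2, max_eq_right (hy i).1]

variable {F : Type*} [NormedAddCommGroup F] [NormedSpace ℝ F]

/-- The average of `f` against the kernel centred at `x`. -/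
def kernelAverage (α : ℝ) (f : C(cube d, F)) (x : EuclideanSpace ℝ (Fin d)) : F :=
  ∫ y in cube d, ker α (x - y) • f (projCube y)

theorem integrableOn_kernelAverage (hd : 1 ≤ d) (hα : α < d) (f : C(cube d, F))
    {x : EuclideanSpace ℝ (Fin d)} (hx : x ∈ cube d) :
    IntegrableOn (fun y => ker α (x - y) • f (projCube y)) (cube d) :=
  integrableOn_ker_smul hd hα hx (f.continuous.comp continuous_projCube).continuousOn

theorem norm_kernelAverage_le (hd : 1 ≤ d) (hα : α < d) (f : C(cube d, F))
    {x : EuclideanSpace ℝ (Fin d)} (hx : x ∈ cube d) :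
    ‖kernelAverage α f x‖ ≤ kerMass d α * ‖f‖ := by
  have hk := integrableOn_comp_sub (integrableOn_ker hd hα) hx
  calc ‖kernelAverage α f x‖ ≤ ∫ y in cube d, ker α (x - y) * ‖f‖ := by
        refine norm_integral_le_of_norm_le (hk.mul_const _) (ae_of_all _ fun y => ?_)
        rw [norm_smul, Real.norm_of_nonneg (ker_nonneg _)]
        exact mul_le_mul_of_nonneg_left (f.norm_coe_le_norm _) (ker_nonneg _)
    _ = (∫ y in cube d, ker α (x - y)) * ‖f‖ := integral_mul_const _ _
    _ ≤ kerMass d α * ‖f‖ := mul_le_mul_of_nonneg_right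
        (setIntegral_comp_sub_le (integrableOn_ker hd hα) (fun z => ker_nonneg _) hx)
        (norm_nonneg _)

/-- Moving the position into the argument of `f`, the integrand depends on it only through a
function that is continuous away from the boundary of the cube, a null set. -/
theorem continuous_kernelAverage (hd : 1 ≤ d) (hα : α < d) (f : C(cube d, F)) :
    Continuous fun x : cube d => kernelAverage α f x := by
  set g : EuclideanSpace ℝ (Fin d) → F := fun y => f (projCube y) with hg
  have hgc : Continuous g := f.continuous.comp continuous_projCube
  have heq : ∀ x : cube d, kernelAverage α f x
      = ∫ z in differenceBall d, ker α z • (cube d).indicator g (x - z) := by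
    intro x
    rw [setIntegral_eq_integral_of_forall_compl_eq_zero, kernelAverage,
      ← integral_indicator measurableSet_cube,
      ← integral_sub_left_eq_self _ volume (x : EuclideanSpace ℝ (Fin d))]
    · refine integral_congr_ae (ae_of_all _ fun z => ?_)
      by_cases hz : (x : EuclideanSpace ℝ (Fin d)) - z ∈ cube d
      · simp only [Set.indicator_of_mem hz, sub_sub_cancel, hg]
      · simp only [Set.indicator_of_notMem hz, smul_zero]
    · intro z hz
      rw [Set.indicator_of_notMem, smul_zero]
      intro hxz
      have := sub_mem_differenceBall x.2 hxz
      rw [sub_sub_cancel] at this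
      exact hz this
  simp only [heq]
  refine continuous_iff_continuousAt.2 fun x₀ => ?_
  refine continuousAt_of_dominated (bound := fun z => ker α z * ‖f‖) ?_ ?_
    ((integrableOn_ker hd hα).mul_const _) ?_
  · refine Eventually.of_forall fun x => ?_
    refine measurable_ker.aestronglyMeasurable.smul ?_
    exact ((hgc.stronglyMeasurable.indicator measurableSet_cube).comp_measurable
      (measurable_const.sub measurable_id)).aestronglyMeasurable
  · refine Eventually.of_forall fun x => ae_of_all _ fun z => ?_
    rw [norm_smul, Real.norm_of_nonneg (ker_nonneg _)]
    refine mul_le_mul_of_nonneg_left ?_ (ker_nonneg _)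
    exact (norm_indicator_le_norm_self _ _).trans (f.norm_coe_le_norm _)
  · have hnull : ∀ᵐ z ∂(volume : Measure (EuclideanSpace ℝ (Fin d))),
        (x₀ : EuclideanSpace ℝ (Fin d)) - z ∉ frontier (cube d) := by
      have h1 : ∀ᵐ z ∂(volume : Measure (EuclideanSpace ℝ (Fin d))), z ∉ frontier (cube d) :=
        measure_eq_zero_iff_ae_notMem.1 (convex_cube.addHaar_frontier volume)
      exact (quasiMeasurePreserving_sub_left volume
        (x₀ : EuclideanSpace ℝ (Fin d))).ae h1
    filter_upwards [ae_restrict_of_ae hnull] with z hz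
    refine continuousAt_const.smul ?_
    have hsub : ContinuousAt (fun x : cube d => (x : EuclideanSpace ℝ (Fin d)) - z) x₀ := by
      fun_prop
    refine ContinuousAt.comp (g := (cube d).indicator g) ?_ hsub
    exact hgc.continuousOn.continuousAt_indicator hz

/-- The operator that averages a field on the cube against the kernel. -/
def kernelOp (hd : 1 ≤ d) (hα : α < d) : C(cube d, F) →L[ℝ] C(cube d, F) :=
  LinearMap.mkContinuous
    { toFun := fun f => ⟨fun x => kernelAverage α f x, continuous_kernelAverage hd hα f⟩
      map_add' := fun f g => by
        ext x
        simp only [ContinuousMap.coe_mk, ContinuousMap.add_apply, kernelAverage, smul_add]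
        exact integral_add (integrableOn_kernelAverage hd hα f x.2)
          (integrableOn_kernelAverage hd hα g x.2)
      map_smul' := fun c f => by
        ext x
        simp only [ContinuousMap.coe_mk, ContinuousMap.smul_apply, kernelAverage, RingHom.id_apply,
          smul_comm _ c]
        exact integral_smul _ _ }
    (kerMass d α) fun f => (ContinuousMap.norm_le _ (mul_nonneg kerMass_nonneg (norm_nonneg _))).2
      fun x => norm_kernelAverage_le hd hα f x.2

/-- The operator given by a finite matrix of couplings. -/
def couplingOp {X : Type*} [Fintype X] [TopologicalSpace X] [DiscreteTopology X] (K : X → X → ℝ) :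
    C(X, F) →L[ℝ] C(X, F) :=
  LinearMap.mkContinuous
    { toFun := fun f => ⟨fun x => ∑ y, K x y • f y, continuous_of_discreteTopology⟩
      map_add' := fun f g => by
        ext x
        simp [Finset.sum_add_distrib]
      map_smul' := fun c f => by
        ext x
        simp [Finset.smul_sum, smul_comm _ c] }
    (∑ x, ∑ y, |K x y|) fun f => by
      refine (ContinuousMap.norm_le _ (by positivity)).2 fun x => ?_
      refine (norm_sum_le _ _).trans ?_
      calc ∑ y, ‖K x y • f y‖ ≤ ∑ y, |K x y| * ‖f‖ := by
            gcongr with y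
            rw [norm_smul, Real.norm_eq_abs]
            exact mul_le_mul_of_nonneg_left (f.norm_coe_le_norm y) (abs_nonneg _)
        _ = (∑ y, |K x y|) * ‖f‖ := by rw [Finset.sum_mul]
        _ ≤ _ := by
            refine mul_le_mul_of_nonneg_right ?_ (norm_nonneg _)
            exact Finset.single_le_sum (f := fun x => ∑ y, |K x y|)
              (fun _ _ => Finset.sum_nonneg fun _ _ => abs_nonneg _) (Finset.mem_univ x)

theorem couplingOp_apply {X : Type*} [Fintype X] [TopologicalSpace X] [DiscreteTopology X]
    (K : X → X → ℝ) (f : C(X, F)) (x : X) : couplingOp K f x = ∑ y, K x y • f y := rfl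

theorem sum_erase_inv_kac {L : ℕ} (hL : 1 ≤ L) (j : Site d L) (φ : Site d L → F) :
    ∑ k ∈ Finset.univ.erase j, (kac d α L * siteDist j k ^ α)⁻¹ • φ k
      = ∑ k, (kacRatio d α L * (((L : ℝ) ^ d)⁻¹ * ker α (coord j - coord k))) • φ k := by
  rw [← Finset.sum_erase_add _ _ (Finset.mem_univ j), sub_self, ker_zero, mul_zero, mul_zero,
    zero_smul, add_zero]
  refine Finset.sum_congr rfl fun k hk => ?_
  rw [inv_kac_mul_siteDist hL (Finset.ne_of_mem_erase hk)]

end Averaging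

/-! ### The finite mean-field equations -/

namespace Model
variable {D m : ℕ} (M : Model D m) {d : ℕ} {α : ℝ}

/-- The interaction term of the finite mean-field equations without the Kac ratio: a Riemann sum
of collisions. -/
def latticeCollision (α : ℝ) {L : ℕ} (f : Site d L → Matrix (Fin D) (Fin D) ℂ) (j : Site d L) :
    Matrix (Fin D) (Fin D) ℂ :=
  ((L : ℝ) ^ d)⁻¹ • ∑ k, ker α (coord j - coord k) • M.collision (f j) (f k)

theorem latticeCollision_eq {L : ℕ} (f : Site d L → Matrix (Fin D) (Fin D) ℂ) (j : Site d L) :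
    M.latticeCollision α f j
      = M.collision (f j) (((L : ℝ) ^ d)⁻¹ • ∑ k, ker α (coord j - coord k) • f k) := by
  simp only [latticeCollision, ← collisionL_apply, map_smul, map_sum]

theorem isMeanFieldSolution_iff {L : ℕ} (hL : 1 ≤ L) {ρ₀ : Site d L → Matrix (Fin D) (Fin D) ℂ}
    {r : Site d L → ℝ → Matrix (Fin D) (Fin D) ℂ} :
    M.IsMeanFieldSolution α L ρ₀ r ↔ ∀ j, r j 0 = ρ₀ j ∧ ∀ t : ℝ, 0 ≤ t →
      HasDerivWithinAt (r j) (M.gen₁ (r j t)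
        + kacRatio d α L • M.latticeCollision α (fun k => r k t) j) (Set.Ici 0) t := by
  refine forall_congr' fun j => and_congr_right fun _ => forall_congr' fun t =>
    forall_congr' fun _ => ?_
  refine Iff.trans ?_ hasDerivWithinAt_matrix.symm
  refine forall_congr' fun a => forall_congr' fun b => ?_
  have h : (M.gen₁ (r j t) + kacRatio d α L • M.latticeCollision α (fun k => r k t) j) a b
      = M.gen₁ (r j t) a b + ∑ k ∈ Finset.univ.erase j,
        (kac d α L * siteDist j k ^ α)⁻¹ • M.collision (r j t) (r k t) a b := by
    rw [sum_erase_inv_kac hL]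
    simp only [latticeCollision, Matrix.add_apply, Matrix.smul_apply, Matrix.sum_apply,
      Finset.smul_sum, smul_smul]
  rw [h]

theorem norm_latticeCollision_le (hd : 1 ≤ d) (hα : α < d) {L : ℕ} (hL : 1 ≤ L)
    {f : Site d L → Matrix (Fin D) (Fin D) ℂ} {R : ℝ} (hf : ∀ j, ‖f j‖ ≤ R) (j : Site d L) :
    ‖M.latticeCollision α f j‖ ≤ (kerMass d α + kerError d α L) * (‖M.collisionL‖ * R * R) := by
  have hR : 0 ≤ R := (norm_nonneg _).trans (hf j)
  calc ‖M.latticeCollision α f j‖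
      ≤ ((L : ℝ) ^ d)⁻¹ * ∑ k, ker α (coord j - coord k) * (‖M.collisionL‖ * R * R) := by
        rw [latticeCollision, norm_smul, Real.norm_of_nonneg (by positivity)]
        refine mul_le_mul_of_nonneg_left ((norm_sum_le _ _).trans ?_) (by positivity)
        refine Finset.sum_le_sum fun k _ => ?_
        rw [norm_smul, Real.norm_of_nonneg (ker_nonneg _)]
        refine mul_le_mul_of_nonneg_left ((M.norm_collision_le _ _).trans ?_) (ker_nonneg _)
        have := hf j
        have := hf k
        gcongr
    _ = (((L : ℝ) ^ d)⁻¹ * ∑ k, ker α (coord j - coord k)) * (‖M.collisionL‖ * R * R) := by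
        rw [← Finset.sum_mul]
        ring
    _ ≤ _ := mul_le_mul_of_nonneg_right
        (latticeSum_ker_le hd hα hL (coord_mem_cube j) (mul_coord_eq_intCast hL j)) (by positivity)

theorem norm_latticeCollision_sub_le (hd : 1 ≤ d) (hα : α < d) {L : ℕ} (hL : 1 ≤ L)
    {f g : Site d L → Matrix (Fin D) (Fin D) ℂ} {R b : ℝ} (hf : ∀ j, ‖f j‖ ≤ R)
    (hg : ∀ j, ‖g j‖ ≤ R) (hfg : ∀ j, ‖f j - g j‖ ≤ b) (j : Site d L) :
    ‖M.latticeCollision α f j - M.latticeCollision α g j‖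
      ≤ (kerMass d α + kerError d α L) * (‖M.collisionL‖ * (2 * R)) * b := by
  have hR : 0 ≤ R := (norm_nonneg _).trans (hf j)
  have hb : 0 ≤ b := (norm_nonneg _).trans (hfg j)
  calc ‖M.latticeCollision α f j - M.latticeCollision α g j‖
      ≤ ((L : ℝ) ^ d)⁻¹ * ∑ k, ker α (coord j - coord k) * (‖M.collisionL‖ * (b * R + R * b)) := by
        rw [latticeCollision, latticeCollision, ← smul_sub, norm_smul,
          Real.norm_of_nonneg (by positivity), ← Finset.sum_sub_distrib]
        refine mul_le_mul_of_nonneg_left ((norm_sum_le _ _).trans ?_) (by positivity)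
        refine Finset.sum_le_sum fun k _ => ?_
        rw [← smul_sub, norm_smul, Real.norm_of_nonneg (ker_nonneg _)]
        refine mul_le_mul_of_nonneg_left ((M.norm_collision_sub_le _ _ _ _).trans ?_) (ker_nonneg _)
        have := hfg j
        have := hfg k
        have := hf k
        have := hg j
        gcongr
    _ = (((L : ℝ) ^ d)⁻¹ * ∑ k, ker α (coord j - coord k)) * (‖M.collisionL‖ * (2 * R) * b) := by
        rw [← Finset.sum_mul]
        ring
    _ ≤ (kerMass d α + kerError d α L) * (‖M.collisionL‖ * (2 * R) * b) :=
        mul_le_mul_of_nonneg_right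
          (latticeSum_ker_le hd hα hL (coord_mem_cube j) (mul_coord_eq_intCast hL j))
          (by positivity)
    _ = _ := by ring

variable {M}

theorem IsMeanFieldSolution.eq (hd : 1 ≤ d) (hα : α < d) {L : ℕ} (hL : 1 ≤ L)
    {ρ₀ : Site d L → Matrix (Fin D) (Fin D) ℂ}
    {r r' : Site d L → ℝ → Matrix (Fin D) (Fin D) ℂ} (hr : M.IsMeanFieldSolution α L ρ₀ r)
    (hr' : M.IsMeanFieldSolution α L ρ₀ r') (j : Site d L) {t : ℝ} (ht : 0 ≤ t) :
    r j t = r' j t := by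
  rw [isMeanFieldSolution_iff M hL] at hr hr'
  have hbound : ∀ r : Site d L → ℝ → Matrix (Fin D) (Fin D) ℂ,
      (∀ j, ContinuousOn (r j) (Set.Icc 0 t)) → ∃ R, ∀ j, ∀ s ∈ Set.Icc 0 t, ‖r j s‖ ≤ R := by
    intro r hr
    choose C hC using fun j => isCompact_Icc.exists_bound_of_continuousOn (hr j)
    refine ⟨∑ j, |C j|, fun j s hs => (hC j s hs).trans ((le_abs_self _).trans ?_)⟩
    exact Finset.single_le_sum (f := fun j => |C j|) (fun _ _ => abs_nonneg _) (Finset.mem_univ j)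
  have hcont : ∀ {r : Site d L → ℝ → Matrix (Fin D) (Fin D) ℂ} {p : Site d L → ℝ → _},
      (∀ j, ∀ t : ℝ, 0 ≤ t → HasDerivWithinAt (r j) (p j t) (Set.Ici 0) t) →
      ∀ j, ContinuousOn (r j) (Set.Icc 0 t) := fun h j s hs =>
    ((h j s hs.1).mono Set.Icc_subset_Ici_self).continuousWithinAt
  obtain ⟨R₁, hR₁⟩ := hbound r (hcont fun j => (hr j).2)
  obtain ⟨R₂, hR₂⟩ := hbound r' (hcont fun j => (hr' j).2)
  set R := max R₁ R₂
  have hb := fun j s hs => (hR₁ j s hs).trans (le_max_left R₁ R₂)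
  have hb' := fun j s hs => (hR₂ j s hs).trans (le_max_right R₁ R₂)
  have := M.norm_sub_le_of_hasDerivWithinAt (T := t) (δ := 0) (δ₀ := 0) (R := R)
    (K := kacRatio d α L * ((kerMass d α + kerError d α L) * (‖M.collisionL‖ * (2 * R))))
    le_rfl le_rfl
    (fun j s hs => ((hr j).2 s hs.1).mono Set.Icc_subset_Ici_self)
    (fun j s hs => ((hr' j).2 s hs.1).mono Set.Icc_subset_Ici_self) hb hb'
    (fun j => by rw [(hr j).1, (hr' j).1, sub_self, norm_zero])
    (fun s hs b hbs j => by
      rw [← smul_sub, norm_smul, Real.norm_of_nonneg (kacRatio_nonneg hd hL), add_zero,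
        mul_assoc (kacRatio d α L)]
      exact mul_le_mul_of_nonneg_left (M.norm_latticeCollision_sub_le hd hα hL
        (fun j => hb j s hs) (fun j => hb' j s hs) hbs j) (kacRatio_nonneg hd hL)) j t ⟨ht, le_rfl⟩
  rw [zero_mul, add_zero, zero_mul] at this
  exact sub_eq_zero.1 (norm_le_zero_iff.1 this)

theorem LocallyPositive.exists_isMeanFieldSolution (hM : M.LocallyPositive) {L : ℕ} (hL : 1 ≤ L)
    {ρ₀ : Site d L → Matrix (Fin D) (Fin D) ℂ} (h0 : ∀ j, IsState (ρ₀ j)) :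
    ∃ r, M.IsMeanFieldSolution α L ρ₀ r ∧ ∀ j, ∀ t : ℝ, 0 ≤ t → IsState (r j t) := by
  obtain ⟨f, hf0, hf⟩ := hM.exists_solution (X := Site d L)
    (T := couplingOp fun j k =>
      kacRatio d α L * (((L : ℝ) ^ d)⁻¹ * ker α (coord j - coord k)))
    (fun f => by
      ext j a b
      simp [couplingOp_apply, conjField_apply, Matrix.sum_apply])
    (f₀ := ⟨ρ₀, continuous_of_discreteTopology⟩) h0
  refine ⟨fun j t => f t j, (isMeanFieldSolution_iff M hL).2 fun j => ⟨by rw [hf0]; rfl,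
    fun t ht => ?_⟩, fun j t ht => (hf t ht).1 j⟩
  have h1 := hasDerivWithinAt_eval (hf t ht).2 j
  rw [meanFieldVec_apply, couplingOp_apply] at h1
  refine h1.congr_deriv ?_
  rw [latticeCollision_eq]
  simp only [← collisionL_apply, ← map_smul, Finset.smul_sum, smul_smul]

/-! ### The limit equation -/

/-- The entry functional of matrices as a continuous real-linear map. -/
def entryL (a b : Fin D) : Matrix (Fin D) (Fin D) ℂ →L[ℝ] ℂ :=
  LinearMap.toContinuousLinearMap (Matrix.entryLinearMap ℝ ℂ a b)

variable (M)

theorem integrableOn_collision (hd : 1 ≤ d) (hα : α < d) (A : Matrix (Fin D) (Fin D) ℂ)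
    (f : C(cube d, Matrix (Fin D) (Fin D) ℂ)) {x : EuclideanSpace ℝ (Fin d)} (hx : x ∈ cube d)
    (a b : Fin D) :
    IntegrableOn (fun y => (‖x - y‖ ^ α)⁻¹ • M.collision A (f (projCube y)) a b) (cube d) := by
  have h1 := ((entryL a b).comp (M.collisionL A)).integrable_comp
    (integrableOn_kernelAverage hd hα f hx)
  refine h1.congr (ae_restrict_of_ae ?_)
  filter_upwards [ker_ae_eq (α := α) hd x] with y hy
  rw [ContinuousLinearMap.comp_apply, map_smul, map_smul, hy]
  rfl

theorem integral_collision (hd : 1 ≤ d) (hα : α < d) (A : Matrix (Fin D) (Fin D) ℂ)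
    (f : C(cube d, Matrix (Fin D) (Fin D) ℂ)) {x : EuclideanSpace ℝ (Fin d)} (hx : x ∈ cube d)
    (a b : Fin D) :
    ∫ y in cube d, (‖x - y‖ ^ α)⁻¹ • M.collision A (f (projCube y)) a b
      = M.collision A (kernelAverage α f x) a b := by
  have h1 := ((entryL a b).comp (M.collisionL A)).integral_comp_comm
    (integrableOn_kernelAverage hd hα f hx)
  refine Eq.trans (integral_congr_ae (ae_restrict_of_ae ?_)) h1
  filter_upwards [ker_ae_eq (α := α) hd x] with y hy
  rw [ContinuousLinearMap.comp_apply, map_smul, map_smul, hy]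
  rfl

variable {M}

/-- The limit equation has a solution that consists of states and is a differentiable curve in the
space of continuous fields on the cube. -/
theorem LocallyPositive.exists_limit (hM : M.LocallyPositive) (hd : 1 ≤ d) (hα : α < d)
    {f₀ : C(cube d, Matrix (Fin D) (Fin D) ℂ)} (h0 : ∀ x, IsState (f₀ x)) :
    ∃ f : ℝ → C(cube d, Matrix (Fin D) (Fin D) ℂ), f 0 = f₀ ∧ ∀ t, 0 ≤ t →
      (∀ x, IsState (f t x)) ∧
        HasDerivWithinAt f (M.meanFieldVec (theta d α • kernelOp hd hα) (f t)) (Set.Ici 0) t := by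
  refine hM.exists_solution (fun f => ?_) h0
  ext x a b
  have h1 := (((Complex.conjCLE : ℂ →L[ℝ] ℂ)).comp (entryL b a)).integral_comp_comm
    (integrableOn_kernelAverage hd hα f x.2)
  have h2 := (entryL a b).integral_comp_comm
    (integrableOn_kernelAverage hd hα (conjField f) x.2)
  have h3 : kernelAverage α (conjField f) x a b = star (kernelAverage α f x b a) := by
    refine h2.symm.trans (Eq.trans (integral_congr_ae (ae_of_all _ fun y => ?_)) h1)
    simp only [ContinuousLinearMap.comp_apply, map_smul]
    rfl
  change theta d α • kernelAverage α (conjField f) x a b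
    = star (theta d α • kernelAverage α f x b a)
  rw [h3]
  exact (star_smul (theta d α) (kernelAverage α f x b a)).symm

theorem isLimitSolution_of_hasDerivWithinAt (hd : 1 ≤ d) (hα : α < d)
    {f : ℝ → C(cube d, Matrix (Fin D) (Fin D) ℂ)}
    {R₀ : EuclideanSpace ℝ (Fin d) → Matrix (Fin D) (Fin D) ℂ} (h0 : ∀ x : cube d, f 0 x = R₀ x)
    (hf : ∀ t, 0 ≤ t →
      HasDerivWithinAt f (M.meanFieldVec (theta d α • kernelOp hd hα) (f t)) (Set.Ici 0) t) :
    M.IsLimitSolution α (theta d α) R₀ fun x t => f t (projCube x) := by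
  intro x hx
  refine ⟨(h0 _).trans (by rw [coe_projCube hx]), fun t ht a b =>
    ⟨M.integrableOn_collision hd hα _ _ hx a b, ?_⟩⟩
  have h1 := hasDerivWithinAt_matrix.1 (hasDerivWithinAt_eval (hf t ht) (projCube x)) a b
  refine h1.congr_deriv ?_
  rw [M.integral_collision hd hα _ _ hx, meanFieldVec_apply, Matrix.add_apply]
  congr 1
  change M.collision _ (theta d α • kernelAverage α (f t) (projCube x)) a b = _
  rw [coe_projCube hx, ← collisionL_apply, map_smul]
  rfl

/-- Solutions of the limit equation that consist of states are unique. No measurability of the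
fields is needed: the integrals of the differences are bounded pointwise. -/
theorem IsLimitSolution.eq (hd : 1 ≤ d) (hα : α < d) {θ : ℝ}
    {R₀ : EuclideanSpace ℝ (Fin d) → Matrix (Fin D) (Fin D) ℂ}
    {R R' : EuclideanSpace ℝ (Fin d) → ℝ → Matrix (Fin D) (Fin D) ℂ}
    (hs : ∀ x ∈ cube d, ∀ t : ℝ, 0 ≤ t → IsState (R x t))
    (hs' : ∀ x ∈ cube d, ∀ t : ℝ, 0 ≤ t → IsState (R' x t))
    (hR : M.IsLimitSolution α θ R₀ R) (hR' : M.IsLimitSolution α θ R₀ R')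
    {x : EuclideanSpace ℝ (Fin d)} (hx : x ∈ cube d) {t : ℝ} (ht : 0 ≤ t) : R x t = R' x t := by
  let P : (EuclideanSpace ℝ (Fin d) → ℝ → Matrix (Fin D) (Fin D) ℂ) → cube d → ℝ →
      Matrix (Fin D) (Fin D) ℂ := fun R x s => Matrix.of fun a b =>
    θ • ∫ y in cube d, (‖(x : EuclideanSpace ℝ (Fin d)) - y‖ ^ α)⁻¹ •
      M.collision (R x s) (R y s) a b
  have hderiv : ∀ {R}, M.IsLimitSolution α θ R₀ R → ∀ x : cube d, ∀ s ∈ Set.Icc 0 t,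
      HasDerivWithinAt (R x) (M.gen₁ (R x s) + P R x s) (Set.Icc 0 t) s := by
    intro R hR x s hs
    exact (hasDerivWithinAt_matrix.2 fun a b => ((hR x x.2).2 s hs.1 a b).2).mono
      Set.Icc_subset_Ici_self
  have hP : ∀ s ∈ Set.Icc 0 t, ∀ b, (∀ y : cube d, ‖R y s - R' y s‖ ≤ b) →
      ∀ x : cube d, ‖P R x s - P R' x s‖
        ≤ |θ| * (kerMass d α * (‖M.collisionL‖ * 2)) * b + 0 := by
    intro s hst β hβ x
    have hβ0 : 0 ≤ β := (norm_nonneg _).trans (hβ x)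
    have hk := integrableOn_comp_sub (integrableOn_ker hd hα) x.2
    have hmass := setIntegral_comp_sub_le (integrableOn_ker hd hα) (fun z => ker_nonneg _) x.2
    have hC : 0 ≤ ‖M.collisionL‖ * 2 * β := by positivity
    have hm0 : 0 ≤ kerMass d α := kerMass_nonneg
    rw [add_zero]
    refine (Matrix.norm_le_iff (by positivity)).2 fun a b => ?_
    have h1 : (P R x s - P R' x s) a b
        = θ • ∫ y in cube d, ((‖(x : EuclideanSpace ℝ (Fin d)) - y‖ ^ α)⁻¹ •
            M.collision (R x s) (R y s) a b
          - (‖(x : EuclideanSpace ℝ (Fin d)) - y‖ ^ α)⁻¹ •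
            M.collision (R' x s) (R' y s) a b) := by
      rw [integral_sub ((hR x x.2).2 s hst.1 a b).1 ((hR' x x.2).2 s hst.1 a b).1, smul_sub]
      rfl
    rw [h1, norm_smul, Real.norm_eq_abs]
    calc |θ| * _ ≤ |θ| * ∫ y in cube d, ker α ((x : EuclideanSpace ℝ (Fin d)) - y) *
            (‖M.collisionL‖ * 2 * β) := by
          refine mul_le_mul_of_nonneg_left (norm_integral_le_of_norm_le (hk.mul_const _) ?_)
            (abs_nonneg _)
          filter_upwards [ae_restrict_of_ae (ker_ae_eq (α := α) hd (x : EuclideanSpace ℝ (Fin d))),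
            ae_restrict_mem measurableSet_cube] with y hy hyc
          rw [← hy, ← smul_sub, norm_smul, Real.norm_of_nonneg (ker_nonneg _)]
          refine mul_le_mul_of_nonneg_left ?_ (ker_nonneg _)
          refine (Matrix.norm_entry_le_entrywise_sup_norm
            (M.collision (R x s) (R y s) - M.collision (R' x s) (R' y s))).trans ?_
          refine (M.norm_collision_sub_le _ _ _ _).trans ?_
          have e1 := hβ x
          have e2 := hβ ⟨y, hyc⟩
          have e3 := (hs y hyc s hst.1).norm_le_one
          have e4 := (hs' x x.2 s hst.1).norm_le_one
          calc ‖M.collisionL‖ * (‖R x s - R' x s‖ * ‖R y s‖ + ‖R' x s‖ * ‖R y s - R' y s‖)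
              ≤ ‖M.collisionL‖ * (β * 1 + 1 * β) := by gcongr
            _ = _ := by ring
      _ = |θ| * ((∫ y in cube d, ker α ((x : EuclideanSpace ℝ (Fin d)) - y)) *
            (‖M.collisionL‖ * 2 * β)) := by
          rw [integral_mul_const]
      _ ≤ |θ| * (kerMass d α * (‖M.collisionL‖ * 2 * β)) :=
          mul_le_mul_of_nonneg_left (mul_le_mul_of_nonneg_right hmass hC) (abs_nonneg _)
      _ = _ := by ring
  have := M.norm_sub_le_of_hasDerivWithinAt (X := cube d) (f := fun x => R x) (g := fun x => R' x)
    (T := t) (δ := 0) (δ₀ := 0) (R := 1) le_rfl le_rfl (hderiv hR) (hderiv hR')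
    (fun x s hst => (hs x x.2 s hst.1).norm_le_one) (fun x s hst => (hs' x x.2 s hst.1).norm_le_one)
    (fun x => by rw [(hR x x.2).1, (hR' x x.2).1, sub_self, norm_zero]) hP ⟨x, hx⟩ t ⟨ht, le_rfl⟩
  rw [zero_mul, add_zero, zero_mul] at this
  exact sub_eq_zero.1 (norm_le_zero_iff.1 this)

end Model

/-! ### Convergence along sites -/

section Convergence
variable {d D : ℕ}

theorem TraceNormContinuous.continuousOn {R : EuclideanSpace ℝ (Fin d) → Matrix (Fin D) (Fin D) ℂ}
    (h : TraceNormContinuous R) : ContinuousOn R (cube d) := fun x hx =>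
  tendsto_iff_norm_sub_tendsto_zero.2
    (squeeze_zero (fun _ => norm_nonneg _) (fun _ => norm_le_traceNorm _) (h x hx))

theorem traceNormContinuous_of_continuousOn
    {R : EuclideanSpace ℝ (Fin d) → Matrix (Fin D) (Fin D) ℂ} (h : ContinuousOn R (cube d)) :
    TraceNormContinuous R := by
  intro x hx
  have h1 := (tendsto_iff_norm_sub_tendsto_zero.1 (h x hx)).const_mul
    ((Fintype.card (Fin D) : ℝ) ^ 2)
  rw [mul_zero] at h1
  exact squeeze_zero (fun y => (norm_nonneg (R y - R x)).trans (norm_le_traceNorm _))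
    (fun _ => traceNorm_le_norm _) h1

/-- Convergence along sites to a continuous field is uniform, by compactness of the cube. -/
theorem ConvergesAlongSites.eventually_norm_sub_le
    {r : (L : ℕ) → Site d L → Matrix (Fin D) (Fin D) ℂ}
    {R : EuclideanSpace ℝ (Fin d) → Matrix (Fin D) (Fin D) ℂ} (h : ConvergesAlongSites r R)
    (hR : ContinuousOn R (cube d)) {η : ℝ} (hη : 0 < η) :
    ∀ᶠ L in atTop, ∀ j : Site d L, ‖r L j - R (coord j)‖ ≤ η := by
  suffices ∀ᶠ L in atTop, ∀ j : Site d L, coord j ∈ cube d → ‖r L j - R (coord j)‖ ≤ η from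
    this.mono fun L hL j => hL j (coord_mem_cube j)
  refine isCompact_cube.induction_on
    (p := fun s => ∀ᶠ L in atTop, ∀ j : Site d L, coord j ∈ s → ‖r L j - R (coord j)‖ ≤ η)
    (Eventually.of_forall fun L j hj => hj.elim)
    (fun s t hst ht => ht.mono fun L hL j hj => hL j (hst hj))
    (fun s t hs ht => by
      filter_upwards [hs, ht] with L h1 h2 j hj
      exact hj.elim (h1 j) (h2 j)) fun x hx => ?_
  obtain ⟨δ, hδ, L₀, hL₀⟩ := h x hx (η / 2) (half_pos hη)
  refine ⟨{y | ‖y - x‖ < δ} ∩ {y | ‖R y - R x‖ < η / 2}, inter_mem ?_ ?_, ?_⟩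
  · refine mem_nhdsWithin_of_mem_nhds ?_
    filter_upwards [Metric.ball_mem_nhds x hδ] with y hy using by rwa [← dist_eq_norm]
  · exact (tendsto_iff_norm_sub_tendsto_zero.1 (hR x hx)).eventually_lt_const (half_pos hη)
  · filter_upwards [eventually_ge_atTop L₀] with L hL j hj
    have h1 := (norm_le_traceNorm _).trans (hL₀ L hL j hj.1).le
    have h2 : ‖R (coord j) - R x‖ < η / 2 := hj.2
    calc ‖r L j - R (coord j)‖ = ‖(r L j - R x) - (R (coord j) - R x)‖ := by
          rw [sub_sub_sub_cancel_right]
      _ ≤ η := (norm_sub_le _ _).trans (by linarith)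

theorem convergesAlongSites_of_eventually_norm_sub_le
    {r : (L : ℕ) → Site d L → Matrix (Fin D) (Fin D) ℂ}
    {R : EuclideanSpace ℝ (Fin d) → Matrix (Fin D) (Fin D) ℂ} (hR : ContinuousOn R (cube d))
    (h : ∀ η > 0, ∀ᶠ L in atTop, ∀ j : Site d L, ‖r L j - R (coord j)‖ ≤ η) :
    ConvergesAlongSites r R := by
  intro x hx ε hε
  set C : ℝ := (Fintype.card (Fin D) : ℝ) ^ 2 + 1 with hC
  have hCpos : 0 < C := by positivity
  set η := ε / (2 * C) with hη
  have hηpos : 0 < η := by positivity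
  obtain ⟨δ, hδ, hδR⟩ := Metric.mem_nhdsWithin_iff.1
    ((tendsto_iff_norm_sub_tendsto_zero.1 (hR x hx)).eventually_lt_const hηpos)
  obtain ⟨L₀, hL₀⟩ := eventually_atTop.1 (h η hηpos)
  refine ⟨δ, hδ, L₀, fun L hL j hj => ?_⟩
  have h1 := hL₀ L hL j
  have h2 : ‖R (coord j) - R x‖ < η :=
    hδR ⟨by rwa [Metric.mem_ball, dist_eq_norm], coord_mem_cube j⟩
  have h3 : ‖r L j - R x‖ < 2 * η := by
    calc ‖r L j - R x‖ = ‖(r L j - R (coord j)) + (R (coord j) - R x)‖ := by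
          rw [sub_add_sub_cancel]
      _ < 2 * η := (norm_add_le _ _).trans_lt (by linarith)
  calc traceNorm (r L j - R x) ≤ (Fintype.card (Fin D) : ℝ) ^ 2 * ‖r L j - R x‖ :=
        traceNorm_le_norm _
    _ ≤ C * ‖r L j - R x‖ := mul_le_mul_of_nonneg_right (by linarith) (norm_nonneg _)
    _ < C * (2 * η) := mul_lt_mul_of_pos_left h3 hCpos
    _ = ε := by rw [hη]; field_simp

theorem exists_norm_coord_sub_le {L : ℕ} (hL : 1 ≤ L) {x : EuclideanSpace ℝ (Fin d)}
    (hx : x ∈ cube d) : ∃ j : Site d L, ‖coord j - x‖ ≤ √d * (1 / L) := by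
  have hL0 : (0 : ℝ) < L := by exact_mod_cast hL
  refine ⟨fun i => ⟨min ⌊L * x i⌋₊ (L - 1), by omega⟩, norm_le_sqrt_mul (by positivity) fun i => ?_⟩
  have hx0 : 0 ≤ L * x i := mul_nonneg hL0.le (hx i).1
  have h1 := Nat.floor_le hx0
  have h2 := Nat.lt_floor_add_one (L * x i)
  have h3 : (L : ℝ) * x i ≤ L := mul_le_of_le_one_right hL0.le (hx i).2
  rw [PiLp.sub_apply, coord_apply, div_sub' hL0.ne', abs_div, abs_of_pos hL0,
    div_le_div_iff_of_pos_right hL0, abs_le]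
  rcases le_total ⌊(L : ℝ) * x i⌋₊ (L - 1) with h | h
  · simp only [min_eq_left h]
    constructor <;> linarith
  · have h4 : (L : ℝ) - 1 ≤ ⌊(L : ℝ) * x i⌋₊ := by
      rw [← Nat.cast_pred hL]
      exact_mod_cast h
    simp only [min_eq_right h, Nat.cast_pred hL]
    constructor <;> linarith

theorem ConvergesAlongSites.isState {r : (L : ℕ) → Site d L → Matrix (Fin D) (Fin D) ℂ}
    {R : EuclideanSpace ℝ (Fin d) → Matrix (Fin D) (Fin D) ℂ} (h : ConvergesAlongSites r R)
    (hr : ∀ L j, IsState (r L j)) {x : EuclideanSpace ℝ (Fin d)} (hx : x ∈ cube d) :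
    IsState (R x) := by
  refine isClosed_isState.closure_subset (Metric.mem_closure_iff.2 fun ε hε => ?_)
  obtain ⟨δ, hδ, L₀, hL₀⟩ := h x hx ε hε
  have hlim : Tendsto (fun L : ℕ => √d * (1 / (L : ℝ))) atTop (𝓝 0) := by
    simpa using tendsto_one_div_atTop_nhds_zero_nat.const_mul √(d : ℝ)
  obtain ⟨L, hLδ, hL₀L, hL1⟩ := ((hlim.eventually_lt_const hδ).and
    ((eventually_ge_atTop L₀).and (eventually_ge_atTop 1))).exists
  obtain ⟨j, hj⟩ := exists_norm_coord_sub_le hL1 hx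
  refine ⟨r L j, hr L j, ?_⟩
  rw [dist_comm, dist_eq_norm]
  exact (norm_le_traceNorm _).trans_lt (hL₀ L hL₀L j (hj.trans_lt hLδ))

/-- The fields on a compact piece of a continuous curve are uniformly equicontinuous. -/
theorem exists_uniform_modulus {X F : Type*} [PseudoMetricSpace X] [CompactSpace X]
    [NormedAddCommGroup F] {f : ℝ → C(X, F)} {T : ℝ} (hf : ContinuousOn f (Set.Icc 0 T)) {ω : ℝ}
    (hω : 0 < ω) :
    ∃ δ > 0, ∀ s ∈ Set.Icc 0 T, ∀ x y, dist x y < δ → ‖f s x - f s y‖ ≤ ω := by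
  have hcont : ContinuousOn (fun p : ℝ × X => f p.1 p.2) (Set.Icc 0 T ×ˢ Set.univ) :=
    continuous_eval.comp_continuousOn
      ((hf.comp continuousOn_fst fun p hp => hp.1).prodMk continuousOn_snd)
  obtain ⟨δ, hδ, h⟩ := Metric.uniformContinuousOn_iff.1
    ((isCompact_Icc.prod isCompact_univ).uniformContinuousOn_of_continuous hcont) ω hω
  refine ⟨δ, hδ, fun s hs x y hxy => ?_⟩
  have := h (s, x) ⟨hs, trivial⟩ (s, y) ⟨hs, trivial⟩ (by simpa [Prod.dist_eq, hδ] using hxy)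
  rw [dist_eq_norm] at this
  exact this.le

end Convergence

/-! ### Convergence of the mean-field states -/

namespace Model
variable {D m : ℕ} (M : Model D m) {d : ℕ} {α : ℝ}

/-- Consistency: on the lattice, a field of states that varies by at most `ω` within a grid cell
almost satisfies the finite equations. -/
theorem norm_latticeCollision_sub_limit_le (hd : 1 ≤ d) (hα : α < d) {L : ℕ} (hL : 1 ≤ L)
    {f : C(cube d, Matrix (Fin D) (Fin D) ℂ)} (hf : ∀ x, IsState (f x)) {ω : ℝ}
    (hω : ∀ y ∈ cube d, ‖f (projCube (gridCeil L y)) - f (projCube y)‖ ≤ ω) (j : Site d L) :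
    ‖kacRatio d α L • M.latticeCollision α (fun k => f (projCube (coord k))) j
        - theta d α • M.collision (f (projCube (coord j))) (kernelAverage α f (coord j))‖
      ≤ |kacRatio d α L - theta d α| * ((kerMass d α + kerError d α L) * ‖M.collisionL‖)
        + theta d α * (‖M.collisionL‖ * (kerError d α L + ω * kerMass d α)) := by
  set g : Site d L → Matrix (Fin D) (Fin D) ℂ := fun k => f (projCube (coord k)) with hg
  have hθ := (theta_pos hd hα).le
  have hsplit : kacRatio d α L • M.latticeCollision α g j
        - theta d α • M.collision (f (projCube (coord j))) (kernelAverage α f (coord j))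
      = (kacRatio d α L - theta d α) • M.latticeCollision α g j
        + theta d α • (M.latticeCollision α g j
          - M.collision (f (projCube (coord j))) (kernelAverage α f (coord j))) := by
    rw [sub_smul, smul_sub]
    abel
  have h1 := M.norm_latticeCollision_le hd hα hL (f := g) (fun k => (hf _).norm_le_one) j
  rw [mul_one, mul_one] at h1
  have h2 := norm_latticeSum_sub_integral_le hd hα hL (coord_mem_cube j) (mul_coord_eq_intCast hL j)
    (g := fun y => f (projCube y)) (f.continuous.comp continuous_projCube).continuousOn
    (G := 1) (fun y _ => (hf _).norm_le_one) hω
  rw [one_mul] at h2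
  have h3 : ‖M.latticeCollision α g j
      - M.collision (f (projCube (coord j))) (kernelAverage α f (coord j))‖
      ≤ ‖M.collisionL‖ * (kerError d α L + ω * kerMass d α) := by
    rw [latticeCollision_eq]
    refine (M.norm_collision_sub_le _ _ _ _).trans ?_
    rw [sub_self, norm_zero, zero_mul, zero_add]
    refine mul_le_mul_of_nonneg_left ?_ (norm_nonneg M.collisionL)
    refine (mul_le_of_le_one_left (norm_nonneg _) (hf _).norm_le_one).trans h2
  rw [hsplit]
  refine (norm_add_le _ _).trans (add_le_add ?_ ?_)
  · rw [norm_smul, Real.norm_eq_abs]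
    exact mul_le_mul_of_nonneg_left h1 (abs_nonneg _)
  · rw [norm_smul, Real.norm_of_nonneg hθ]
    exact mul_le_mul_of_nonneg_left h3 hθ

variable {M}

/-- The finite mean-field states converge, uniformly over the sites, to the solution of the limit
equation: consistency and stability. -/
theorem LocallyPositive.eventually_norm_sub_le (hM : M.LocallyPositive) (hd : 1 ≤ d) (hα : α < d)
    {ρ₀ : (L : ℕ) → Site d L → Matrix (Fin D) (Fin D) ℂ} (hρ₀ : ∀ L j, IsState (ρ₀ L j))
    {f : ℝ → C(cube d, Matrix (Fin D) (Fin D) ℂ)}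
    (hf : ∀ t, 0 ≤ t → (∀ x, IsState (f t x)) ∧
      HasDerivWithinAt f (M.meanFieldVec (theta d α • kernelOp hd hα) (f t)) (Set.Ici 0) t)
    (h0 : ∀ η > 0, ∀ᶠ L in atTop, ∀ j : Site d L, ‖ρ₀ L j - f 0 (projCube (coord j))‖ ≤ η)
    {r : (L : ℕ) → Site d L → ℝ → Matrix (Fin D) (Fin D) ℂ}
    (hr : ∀ L : ℕ, 1 ≤ L → M.IsMeanFieldSolution α L (ρ₀ L) (r L)) {T : ℝ} (hT : 0 ≤ T)
    {η : ℝ} (hη : 0 < η) :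
    ∀ᶠ L in atTop, ∀ j : Site d L, ‖r L j T - f T (projCube (coord j))‖ ≤ η := by
  set c := ‖M.collisionL‖ with hc
  set θ := theta d α with hθ_def
  have hθ : 0 < θ := theta_pos hd hα
  have hm : 0 ≤ kerMass d α := kerMass_nonneg
  set K := (θ + 1) * ((kerMass d α + 1) * (c * 2)) with hK
  set A := Real.exp ((‖M.gen₁L‖ + K) * T) with hA
  have hApos : 0 < A := Real.exp_pos _
  set δ := η / (A * (1 + T)) with hδ_def
  have hδ : 0 < δ := by positivity
  set ω := δ / (2 * (θ * c * kerMass d α + 1)) with hω_def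
  have hω : 0 < ω := by positivity
  have hωδ : θ * (c * (ω * kerMass d α)) ≤ δ / 2 := by
    have : 0 ≤ θ * c * kerMass d α := by positivity
    rw [hω_def, ← sub_nonneg]
    have h1 : δ / 2 - θ * (c * (δ / (2 * (θ * c * kerMass d α + 1)) * kerMass d α))
        = δ / (2 * (θ * c * kerMass d α + 1)) := by
      field_simp
      ring
    rw [h1]
    positivity
  obtain ⟨ε, hε, hmod⟩ := exists_uniform_modulus (T := T) (f := f) (fun s hs =>
    ((hf s hs.1).2.mono Set.Icc_subset_Ici_self).continuousWithinAt) hω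
  have hkr : Tendsto (kacRatio d α) atTop (𝓝 θ) := tendsto_kacRatio hd hα
  have hke := tendsto_kerError hd hα
  have hgrid : Tendsto (fun L : ℕ => √d * (1 / (L : ℝ))) atTop (𝓝 0) := by
    simpa using tendsto_one_div_atTop_nhds_zero_nat.const_mul √(d : ℝ)
  have herr : Tendsto (fun L => |kacRatio d α L - θ| * ((kerMass d α + kerError d α L) * c)
      + θ * (c * kerError d α L)) atTop (𝓝 0) := by
    simpa using (((hkr.sub_const θ).abs.mul ((hke.const_add (kerMass d α)).mul_const c)).add
      ((hke.const_mul c).const_mul θ))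
  filter_upwards [eventually_ge_atTop 1, h0 δ hδ, hgrid.eventually_lt_const hε,
    hke.eventually_le_const one_pos, hkr.eventually_le_const (lt_add_one θ),
    herr.eventually_le_const (half_pos hδ)] with L hL hL0 hLε hLe hLk hLerr j
  have hstate : ∀ j, ∀ s, 0 ≤ s → IsState (r L j s) := fun j s hs => by
    obtain ⟨r', hr', hs'⟩ := hM.exists_isMeanFieldSolution (α := α) hL (hρ₀ L)
    rw [(hr L hL).eq hd hα hL hr' j hs]
    exact hs' j s hs
  have hrL := (isMeanFieldSolution_iff M hL).1 (hr L hL)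
  have hstep := M.norm_sub_le_of_hasDerivWithinAt (X := Site d L) (T := T) (R := 1) (K := K)
    (δ₀ := δ) (δ := δ) (f := r L) (g := fun j s => f s (projCube (coord j)))
    (p := fun j s => kacRatio d α L • M.latticeCollision α (fun k => r L k s) j)
    (q := fun j s =>
      θ • M.collision (f s (projCube (coord j))) (kernelAverage α (f s) (coord j)))
    hδ.le hδ.le
    (fun j s hs => ((hrL j).2 s hs.1).mono Set.Icc_subset_Ici_self)
    (fun j s hs => by
      refine ((hasDerivWithinAt_eval (hf s hs.1).2 (projCube (coord j))).mono
        Set.Icc_subset_Ici_self).congr_deriv ?_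
      rw [meanFieldVec_apply]
      change _ + M.collision _ (θ • kernelAverage α (f s) (projCube (coord j))) = _
      rw [coe_projCube (coord_mem_cube j), ← collisionL_apply, map_smul, collisionL_apply])
    (fun j s hs => (hstate j s hs.1).norm_le_one)
    (fun j s hs => ((hf s hs.1).1 _).norm_le_one)
    (fun j => by rw [(hrL j).1]; exact hL0 j)
    (fun s hs b hb j => by
      have hb0 : 0 ≤ b := (norm_nonneg _).trans (hb j)
      have h1 := M.norm_latticeCollision_sub_le hd hα hL (R := 1)
        (fun j => (hstate j s hs.1).norm_le_one) (fun j => ((hf s hs.1).1 _).norm_le_one) hb j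
      rw [mul_one] at h1
      have h2 := M.norm_latticeCollision_sub_limit_le hd hα hL (hf s hs.1).1 (ω := ω)
        (fun y hy => hmod s hs _ _ (by
          rw [Subtype.dist_eq, coe_projCube (gridCeil_mem_cube hL hy), coe_projCube hy,
            dist_eq_norm]
          exact (norm_sub_gridCeil_le hL y).trans_lt hLε)) j
      rw [← sub_add_sub_cancel _
        (kacRatio d α L • M.latticeCollision α (fun k => f s (projCube (coord k))) j), ← smul_sub]
      refine (norm_add_le _ _).trans (add_le_add ?_ (h2.trans ?_))
      · rw [norm_smul, Real.norm_of_nonneg (kacRatio_nonneg hd hL)]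
        have hk0 : 0 ≤ kacRatio d α L := kacRatio_nonneg hd hL
        calc _ ≤ (θ + 1) * ((kerMass d α + 1) * (c * 2) * b) := by
              refine mul_le_mul hLk (h1.trans ?_) (norm_nonneg _) (by positivity)
              gcongr
          _ = K * b := by rw [hK]; ring
      · calc _ = (|kacRatio d α L - θ| * ((kerMass d α + kerError d α L) * c)
              + θ * (c * kerError d α L)) + θ * (c * (ω * kerMass d α)) := by ring
          _ ≤ δ / 2 + δ / 2 := add_le_add hLerr hωδ
          _ = δ := add_halves δ) j T ⟨hT, le_rfl⟩
  refine hstep.trans (le_of_eq ?_)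
  rw [← hA, hδ_def]
  have : 1 + T ≠ 0 := by positivity
  field_simp

end Model

end LongRange

attribute [local instance] Matrix.normedAddCommGroup Matrix.normedSpace
  LongRange.matrixUniformSpace LongRange.matrixTopology LongRange.matrixCompleteSpace

theorem proposition1 {d D m : ℕ} (hd : 1 ≤ d) (α : ℝ) (hα : α < d)
    (M : LongRange.Model D m)
    (hCP : ∀ L : ℕ, 1 ≤ L → LongRange.GeneratesCP (M.fullGen d α L))
    (ρ₀ : (L : ℕ) → LongRange.Site d L → Matrix (Fin D) (Fin D) ℂ)
    (hρ₀ : ∀ L j, LongRange.IsState (ρ₀ L j))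
    (R₀ : EuclideanSpace ℝ (Fin d) → Matrix (Fin D) (Fin D) ℂ)
    (hR₀ : LongRange.TraceNormContinuous R₀)
    (hlim : LongRange.ConvergesAlongSites ρ₀ R₀) :
    ∃ θ : ℝ,
      Tendsto (fun L : ℕ => ((L : ℝ) ^ d) ^ (1 - α / d) / LongRange.kac d α L) atTop (𝓝 θ) ∧
      (∀ L : ℕ, 1 ≤ L →
        (∃ r, M.IsMeanFieldSolution α L (ρ₀ L) r) ∧
        ∀ r, M.IsMeanFieldSolution α L (ρ₀ L) r →
          ∀ j, ∀ t : ℝ, 0 ≤ t → LongRange.IsState (r j t)) ∧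
      ∃ R : EuclideanSpace ℝ (Fin d) → ℝ → Matrix (Fin D) (Fin D) ℂ,
        (∀ x ∈ LongRange.cube d, ∀ t : ℝ, 0 ≤ t → LongRange.IsState (R x t)) ∧
        (∀ t : ℝ, 0 ≤ t → LongRange.TraceNormContinuous (fun x => R x t)) ∧
        M.IsLimitSolution α θ R₀ R ∧
        (∀ r : (L : ℕ) → LongRange.Site d L → ℝ → Matrix (Fin D) (Fin D) ℂ,
          (∀ L : ℕ, 1 ≤ L → M.IsMeanFieldSolution α L (ρ₀ L) (r L)) →
          ∀ t : ℝ, 0 ≤ t →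
            LongRange.ConvergesAlongSites (fun L j => r L j t) (fun x => R x t)) ∧
        (∀ R' : EuclideanSpace ℝ (Fin d) → ℝ → Matrix (Fin D) (Fin D) ℂ,
          (∀ x ∈ LongRange.cube d, ∀ t : ℝ, 0 ≤ t → LongRange.IsState (R' x t)) →
          M.IsLimitSolution α θ R₀ R' →
          ∀ x ∈ LongRange.cube d, ∀ t : ℝ, 0 ≤ t → R' x t = R x t) := by
  have hM : M.LocallyPositive := M.locallyPositive (LongRange.tendsto_kac hd hα) hCP
  have hR₀c : ContinuousOn R₀ (LongRange.cube d) := hR₀.continuousOn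
  obtain ⟨f, hf0, hf⟩ := hM.exists_limit hd hα
    (f₀ := ⟨(LongRange.cube d).domRestrict R₀, hR₀c.domRestrict⟩) fun x => hlim.isState hρ₀ x.2
  have hfx : ∀ x ∈ LongRange.cube d, f 0 (LongRange.projCube x) = R₀ x := fun x hx => by
    rw [hf0]
    exact congrArg R₀ (LongRange.coe_projCube hx)
  have hfc : ∀ t, ContinuousOn (fun x => f t (LongRange.projCube x)) (LongRange.cube d) := fun t =>
    ((f t).continuous.comp LongRange.continuous_projCube).continuousOn
  have hsol := LongRange.Model.isLimitSolution_of_hasDerivWithinAt hd hα (R₀ := R₀)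
    (fun x => by rw [hf0]; rfl) fun t ht => (hf t ht).2
  refine ⟨LongRange.theta d α, ?_, fun L hL => ?_, fun x t => f t (LongRange.projCube x),
    fun x _ t ht => (hf t ht).1 _,
    fun t _ => LongRange.traceNormContinuous_of_continuousOn (hfc t), hsol, fun r hr t ht => ?_,
    fun R' hs' hR' x hx t ht => ?_⟩
  · simp only [LongRange.rpow_div_kac_eq hd]
    exact LongRange.tendsto_kacRatio hd hα
  · obtain ⟨r, hr, hs⟩ := hM.exists_isMeanFieldSolution (α := α) hL (hρ₀ L)
    refine ⟨⟨r, hr⟩, fun r' hr' j t ht => ?_⟩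
    rw [hr'.eq hd hα hL hr j ht]
    exact hs j t ht
  · refine LongRange.convergesAlongSites_of_eventually_norm_sub_le (hfc t) fun η hη =>
      hM.eventually_norm_sub_le hd hα hρ₀ hf (fun η hη => ?_) hr ht hη
    filter_upwards [hlim.eventually_norm_sub_le hR₀c hη] with L hL j
    rw [hfx _ (LongRange.coord_mem_cube j)]
    exact hL j
  · exact hR'.eq hd hα hs' (fun x _ t ht => (hf t ht).1 _) hsol hx ht

end
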